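/- **Definition (fusion ring).** Let $\mathcal X={}_N\mathcal X_N\sqcup{}_N\mathcal X_M\sqcup{}_M\mathcal X_N\sqcup{}_M\mathcal X_M$ be a finite bi-graded set; an element of ${}_P\mathcal X_Q$ has left coefficient $P$ and right coefficient $Q$. A *fusion ring* with basis $\mathcal X$ consists of nonnegative integers $N_{X,Y}^Z$ for $X\in{}_P\mathcal X_Q$, $Y\in{}_Q\mathcal X_R$, $Z\in{}_P\mathcal X_R$ ($P,Q,R\in\{N,M\}$), an involution $X\in{}_P\mathcal X_Q\mapsto\overline X\in{}_Q\mathcal X_P$ with $\overline{\overline X}=X$, and identity objects $1_N\in{}_N\mathcal X_N$, $1_M\in{}_M\mathcal X_M$, such that the bilinear product on $\mathcal A=\mathbb Z\mathcal X$ given by $XY=\sum_{Z\in{}_P\mathcal X_R}N_{X,Y}^Z Z$ (defined for matching coefficients) is associative, $1_N$ and $1_M$ act as left and right identities whenever the product is defined (so $N_{X,1}^Y=\delta_{X,Y}=N_{1,X}^Y$), and Frobenius reciprocity holds: $$N_{X,Y}^Z=N_{Z,\overline Y}^X=N_{\overline X,Z}^Y=N_{\overline Y,\overline X}^{\overline Z}=N_{\overline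 Z,X}^{\overline Y}=N_{Y,\overline Z}^{\overline X}.$$ **The graphs.** Let $k\ge 0$ and $n=4k+3$. The graph $\Gamma_k$ has vertices $\alpha_0,\dots,\alpha_n,\beta_1,\beta_2,\beta_3,\gamma_1,\gamma_2,\gamma_3$ and consists of the three paths $\alpha_0-\alpha_1-\cdots-\alpha_n$, $\alpha_n-\beta_1-\beta_2-\beta_3$ and $\alpha_n-\gamma_1-\gamma_2-\gamma_3$. The graph $\Gamma'_k$ has vertices $\alpha'_j$ ($0\le j\le n$, $j$ even), $\overline{\alpha_j}$ ($0\le j\le n$, $j$ odd), $f,g,\overline{\beta_2},\overline{\gamma_2}$ and consists of the path $\alpha'_0-\overline{\alpha_1}-\alpha'_2-\cdots-\alpha'_{n-1}-\overline{\alpha_n}$ and the edges $\overline{\alpha_n}-f$, $\overline{\alpha_n}-g$, $g-\overline{\beta_2}$, $g-\overline{\gamma_2}$. A vertex is even or odd according to its distance from $\alpha_0$, respectively $\alpha'_0$. Let $V_{11}$ and $V_{12}$ be the sets of even and odd vertices of $\Gamma_k$, and $V_{21}$ and $V_{22}$ the sets of odd and even vertices of $\Gamma'_k$. **Theorem 1.1.**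 For every $k\ge 0$ there is exactly one fusion ring with ${}_N\mathcal X_N=V_{11}$, ${}_N\mathcal X_M=V_{12}$, ${}_M\mathcal X_N=V_{21}$, ${}_M\mathcal X_M=V_{22}$ (that is, exactly one choice of coefficients $N_{X,Y}^Z$, involution and identity objects on these sets) that is compatible with $(\Gamma_k,\Gamma'_k)$ in the following sense: * $1_N=\alpha_0$ and $1_M=\alpha'_0$; * the involution sends each of the odd vertices $\alpha_1,\alpha_3,\dots,\alpha_n,\beta_2,\gamma_2$ of $\Gamma_k$ to the odd vertex of $\Gamma'_k$ denoted by the same symbol with a bar; * whenever the coefficients match (i.e. for $(X,Y)\in V_{11}\times V_{12}$ or $V_{21}\times V_{22}$ in the case of $\alpha_1$, and for $(X,Y)\in V_{12}\times V_{11}$ or $V_{22}\times V_{21}$ in the case of $\overline{\alpha_1}$), $N_{X,\alpha_1}^Y$, respectively $N_{X,\overline{\alpha_1}}^Y$, is $1$ if $X$ and $Y$ are connected by an edge of $\Gamma_k$ or $\Gamma'_k$, and $0$ otherwise. -/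

import Mathlib

open scoped BigOperators

/-- The two coefficient labels `N` and `M`. -/
inductive Side : Type
  | N
  | M
  deriving DecidableEq

/-- The product on the free `ℤ`-module `ℤX` (elements are written as coefficient vectors) determined
by structure constants `c`: the bilinear extension of `x * y = ∑ z, c x y z • z`. -/
def gradedProd {X : Side → Side → Type} [∀ P Q, Fintype (X P Q)]
    (c : ∀ ⦃P Q R : Side⦄, X P Q → X Q R → X P R → ℕ) {P Q R : Side}
    (a : X P Q → ℤ) (b : X Q R → ℤ) : X P R → ℤ :=
  fun z => ∑ x, ∑ y, a x * b y * (c x y z : ℤ)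

/-- A fusion ring with finite bi-graded basis `X`; `X P Q` consists of the basis elements with left
coefficient `P` and right coefficient `Q`. It is the bi-graded associative `ℤ`-algebra `ℤX` with
`x * y = ∑ z, N x y z • z` for `x : X P Q`, `y : X Q R` (the sum over `z : X P R`), with
nonnegative integers `N x y z`, an involution on the basis, Frobenius reciprocity, and two
identity objects in the basis. -/
@[ext]
structure FusionRing (X : Side → Side → Type) [∀ P Q, Fintype (X P Q)]
    [∀ P Q, DecidableEq (X P Q)] where
  /-- the fusion coefficients -/
  N : ∀ ⦃P Q R : Side⦄, X P Q → X Q R → X P R → ℕ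
  /-- the involution on the basis -/
  conj : ∀ ⦃P Q : Side⦄, X P Q → X Q P
  /-- the identity objects -/
  one : ∀ P : Side, X P P
  mul_assoc : ∀ ⦃P Q R S : Side⦄ (a : X P Q → ℤ) (b : X Q R → ℤ) (c : X R S → ℤ),
    gradedProd N (gradedProd N a b) c = gradedProd N a (gradedProd N b c)
  conj_conj : ∀ ⦃P Q : Side⦄ (x : X P Q), conj (conj x) = x
  frobenius₁ : ∀ ⦃P Q R : Side⦄ (x : X P Q) (y : X Q R) (z : X P R),
    N x y z = N z (conj y) x
  frobenius₂ : ∀ ⦃P Q R : Side⦄ (x : X P Q) (y : X Q R) (z : X P R),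
    N x y z = N (conj x) z y
  frobenius₃ : ∀ ⦃P Q R : Side⦄ (x : X P Q) (y : X Q R) (z : X P R),
    N x y z = N (conj y) (conj x) (conj z)
  frobenius₄ : ∀ ⦃P Q R : Side⦄ (x : X P Q) (y : X Q R) (z : X P R),
    N x y z = N (conj z) x (conj y)
  frobenius₅ : ∀ ⦃P Q R : Side⦄ (x : X P Q) (y : X Q R) (z : X P R),
    N x y z = N y (conj z) (conj x)
  mul_one : ∀ ⦃P Q : Side⦄ (x y : X P Q), N x (one Q) y = if x = y then 1 else 0
  one_mul : ∀ ⦃P Q : Side⦄ (x y : X P Q), N (one P) x y = if x = y then 1 else 0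

/-- The vertices of `Γ_k`, where `n = 4k+3`: `α_0, …, α_n` and `β_1, β_2, β_3, γ_1, γ_2, γ_3`. -/
inductive GVertex (k : ℕ) : Type
  | alpha (j : Fin (4 * k + 4))
  | beta1
  | beta2
  | beta3
  | gamma1
  | gamma2
  | gamma3
  deriving DecidableEq, Fintype

/-- The edges of `Γ_k`, each in one direction: the path `α_0 - α_1 - ⋯ - α_n` and, attached to
`α_n`, the two legs `α_n - β_1 - β_2 - β_3` and `α_n - γ_1 - γ_2 - γ_3`. -/
def GVertex.Edge {k : ℕ} : GVertex k → GVertex k → Prop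
  | .alpha i, .alpha j => (i : ℕ) + 1 = (j : ℕ)
  | .alpha i, .beta1 => (i : ℕ) = 4 * k + 3
  | .beta1, .beta2 => True
  | .beta2, .beta3 => True
  | .alpha i, .gamma1 => (i : ℕ) = 4 * k + 3
  | .gamma1, .gamma2 => True
  | .gamma2, .gamma3 => True
  | _, _ => False

/-- The graph `Γ_k`. -/
def GammaGraph (k : ℕ) : SimpleGraph (GVertex k) := SimpleGraph.fromRel GVertex.Edge

/-- The distance of a vertex of `Γ_k` from `α_0`; a vertex is even or odd according to it. -/
def GVertex.depth {k : ℕ} : GVertex k → ℕ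
  | .alpha j => j
  | .beta1 => 4 * k + 4
  | .beta2 => 4 * k + 5
  | .beta3 => 4 * k + 6
  | .gamma1 => 4 * k + 4
  | .gamma2 => 4 * k + 5
  | .gamma3 => 4 * k + 6

/-- The vertices of `Γ'_k`. Here `alpha' j` is `α'_j` for even `j` and `ᾱ_j` for odd `j`
(`0 ≤ j ≤ n = 4k+3`), and `beta2bar`, `gamma2bar` are the vertices named `β̄_2`, `γ̄_2`. -/
inductive GVertex' (k : ℕ) : Type
  | alpha' (j : Fin (4 * k + 4))
  | f
  | g
  | beta2bar
  | gamma2bar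
  deriving DecidableEq, Fintype

/-- The edges of `Γ'_k`, each in one direction: the path `α'_0 - ᾱ_1 - α'_2 - ⋯ - ᾱ_n`, the edges
`ᾱ_n - f` and `ᾱ_n - g`, and the edges `g - β̄_2` and `g - γ̄_2`. -/
def GVertex'.Edge {k : ℕ} : GVertex' k → GVertex' k → Prop
  | .alpha' i, .alpha' j => (i : ℕ) + 1 = (j : ℕ)
  | .alpha' i, .f => (i : ℕ) = 4 * k + 3
  | .alpha' i, .g => (i : ℕ) = 4 * k + 3
  | .g, .beta2bar => True
  | .g, .gamma2bar => True
  | _, _ => False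

/-- The graph `Γ'_k`. -/
def GammaGraph' (k : ℕ) : SimpleGraph (GVertex' k) := SimpleGraph.fromRel GVertex'.Edge

/-- The distance of a vertex of `Γ'_k` from `α'_0`; a vertex is even or odd according to it. -/
def GVertex'.depth {k : ℕ} : GVertex' k → ℕ
  | .alpha' j => j
  | .f => 4 * k + 4
  | .g => 4 * k + 4
  | .beta2bar => 4 * k + 5
  | .gamma2bar => 4 * k + 5

/-- The bi-graded set `V = V₁₁ ⊔ V₁₂ ⊔ V₂₁ ⊔ V₂₂` of vertices: `V₁₁` (resp. `V₁₂`) are the even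
(resp. odd) vertices of `Γ_k`, and `V₂₂` (resp. `V₂₁`) the even (resp. odd) vertices of `Γ'_k`. -/
def V (k : ℕ) : Side → Side → Type
  | .N, .N => {v : GVertex k // Even v.depth}
  | .N, .M => {v : GVertex k // Odd v.depth}
  | .M, .N => {v : GVertex' k // Odd v.depth}
  | .M, .M => {v : GVertex' k // Even v.depth}

instance (k : ℕ) : ∀ P Q : Side, Fintype (V k P Q)
  | .N, .N => inferInstanceAs (Fintype {v : GVertex k // Even v.depth})
  | .N, .M => inferInstanceAs (Fintype {v : GVertex k // Odd v.depth})
  | .M, .N => inferInstanceAs (Fintype {v : GVertex' k // Odd v.depth})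
  | .M, .M => inferInstanceAs (Fintype {v : GVertex' k // Even v.depth})

instance (k : ℕ) : ∀ P Q : Side, DecidableEq (V k P Q)
  | .N, .N => inferInstanceAs (DecidableEq {v : GVertex k // Even v.depth})
  | .N, .M => inferInstanceAs (DecidableEq {v : GVertex k // Odd v.depth})
  | .M, .N => inferInstanceAs (DecidableEq {v : GVertex' k // Odd v.depth})
  | .M, .M => inferInstanceAs (DecidableEq {v : GVertex' k // Even v.depth})

namespace V

variable {k : ℕ}

/-- The vertex of `Γ_k` underlying an element of `V₁₁`. -/
def v11 (x : V k .N .N) : GVertex k := Subtype.val (p := fun v : GVertex k => Even v.depth) x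

/-- The vertex of `Γ_k` underlying an element of `V₁₂`. -/
def v12 (x : V k .N .M) : GVertex k := Subtype.val (p := fun v : GVertex k => Odd v.depth) x

/-- The vertex of `Γ'_k` underlying an element of `V₂₁`. -/
def v21 (x : V k .M .N) : GVertex' k := Subtype.val (p := fun v : GVertex' k => Odd v.depth) x

/-- The vertex of `Γ'_k` underlying an element of `V₂₂`. -/
def v22 (x : V k .M .M) : GVertex' k := Subtype.val (p := fun v : GVertex' k => Even v.depth) x

variable (k)

/-- `α_0 ∈ V₁₁`. -/
def alpha0 : V k .N .N := ⟨GVertex.alpha 0, by simp [GVertex.depth]⟩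

/-- `α'_0 ∈ V₂₂`. -/
def alpha0' : V k .M .M := ⟨GVertex'.alpha' 0, by simp [GVertex'.depth]⟩

/-- `α_j ∈ V₁₂` for odd `j`. -/
def alphaOdd (j : Fin (4 * k + 4)) (hj : Odd (j : ℕ)) : V k .N .M := ⟨GVertex.alpha j, hj⟩

/-- `ᾱ_j ∈ V₂₁` for odd `j`. -/
def alphaOddBar (j : Fin (4 * k + 4)) (hj : Odd (j : ℕ)) : V k .M .N := ⟨GVertex'.alpha' j, hj⟩

/-- `α_1 ∈ V₁₂`. -/
def alpha1 : V k .N .M := alphaOdd k ⟨1, by omega⟩ odd_one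

/-- `ᾱ_1 ∈ V₂₁`. -/
def alpha1Bar : V k .M .N := alphaOddBar k ⟨1, by omega⟩ odd_one

/-- `β_2 ∈ V₁₂`. -/
def beta2 : V k .N .M := ⟨GVertex.beta2, ⟨2 * k + 2, by simp only [GVertex.depth]; ring⟩⟩

/-- `γ_2 ∈ V₁₂`. -/
def gamma2 : V k .N .M := ⟨GVertex.gamma2, ⟨2 * k + 2, by simp only [GVertex.depth]; ring⟩⟩

/-- `β̄_2 ∈ V₂₁`. -/
def beta2Bar : V k .M .N := ⟨GVertex'.beta2bar, ⟨2 * k + 2, by simp only [GVertex'.depth]; ring⟩⟩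

/-- `γ̄_2 ∈ V₂₁`. -/
def gamma2Bar : V k .M .N := ⟨GVertex'.gamma2bar, ⟨2 * k + 2, by simp only [GVertex'.depth]; ring⟩⟩

end V

open Classical in
/-- A fusion ring with basis `V` is compatible with `(Γ_k, Γ'_k)`: the identity objects are `α_0`
and `α'_0`, the odd vertices of `Γ'_k` that are named with a bar are the conjugates of the odd
vertices of `Γ_k` of that name, and right multiplication by `α_1` and by `ᾱ_1` is given by the
edges of the two graphs. -/
structure GraphCompatible (k : ℕ) (F : FusionRing (V k)) : Prop where
  one_N : F.one .N = V.alpha0 k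
  one_M : F.one .M = V.alpha0' k
  conj_alpha : ∀ (j : Fin (4 * k + 4)) (hj : Odd (j : ℕ)),
    F.conj (V.alphaOdd k j hj) = V.alphaOddBar k j hj
  conj_beta2 : F.conj (V.beta2 k) = V.beta2Bar k
  conj_gamma2 : F.conj (V.gamma2 k) = V.gamma2Bar k
  edge_NN : ∀ (x : V k .N .N) (y : V k .N .M),
    F.N x (V.alpha1 k) y = if (GammaGraph k).Adj x.v11 y.v12 then 1 else 0
  edge_NM : ∀ (x : V k .N .M) (y : V k .N .N),
    F.N x (V.alpha1Bar k) y = if (GammaGraph k).Adj x.v12 y.v11 then 1 else 0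
  edge_MN : ∀ (x : V k .M .N) (y : V k .M .M),
    F.N x (V.alpha1 k) y = if (GammaGraph' k).Adj x.v21 y.v22 then 1 else 0
  edge_MM : ∀ (x : V k .M .M) (y : V k .M .N),
    F.N x (V.alpha1Bar k) y = if (GammaGraph' k).Adj x.v22 y.v21 then 1 else 0

/-! All four graded pieces are put into one rational vector space whose basis is the set of all
vertices of both graphs. A fusion ring then becomes an algebra of matrices, the right
multiplications; transposition is the bar involution, and conjugating by that involution gives the
left multiplications, which must commute with the right ones. Right multiplication by α_1 + ᾱ_1 is
the adjacency matrix A, and right multiplication by α_0 is a projection. Since α_j = U_j(A) α_0 for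
the Chebyshev polynomials U_j, these two matrices reach every vector that is symmetric under
exchange of the legs. The only missing datum is D, right multiplication by β_1 - γ_1.

Existence. The involution has to fix β_1, γ_1 and exchange β_3, γ_3. As (A² - 1)(β_1 - γ_1) = β_3 -
γ_3, transposing shows that D anticommutes with A² - 1, so D exchanges the eigenvalues 0 and 2 of
A². This suggests an explicit sum of rank-one matrices in such eigenvectors, `antiM`. The three
matrices commute with their conjugates and the identity vector is cyclic for them (`generates`); the
lemmas on `Generates` turn this into an associative product with Frobenius reciprocity.

It remains to see that the structure constants are natural numbers. For α_j and α'_j they are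
entries of U_j(A). The vectors U_m(A)x solve a discrete wave equation: on the long path the wave
only travels towards the far end, and at the branch it is given by Tribonacci numbers, whence
nonnegativity (`natV_cheb`). The matrix D brings in denominators; for β_3 they cancel because of
residues of Tribonacci numbers modulo 4 (`exists_nat_leg`, `good_b3`). Associativity and reciprocity
carry this to all vertices but f, and the coefficient of f in f·f is computed by hand
(`coef_vf_vf_vf`).

Uniqueness. In any compatible ring U_m(A)·1 is self-conjugate, which determines the involution up to
two choices: whether β_1, γ_1 are exchanged (excluded by parity, `GraphModel.K_b1`) and whether β_3,
γ_3 are fixed (excluded by commutation of left and right multiplication, `GraphModel.K_b3`). Right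
multiplication by β_1 - γ_1 then has the properties collected in `IsAnti`, which have only one
solution (`IsAnti.unique`), so all right multiplications are known (`GraphModel.matV_eq_R`). -/

open Matrix

/-! ### The vertices of both graphs as one set: grading, adjacency, conjugation. -/

/-- All vertices of the two graphs `Γ_k` and `Γ'_k`. -/
abbrev Vtx (k : ℕ) := GVertex k ⊕ GVertex' k

namespace Vtx

variable {k : ℕ}

/-- The vertex `α_j` of `Γ_k`, for `j < 4k+4`. -/
def al (j : ℕ) : Vtx k := .inl (.alpha (Fin.ofNat (4 * k + 4) j))

/-- The vertex `α'_j` or `ᾱ_j` of `Γ'_k`, for `j < 4k+4`. -/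
def al' (j : ℕ) : Vtx k := .inr (.alpha' (Fin.ofNat (4 * k + 4) j))

abbrev b1 : Vtx k := .inl .beta1
abbrev b2 : Vtx k := .inl .beta2
abbrev b3 : Vtx k := .inl .beta3
abbrev c1 : Vtx k := .inl .gamma1
abbrev c2 : Vtx k := .inl .gamma2
abbrev c3 : Vtx k := .inl .gamma3
abbrev vf : Vtx k := .inr .f
abbrev vg : Vtx k := .inr .g
abbrev bb : Vtx k := .inr .beta2bar
abbrev cb : Vtx k := .inr .gamma2bar

theorem cases_vtx {p : Vtx k → Prop} (hal : ∀ j < 4 * k + 4, p (al j))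
    (hal' : ∀ j < 4 * k + 4, p (al' j)) (hb1 : p b1) (hb2 : p b2) (hb3 : p b3)
    (hc1 : p c1) (hc2 : p c2) (hc3 : p c3) (hf : p vf) (hg : p vg) (hbb : p bb) (hcb : p cb)
    (x : Vtx k) : p x := by
  rcases x with (x | x)
  · rcases x with ⟨j⟩ | _ | _ | _ | _ | _ | _ <;> try assumption
    have := hal j j.2
    simpa [al] using this
  · rcases x with ⟨j⟩ | _ | _ | _ | _ <;> try assumption
    have := hal' j j.2
    simpa [al'] using this

theorem al_inj {i j : ℕ} (hi : i < 4 * k + 4) (hj : j < 4 * k + 4) :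
    (al i : Vtx k) = al j ↔ i = j := by
  simp [al, Fin.ext_iff, Nat.mod_eq_of_lt hi, Nat.mod_eq_of_lt hj]

theorem al'_inj {i j : ℕ} (hi : i < 4 * k + 4) (hj : j < 4 * k + 4) :
    (al' i : Vtx k) = al' j ↔ i = j := by
  simp [al', Fin.ext_iff, Nat.mod_eq_of_lt hi, Nat.mod_eq_of_lt hj]

/-- Left coefficient. -/
def lt : Vtx k → Side
  | .inl _ => .N
  | .inr _ => .M

/-- Right coefficient. -/
def rt : Vtx k → Side
  | .inl x => if Even x.depth then .N else .M
  | .inr x => if Even x.depth then .M else .N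

/-- Adjacency in the disjoint union of the two graphs. -/
def Adj : Vtx k → Vtx k → Prop
  | .inl x, .inl y => (GammaGraph k).Adj x y
  | .inr x, .inr y => (GammaGraph' k).Adj x y
  | _, _ => False

theorem Adj.symm {x y : Vtx k} (h : Adj x y) : Adj y x := by
  rcases x with x | x <;> rcases y with y | y <;> simp only [Adj] at h ⊢
  · exact SimpleGraph.Adj.symm h
  · exact SimpleGraph.Adj.symm h

theorem adj_comm {x y : Vtx k} : Adj x y ↔ Adj y x := ⟨Adj.symm, Adj.symm⟩

/-- The conjugation as a function. -/
def conjFun : Vtx k → Vtx k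
  | .inl (.alpha j) => if Even (j : ℕ) then .inl (.alpha j) else .inr (.alpha' j)
  | .inr (.alpha' j) => if Even (j : ℕ) then .inr (.alpha' j) else .inl (.alpha j)
  | .inl .beta1 => .inl .beta1
  | .inl .gamma1 => .inl .gamma1
  | .inl .beta2 => .inr .beta2bar
  | .inl .gamma2 => .inr .gamma2bar
  | .inr .beta2bar => .inl .beta2
  | .inr .gamma2bar => .inl .gamma2
  | .inl .beta3 => .inl .gamma3
  | .inl .gamma3 => .inl .beta3
  | .inr .f => .inr .f
  | .inr .g => .inr .g

theorem conjFun_conjFun (x : Vtx k) : conjFun (conjFun x) = x := by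
  rcases x with (x | x)
  · rcases x with ⟨j⟩ | _ | _ | _ | _ | _ | _ <;> try rfl
    simp only [conjFun]; split_ifs with h <;> simp [h]
  · rcases x with ⟨j⟩ | _ | _ | _ | _ <;> try rfl
    simp only [conjFun]; split_ifs with h <;> simp [h]

/-- The conjugation of vertices. -/
def conj (k : ℕ) : Equiv.Perm (Vtx k) := ⟨conjFun, conjFun, conjFun_conjFun, conjFun_conjFun⟩

@[simp] theorem conj_conj (x : Vtx k) : conj k (conj k x) = x := conjFun_conjFun x

theorem conj_al_even {j : ℕ} (hj : j < 4 * k + 4) (h : Even j) : conj k (al j) = al j := by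
  simp [conj, conjFun, al, Nat.mod_eq_of_lt hj, h]

theorem conj_al_odd {j : ℕ} (hj : j < 4 * k + 4) (h : ¬ Even j) : conj k (al j) = al' j := by
  simp only [conj, conjFun, al, al', Equiv.coe_fn_mk, Fin.val_ofNat, Nat.mod_eq_of_lt hj, h]
  simp

theorem conj_al'_even {j : ℕ} (hj : j < 4 * k + 4) (h : Even j) : conj k (al' j) = al' j := by
  simp [conj, conjFun, al', Nat.mod_eq_of_lt hj, h]

theorem conj_al'_odd {j : ℕ} (hj : j < 4 * k + 4) (h : ¬ Even j) : conj k (al' j) = al j := by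
  simp only [conj, conjFun, al, al', Equiv.coe_fn_mk, Fin.val_ofNat, Nat.mod_eq_of_lt hj, h]
  simp

@[simp] theorem conj_b1 : conj k b1 = b1 := rfl
@[simp] theorem conj_b2 : conj k b2 = bb := rfl
@[simp] theorem conj_b3 : conj k b3 = c3 := rfl
@[simp] theorem conj_c1 : conj k c1 = c1 := rfl
@[simp] theorem conj_c2 : conj k c2 = cb := rfl
@[simp] theorem conj_c3 : conj k c3 = b3 := rfl
@[simp] theorem conj_vf : conj k vf = vf := rfl
@[simp] theorem conj_vg : conj k vg = vg := rfl
@[simp] theorem conj_bb : conj k bb = b2 := rfl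
@[simp] theorem conj_cb : conj k cb = c2 := rfl

theorem lt_al (j : ℕ) : lt (al j : Vtx k) = .N := rfl
theorem lt_al' (j : ℕ) : lt (al' j : Vtx k) = .M := rfl

theorem rt_al {j : ℕ} (hj : j < 4 * k + 4) : rt (al j : Vtx k) = if Even j then .N else .M := by
  simp [rt, al, GVertex.depth, Nat.mod_eq_of_lt hj]

theorem rt_al' {j : ℕ} (hj : j < 4 * k + 4) : rt (al' j : Vtx k) = if Even j then .M else .N := by
  simp [rt, al', GVertex'.depth, Nat.mod_eq_of_lt hj]

theorem even_depth_one : Even (4 * k + 4) := ⟨2 * k + 2, by ring⟩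
theorem not_even_depth_two : ¬ Even (4 * k + 5) := by
  rw [Nat.not_even_iff_odd]; exact ⟨2 * k + 2, by ring⟩
theorem even_depth_three : Even (4 * k + 6) := ⟨2 * k + 3, by ring⟩

@[simp] theorem rt_b1 : rt (b1 : Vtx k) = .N := if_pos even_depth_one
@[simp] theorem rt_b2 : rt (b2 : Vtx k) = .M := if_neg not_even_depth_two
@[simp] theorem rt_b3 : rt (b3 : Vtx k) = .N := if_pos even_depth_three
@[simp] theorem rt_c1 : rt (c1 : Vtx k) = .N := if_pos even_depth_one
@[simp] theorem rt_c2 : rt (c2 : Vtx k) = .M := if_neg not_even_depth_two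
@[simp] theorem rt_c3 : rt (c3 : Vtx k) = .N := if_pos even_depth_three
@[simp] theorem rt_vf : rt (vf : Vtx k) = .M := if_pos even_depth_one
@[simp] theorem rt_vg : rt (vg : Vtx k) = .M := if_pos even_depth_one
@[simp] theorem rt_bb : rt (bb : Vtx k) = .N := if_neg not_even_depth_two
@[simp] theorem rt_cb : rt (cb : Vtx k) = .N := if_neg not_even_depth_two

theorem lt_conj (x : Vtx k) : lt (conj k x) = rt x := by
  refine cases_vtx (p := fun x => lt (conj k x) = rt x) ?_ ?_ ?_ ?_ ?_ ?_ ?_ ?_ ?_ ?_ ?_ ?_ x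
  · intro j hj
    by_cases h : Even j
    · rw [conj_al_even hj h, rt_al hj, if_pos h, lt_al]
    · rw [conj_al_odd hj h, rt_al hj, if_neg h, lt_al']
  · intro j hj
    by_cases h : Even j
    · rw [conj_al'_even hj h, rt_al' hj, if_pos h, lt_al']
    · rw [conj_al'_odd hj h, rt_al' hj, if_neg h, lt_al]
  all_goals simp [lt]

theorem rt_conj (x : Vtx k) : rt (conj k x) = lt x := by
  rw [← lt_conj, conj_conj]

theorem Adj.lt_eq {x y : Vtx k} (h : Adj x y) : lt x = lt y := by
  rcases x with x | x <;> rcases y with y | y <;> simp_all [Adj, lt]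

theorem Adj.rt_ne {x y : Vtx k} (h : Adj x y) : rt x ≠ rt y := by
  rcases x with x | x <;> rcases y with y | y <;> simp only [Adj] at h
  · simp only [GammaGraph, SimpleGraph.fromRel_adj] at h
    have : Even x.depth ↔ ¬ Even y.depth := by
      obtain ⟨-, h | h⟩ := h <;> cases x <;> cases y <;> simp only [GVertex.Edge] at h <;>
        simp only [GVertex.depth] <;> grind
    simp only [rt]; split_ifs <;> simp_all
  · simp only [GammaGraph', SimpleGraph.fromRel_adj] at h
    have : Even x.depth ↔ ¬ Even y.depth := by
      obtain ⟨-, h | h⟩ := h <;> cases x <;> cases y <;> simp only [GVertex'.Edge] at h <;>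
        simp only [GVertex'.depth] <;> grind
    simp only [rt]; split_ifs <;> simp_all

theorem adj_al_al {i j : ℕ} (hi : i < 4 * k + 4) (hj : j < 4 * k + 4) :
    Adj (al i : Vtx k) (al j) ↔ i + 1 = j ∨ j + 1 = i := by
  simp only [al, Adj, GammaGraph, SimpleGraph.fromRel_adj, GVertex.Edge, ne_eq,
    GVertex.alpha.injEq, Fin.ext_iff, Fin.val_ofNat, Nat.mod_eq_of_lt hi, Nat.mod_eq_of_lt hj]
  omega

theorem adj_al'_al' {i j : ℕ} (hi : i < 4 * k + 4) (hj : j < 4 * k + 4) :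
    Adj (al' i : Vtx k) (al' j) ↔ i + 1 = j ∨ j + 1 = i := by
  simp only [al', Adj, GammaGraph', SimpleGraph.fromRel_adj, GVertex'.Edge, ne_eq,
    GVertex'.alpha'.injEq, Fin.ext_iff, Fin.val_ofNat, Nat.mod_eq_of_lt hi, Nat.mod_eq_of_lt hj]
  omega

theorem adj_inl_inl {x y : GVertex k} :
    Adj (.inl x : Vtx k) (.inl y) ↔ x ≠ y ∧ (x.Edge y ∨ y.Edge x) := by
  simp [Adj, GammaGraph]

theorem adj_inr_inr {x y : GVertex' k} :
    Adj (.inr x : Vtx k) (.inr y) ↔ x ≠ y ∧ (x.Edge y ∨ y.Edge x) := by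
  simp [Adj, GammaGraph']

@[simp] theorem not_adj_inl_inr {x : GVertex k} {y : GVertex' k} :
    ¬ Adj (.inl x : Vtx k) (.inr y) := id

@[simp] theorem not_adj_inr_inl {x : GVertex' k} {y : GVertex k} :
    ¬ Adj (.inr x : Vtx k) (.inl y) := id

theorem alpha_val_eq {j : ℕ} (hj : j < 4 * k + 4) :
    ((Fin.ofNat (4 * k + 4) j : Fin (4 * k + 4)) : ℕ) = j := by
  simp [Nat.mod_eq_of_lt hj]

end Vtx

open Vtx

variable {k : ℕ}

/-! ### The adjacency matrix and its columns. -/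

/-- The basis vector of a vertex. -/
abbrev e (x : Vtx k) : Vtx k → ℚ := Pi.single x 1

open Classical in
/-- The adjacency matrix of the disjoint union of the two graphs. -/
noncomputable def adjM (k : ℕ) : Matrix (Vtx k) (Vtx k) ℚ := fun x y => if Adj x y then 1 else 0

theorem adjM_symm : (adjM k)ᵀ = adjM k := by
  ext x y; simp only [adjM, Matrix.transpose_apply]; congr 1; exact propext adj_comm

/-- By symmetry the table of columns also serves as a table of rows. -/
theorem adjM_mulVec_apply (u : Vtx k → ℚ) (x : Vtx k) :
    (adjM k *ᵥ u) x = (adjM k *ᵥ e x) ⬝ᵥ u := by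
  have h : (adjM k *ᵥ u) x = e x ⬝ᵥ (adjM k *ᵥ u) := (single_one_dotProduct ..).symm
  rw [h, dotProduct_mulVec, ← mulVec_transpose, adjM_symm]

theorem adjM_columns :
    adjM k *ᵥ e (b1) = e (al (4 * k + 3)) + e b2 ∧
    adjM k *ᵥ e (b2) = e b1 + e b3 ∧
    adjM k *ᵥ e (b3) = e b2 ∧
    adjM k *ᵥ e (bb) = e vg ∧
    adjM k *ᵥ e (c1) = e (al (4 * k + 3)) + e c2 ∧
    adjM k *ᵥ e (c2) = e c1 + e c3 ∧
    adjM k *ᵥ e (c3) = e c2 ∧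
    adjM k *ᵥ e (cb) = e vg ∧
    adjM k *ᵥ e (vf) = e (al' (4 * k + 3)) ∧
    adjM k *ᵥ e (vg) = e (al' (4 * k + 3)) + e bb + e cb ∧
    adjM k *ᵥ e (al (4 * k + 3)) = e (al (4 * k + 2)) + e b1 + e c1 ∧
    adjM k *ᵥ e (al' (4 * k + 3)) = e (al' (4 * k + 2)) + e vf + e vg ∧
    adjM k *ᵥ e (al 0) = e (al 1) ∧
    adjM k *ᵥ e (al' 0) = e (al' 1) := by
  refine ⟨?_, ?_, ?_, ?_, ?_, ?_, ?_, ?_, ?_, ?_, ?_, ?_, ?_, ?_⟩ <;>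
    (rw [mulVec_single_one]; ext y
     induction y using cases_vtx <;>
     (try simp (disch := omega) only [Matrix.col_apply, adjM, Pi.single_apply, al_inj, adj_al_al,
      Pi.add_apply, al'_inj, adj_al'_al']) <;>
     (try simp (disch := omega) only [al, al', adj_inl_inl, adj_inr_inr,
      GVertex.Edge, GVertex'.Edge, alpha_val_eq, not_adj_inl_inr,
      not_adj_inr_inl, reduceCtorEq, Sum.inl.injEq, Sum.inr.injEq]) <;> try grind)

theorem adjM_columns_al {j : ℕ} (h : j + 2 < 4 * k + 4) :
    adjM k *ᵥ e (al (j + 1)) = e (al j) + e (al (j + 2)) ∧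
    adjM k *ᵥ e (al' (j + 1)) = e (al' j) + e (al' (j + 2)) := by
  refine ⟨?_, ?_⟩ <;>
    (rw [mulVec_single_one]; ext y
     induction y using cases_vtx <;>
     (try simp (disch := omega) only [Matrix.col_apply, adjM, Pi.single_apply, al_inj, adj_al_al,
      Pi.add_apply, al'_inj, adj_al'_al']) <;>
     (try simp (disch := omega) only [al, al', adj_inl_inl, adj_inr_inr,
      GVertex.Edge, GVertex'.Edge, alpha_val_eq, not_adj_inl_inr,
      not_adj_inr_inl, reduceCtorEq, Sum.inl.injEq, Sum.inr.injEq]) <;> try grind)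

theorem adjM_b1 : adjM k *ᵥ e (b1) = e (al (4 * k + 3)) + e b2 := adjM_columns.1

theorem adjM_b2 : adjM k *ᵥ e (b2) = e b1 + e b3 := adjM_columns.2.1

theorem adjM_b3 : adjM k *ᵥ e (b3) = e b2 := adjM_columns.2.2.1

theorem adjM_bb : adjM k *ᵥ e (bb) = e vg := adjM_columns.2.2.2.1

theorem adjM_c1 : adjM k *ᵥ e (c1) = e (al (4 * k + 3)) + e c2 := adjM_columns.2.2.2.2.1

theorem adjM_c2 : adjM k *ᵥ e (c2) = e c1 + e c3 := adjM_columns.2.2.2.2.2.1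

theorem adjM_c3 : adjM k *ᵥ e (c3) = e c2 := adjM_columns.2.2.2.2.2.2.1

theorem adjM_cb : adjM k *ᵥ e (cb) = e vg := adjM_columns.2.2.2.2.2.2.2.1

theorem adjM_vf : adjM k *ᵥ e (vf) = e (al' (4 * k + 3)) := adjM_columns.2.2.2.2.2.2.2.2.1

theorem adjM_vg : adjM k *ᵥ e (vg) = e (al' (4 * k + 3)) + e bb + e cb := adjM_columns.2.2.2.2.2.2.2.2.2.1

theorem adjM_al_last : adjM k *ᵥ e (al (4 * k + 3)) = e (al (4 * k + 2)) + e b1 + e c1 := adjM_columns.2.2.2.2.2.2.2.2.2.2.1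

theorem adjM_al'_last : adjM k *ᵥ e (al' (4 * k + 3)) = e (al' (4 * k + 2)) + e vf + e vg := adjM_columns.2.2.2.2.2.2.2.2.2.2.2.1

theorem adjM_al_zero : adjM k *ᵥ e (al 0) = e (al 1) := adjM_columns.2.2.2.2.2.2.2.2.2.2.2.2.1

theorem adjM_al'_zero : adjM k *ᵥ e (al' 0) = e (al' 1) := adjM_columns.2.2.2.2.2.2.2.2.2.2.2.2.2

theorem adjM_al_succ {j : ℕ} (h : j + 2 < 4 * k + 4) :
    adjM k *ᵥ e (al (j + 1)) = e (al j) + e (al (j + 2)) := (adjM_columns_al h).1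

theorem adjM_al'_succ {j : ℕ} (h : j + 2 < 4 * k + 4) :
    adjM k *ᵥ e (al' (j + 1)) = e (al' j) + e (al' (j + 2)) := (adjM_columns_al h).2

open Vtx

/-! ### Based rings from a matrix algebra with a cyclic vector. -/

/-- A finite set of symmetric matrices which generates the algebra of right multiplications of a
based ring with basis `Ω`, identity vector `one` and conjugation `J`. -/
structure Generates {Ω : Type*} [Fintype Ω] [DecidableEq Ω] (J : Equiv.Perm Ω) (one : Ω → ℚ)
    (G : Set (Matrix Ω Ω ℚ)) : Prop where
  invol : ∀ x, J (J x) = x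
  symm : ∀ X ∈ G, Xᵀ = X
  conj_one : one ∘ J = one
  conj_apply_one : ∀ X ∈ G, (X *ᵥ one) ∘ J = X *ᵥ one
  comm : ∀ X ∈ G, ∀ Y ∈ G, Commute X (Y.submatrix J J)
  cyclic : ∀ v : Ω → ℚ, ∃ X ∈ Algebra.adjoin ℚ G, X *ᵥ one = v

namespace Generates

variable {Ω : Type*} [Fintype Ω] [DecidableEq Ω] {J : Equiv.Perm Ω} {one : Ω → ℚ}
  {G : Set (Matrix Ω Ω ℚ)} (hG : Generates J one G)

theorem submatrix_mulVec (J : Equiv.Perm Ω) (hJ : ∀ x, J (J x) = x) (X : Matrix Ω Ω ℚ)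
    (v : Ω → ℚ) : X.submatrix J J *ᵥ v = (X *ᵥ (v ∘ J)) ∘ J := by
  rw [Matrix.submatrix_mulVec_equiv]
  congr 2
  ext x
  simp only [Function.comp_apply]
  congr 1
  rw [Equiv.symm_apply_eq, hJ]

include hG

theorem comp_comp (v : Ω → ℚ) : (v ∘ J) ∘ J = v := by
  ext x; simp [hG.invol]

theorem dot_comp (u v : Ω → ℚ) : (u ∘ J) ⬝ᵥ (v ∘ J) = u ⬝ᵥ v := by
  simp only [dotProduct, Function.comp_apply]
  exact Equiv.sum_comp J (fun x => u x * v x)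

/-- Commutation of generators passes to the two algebras they generate, since conjugation by `J` is
an algebra automorphism. It expresses that right multiplications commute with left ones. -/
theorem commute_adjoin {X Y : Matrix Ω Ω ℚ} (hX : X ∈ Algebra.adjoin ℚ G)
    (hY : Y ∈ Algebra.adjoin ℚ G) : Commute X (Y.submatrix J J) := by
  induction hY using Algebra.adjoin_induction with
  | mem Y hY =>
    induction hX using Algebra.adjoin_induction with
    | mem X hX => exact hG.comm X hX Y hY
    | algebraMap r => exact Algebra.commutes r _
    | add X X' _ _ h h' => exact h.add_left h'
    | mul X X' _ _ h h' => exact h.mul_left h'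
  | algebraMap r =>
    have : (algebraMap ℚ (Matrix Ω Ω ℚ) r).submatrix J J = algebraMap ℚ (Matrix Ω Ω ℚ) r := by
      ext x y
      simp [Matrix.algebraMap_matrix_apply]
    rw [this]
    exact (Algebra.commutes r _).symm
  | add Y Y' _ _ h h' => exact h.add_right h'
  | mul Y Y' _ _ h h' =>
    rw [← Matrix.submatrix_mul_equiv Y Y' J J J]
    exact h.mul_right h'

theorem transpose_mem {X : Matrix Ω Ω ℚ} (hX : X ∈ Algebra.adjoin ℚ G) :
    Xᵀ ∈ Algebra.adjoin ℚ G := by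
  induction hX using Algebra.adjoin_induction with
  | mem X hX => rw [hG.symm X hX]; exact Algebra.subset_adjoin hX
  | algebraMap r =>
    have : (algebraMap ℚ (Matrix Ω Ω ℚ) r)ᵀ = algebraMap ℚ (Matrix Ω Ω ℚ) r := by
      simp [Matrix.algebraMap_eq_diagonal]
    rw [this]; exact Subalgebra.algebraMap_mem _ r
  | add X X' _ _ h h' => rw [transpose_add]; exact add_mem h h'
  | mul X X' _ _ h h' => rw [transpose_mul]; exact mul_mem h' h

theorem mulVec_conj_mulVec {X Y : Matrix Ω Ω ℚ} (hX : X ∈ Algebra.adjoin ℚ G)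
    (hY : Y ∈ Algebra.adjoin ℚ G) (v : Ω → ℚ) :
    X *ᵥ ((Y *ᵥ (v ∘ J)) ∘ J) = (Y *ᵥ ((X *ᵥ v) ∘ J)) ∘ J := by
  have h := congrArg (· *ᵥ v) (hG.commute_adjoin hX hY).eq
  simp only [← mulVec_mulVec, submatrix_mulVec J hG.invol] at h
  exact h

/-- For a product, (XY)ᵀ·1 = Yᵀ(X·1)ᴶ, and commuting `Y`ᵀ past the left multiplication J X J turns
this into ((XY)·1)ᴶ. This is what makes transposition the involution of the ring. -/
theorem transpose_mulVec_one {X : Matrix Ω Ω ℚ} (hX : X ∈ Algebra.adjoin ℚ G) :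
    Xᵀ *ᵥ one = (X *ᵥ one) ∘ J := by
  induction hX using Algebra.adjoin_induction with
  | mem X hX => rw [hG.symm X hX, hG.conj_apply_one X hX]
  | algebraMap r =>
    simp only [Matrix.algebraMap_eq_diagonal, diagonal_transpose]
    ext x
    simp only [mulVec_diagonal, Function.comp_apply]
    have := congrFun hG.conj_one x
    simp only [Function.comp_apply] at this
    simp [this]
  | add X X' _ _ h h' =>
    rw [transpose_add, add_mulVec, add_mulVec, h, h']; rfl
  | mul X Y hX hY h h' =>
    rw [transpose_mul, ← mulVec_mulVec, h]
    have := hG.mulVec_conj_mulVec (hG.transpose_mem hY) hX one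
    rw [hG.conj_one] at this
    rw [this, h', hG.comp_comp, mulVec_mulVec]

/-- The identity vector is also cyclic for the left multiplications J Z J, and `X` commutes with
those, so its value at the identity determines it. -/
theorem eq_of_mulVec_one {X Y : Matrix Ω Ω ℚ} (hX : X ∈ Algebra.adjoin ℚ G)
    (hY : Y ∈ Algebra.adjoin ℚ G) (h : X *ᵥ one = Y *ᵥ one) : X = Y := by
  apply Matrix.ext_of_mulVec_single
  intro x
  obtain ⟨Z, hZ, hx⟩ := hG.cyclic ((Pi.single x 1) ∘ J)
  have h1 := hG.mulVec_conj_mulVec hX hZ one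
  have h2 := hG.mulVec_conj_mulVec hY hZ one
  rw [hG.conj_one, hx, hG.comp_comp] at h1 h2
  rw [h1, h2, h]

/-- Right multiplication by `v`. -/
noncomputable def R (v : Ω → ℚ) : Matrix Ω Ω ℚ := (hG.cyclic v).choose

theorem R_mem (v : Ω → ℚ) : hG.R v ∈ Algebra.adjoin ℚ G := (hG.cyclic v).choose_spec.1

theorem R_one (v : Ω → ℚ) : hG.R v *ᵥ one = v := (hG.cyclic v).choose_spec.2

theorem R_unique {X : Matrix Ω Ω ℚ} (hX : X ∈ Algebra.adjoin ℚ G) {v : Ω → ℚ}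
    (h : X *ᵥ one = v) : hG.R v = X :=
  hG.eq_of_mulVec_one (hG.R_mem v) hX (by rw [hG.R_one, h])

theorem R_add (u v : Ω → ℚ) : hG.R (u + v) = hG.R u + hG.R v :=
  hG.R_unique (add_mem (hG.R_mem u) (hG.R_mem v)) (by rw [add_mulVec, hG.R_one, hG.R_one])

theorem R_smul (c : ℚ) (v : Ω → ℚ) : hG.R (c • v) = c • hG.R v :=
  hG.R_unique (Subalgebra.smul_mem _ (hG.R_mem v) c) (by rw [smul_mulVec, hG.R_one])

theorem R_mulVec (u v : Ω → ℚ) : hG.R (hG.R u *ᵥ v) = hG.R u * hG.R v :=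
  hG.R_unique (mul_mem (hG.R_mem u) (hG.R_mem v)) (by rw [← mulVec_mulVec, hG.R_one])

/-- The source of Frobenius reciprocity: right multiplication by the conjugate is the adjoint for
the scalar product in which the basis is orthonormal. -/
theorem R_conj (v : Ω → ℚ) : hG.R (v ∘ J) = (hG.R v)ᵀ :=
  hG.R_unique (hG.transpose_mem (hG.R_mem v)) (by rw [hG.transpose_mulVec_one (hG.R_mem v), hG.R_one])

/-- The product of the based ring. -/
noncomputable def mul (u v : Ω → ℚ) : Ω → ℚ := hG.R v *ᵥ u

theorem mul_def (u v : Ω → ℚ) : hG.mul u v = hG.R v *ᵥ u := rfl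

theorem mul_assoc (u v w : Ω → ℚ) : hG.mul (hG.mul u v) w = hG.mul u (hG.mul v w) := by
  rw [mul, mul, mul, mul, R_mulVec, mulVec_mulVec]

/-- Both sides come from applying the commuting operators `R v` and J (R (u ∘ J)) J to the identity
vector. -/
theorem mul_conj (u v : Ω → ℚ) : hG.mul u v ∘ J = hG.mul (v ∘ J) (u ∘ J) := by
  have h := hG.mulVec_conj_mulVec (hG.R_mem v) (hG.R_mem (u ∘ J)) one
  rw [hG.conj_one, hG.R_one, hG.R_one, hG.comp_comp] at h
  rw [mul, h, hG.comp_comp]; rfl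

theorem mul_add (u v w : Ω → ℚ) : hG.mul u (v + w) = hG.mul u v + hG.mul u w := by
  rw [mul, R_add, add_mulVec]; rfl

theorem add_mul (u v w : Ω → ℚ) : hG.mul (u + v) w = hG.mul u w + hG.mul v w := mulVec_add ..

theorem mul_smul (c : ℚ) (u v : Ω → ℚ) : hG.mul u (c • v) = c • hG.mul u v := by
  rw [mul, R_smul, smul_mulVec]; rfl

theorem smul_mul (c : ℚ) (u v : Ω → ℚ) : hG.mul (c • u) v = c • hG.mul u v := mulVec_smul ..

theorem mul_zero (u : Ω → ℚ) : hG.mul u 0 = 0 := by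
  simpa using hG.mul_smul 0 u 0

theorem zero_mul (u : Ω → ℚ) : hG.mul 0 u = 0 := mulVec_zero _

theorem mul_sum {ι : Type*} (s : Finset ι) (u : Ω → ℚ) (f : ι → Ω → ℚ) :
    hG.mul u (∑ i ∈ s, f i) = ∑ i ∈ s, hG.mul u (f i) := by
  classical
  induction s using Finset.induction_on with
  | empty => simp [hG.mul_zero]
  | insert a s ha h => rw [Finset.sum_insert ha, Finset.sum_insert ha, mul_add, h]

theorem sum_mul {ι : Type*} (s : Finset ι) (u : Ω → ℚ) (f : ι → Ω → ℚ) :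
    hG.mul (∑ i ∈ s, f i) u = ∑ i ∈ s, hG.mul (f i) u := by
  classical
  induction s using Finset.induction_on with
  | empty => simp [hG.zero_mul]
  | insert a s ha h => rw [Finset.sum_insert ha, Finset.sum_insert ha, add_mul, h]

theorem mul_dot (u v w : Ω → ℚ) : hG.mul u v ⬝ᵥ w = u ⬝ᵥ hG.mul w (v ∘ J) := by
  rw [mul, mul, R_conj, mulVec_transpose, dotProduct_comm, dotProduct_mulVec, dotProduct_comm]

theorem mul_dot' (u v w : Ω → ℚ) : hG.mul u v ⬝ᵥ w = v ⬝ᵥ hG.mul (u ∘ J) w := by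
  rw [← hG.dot_comp, mul_conj, mul_dot, hG.comp_comp, ← hG.dot_comp, mul_conj, hG.comp_comp,
    hG.comp_comp]

end Generates

/-! ### The adjacency matrix in coordinates, and its conjugate, left multiplication. -/

variable {k : ℕ}

section Rows

variable (u : Vtx k → ℚ)

theorem adjM_apply_al_zero : (adjM k *ᵥ u) (al 0) = u (al 1) := by
  rw [adjM_mulVec_apply, adjM_al_zero]; simp
theorem adjM_apply_al'_zero : (adjM k *ᵥ u) (al' 0) = u (al' 1) := by
  rw [adjM_mulVec_apply, adjM_al'_zero]; simp
theorem adjM_apply_al_succ {j : ℕ} (h : j + 2 < 4 * k + 4) :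
    (adjM k *ᵥ u) (al (j + 1)) = u (al j) + u (al (j + 2)) := by
  rw [adjM_mulVec_apply, adjM_al_succ h]; simp [add_dotProduct]
theorem adjM_apply_al'_succ {j : ℕ} (h : j + 2 < 4 * k + 4) :
    (adjM k *ᵥ u) (al' (j + 1)) = u (al' j) + u (al' (j + 2)) := by
  rw [adjM_mulVec_apply, adjM_al'_succ h]; simp [add_dotProduct]
theorem adjM_apply_al_last :
    (adjM k *ᵥ u) (al (4 * k + 3)) = u (al (4 * k + 2)) + u b1 + u c1 := by
  rw [adjM_mulVec_apply, adjM_al_last]; simp [add_dotProduct]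
theorem adjM_apply_al'_last :
    (adjM k *ᵥ u) (al' (4 * k + 3)) = u (al' (4 * k + 2)) + u vf + u vg := by
  rw [adjM_mulVec_apply, adjM_al'_last]; simp [add_dotProduct]
theorem adjM_apply_b1 : (adjM k *ᵥ u) b1 = u (al (4 * k + 3)) + u b2 := by
  rw [adjM_mulVec_apply, adjM_b1]; simp [add_dotProduct]
theorem adjM_apply_c1 : (adjM k *ᵥ u) c1 = u (al (4 * k + 3)) + u c2 := by
  rw [adjM_mulVec_apply, adjM_c1]; simp [add_dotProduct]
theorem adjM_apply_b2 : (adjM k *ᵥ u) b2 = u b1 + u b3 := by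
  rw [adjM_mulVec_apply, adjM_b2]; simp [add_dotProduct]
theorem adjM_apply_c2 : (adjM k *ᵥ u) c2 = u c1 + u c3 := by
  rw [adjM_mulVec_apply, adjM_c2]; simp [add_dotProduct]
theorem adjM_apply_b3 : (adjM k *ᵥ u) b3 = u b2 := by
  rw [adjM_mulVec_apply, adjM_b3]; simp
theorem adjM_apply_c3 : (adjM k *ᵥ u) c3 = u c2 := by
  rw [adjM_mulVec_apply, adjM_c3]; simp
theorem adjM_apply_vf : (adjM k *ᵥ u) vf = u (al' (4 * k + 3)) := by
  rw [adjM_mulVec_apply, adjM_vf]; simp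
theorem adjM_apply_vg : (adjM k *ᵥ u) vg = u (al' (4 * k + 3)) + u bb + u cb := by
  rw [adjM_mulVec_apply, adjM_vg]; simp [add_dotProduct]
theorem adjM_apply_bb : (adjM k *ᵥ u) bb = u vg := by
  rw [adjM_mulVec_apply, adjM_bb]; simp
theorem adjM_apply_cb : (adjM k *ᵥ u) cb = u vg := by
  rw [adjM_mulVec_apply, adjM_cb]; simp

end Rows

theorem single_comp_conj (x : Vtx k) : e x ∘ conj k = e (conj k x) := by
  ext y
  simp only [Function.comp_apply, Pi.single_apply]
  congr 1
  rw [eq_iff_iff]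
  constructor
  · rintro h; rw [← h, conj_conj]
  · rintro rfl; rw [conj_conj]

theorem add_comp_conj (u v : Vtx k → ℚ) : (u + v) ∘ conj k = u ∘ conj k + v ∘ conj k := rfl
theorem sub_comp_conj (u v : Vtx k → ℚ) : (u - v) ∘ conj k = u ∘ conj k - v ∘ conj k := rfl
theorem smul_comp_conj (c : ℚ) (v : Vtx k → ℚ) : (c • v) ∘ conj k = c • (v ∘ conj k) := rfl
theorem zero_comp_conj : (0 : Vtx k → ℚ) ∘ conj k = 0 := rfl
theorem comp_conj_comp_conj (v : Vtx k → ℚ) : (v ∘ conj k) ∘ conj k = v := by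
  ext x; simp

/-- Right multiplication commutes with left multiplication by `α_1 + ᾱ_1`. -/
noncomputable def leftM (k : ℕ) : Matrix (Vtx k) (Vtx k) ℚ := (adjM k).submatrix (conj k) (conj k)

theorem leftM_mulVec (u : Vtx k → ℚ) : leftM k *ᵥ u = (adjM k *ᵥ (u ∘ conj k)) ∘ conj k :=
  Generates.submatrix_mulVec _ conj_conj _ _

theorem leftM_al_zero : leftM k *ᵥ e (al 0) = e (al' 1) := by
  rw [leftM_mulVec, single_comp_conj, conj_al_even (by omega) (by simp), adjM_al_zero,
    single_comp_conj, conj_al_odd (by omega) (by simp)]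

theorem leftM_al'_zero : leftM k *ᵥ e (al' 0) = e (al 1) := by
  rw [leftM_mulVec, single_comp_conj, conj_al'_even (by omega) (by simp), adjM_al'_zero,
    single_comp_conj, conj_al'_odd (by omega) (by simp)]

theorem leftM_al_succ {j : ℕ} (h : j + 2 < 4 * k + 4) :
    leftM k *ᵥ e (al (j + 1)) = e (al' j) + e (al' (j + 2)) := by
  rw [leftM_mulVec, single_comp_conj]
  by_cases hj : Even j
  · have h1 : ¬ Even (j + 1) := by grind
    have h2 : Even (j + 2) := by grind
    rw [conj_al_odd (by omega) h1, adjM_al'_succ h, add_comp_conj, single_comp_conj,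
      single_comp_conj, conj_al'_even (by omega) hj, conj_al'_even (by omega) h2]
  · have h1 : Even (j + 1) := by grind
    have h2 : ¬ Even (j + 2) := by grind
    rw [conj_al_even (by omega) h1, adjM_al_succ h, add_comp_conj, single_comp_conj,
      single_comp_conj, conj_al_odd (by omega) hj, conj_al_odd (by omega) h2]

theorem leftM_al'_succ {j : ℕ} (h : j + 2 < 4 * k + 4) :
    leftM k *ᵥ e (al' (j + 1)) = e (al j) + e (al (j + 2)) := by
  rw [leftM_mulVec, single_comp_conj]
  by_cases hj : Even j
  · have h1 : ¬ Even (j + 1) := by grind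
    have h2 : Even (j + 2) := by grind
    rw [conj_al'_odd (by omega) h1, adjM_al_succ h, add_comp_conj, single_comp_conj,
      single_comp_conj, conj_al_even (by omega) hj, conj_al_even (by omega) h2]
  · have h1 : Even (j + 1) := by grind
    have h2 : ¬ Even (j + 2) := by grind
    rw [conj_al'_even (by omega) h1, adjM_al'_succ h, add_comp_conj, single_comp_conj,
      single_comp_conj, conj_al'_odd (by omega) hj, conj_al'_odd (by omega) h2]

theorem not_even_last : ¬ Even (4 * k + 3) := by
  rw [Nat.not_even_iff_odd]; exact ⟨2 * k + 1, by ring⟩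
theorem even_before_last : Even (4 * k + 2) := ⟨2 * k + 1, by ring⟩

theorem conj_al_last : conj k (al (4 * k + 3)) = al' (4 * k + 3) :=
  conj_al_odd (by omega) not_even_last
theorem conj_al'_last : conj k (al' (4 * k + 3)) = al (4 * k + 3) :=
  conj_al'_odd (by omega) not_even_last
theorem conj_al_before_last : conj k (al (4 * k + 2)) = al (4 * k + 2) :=
  conj_al_even (by omega) even_before_last
theorem conj_al'_before_last : conj k (al' (4 * k + 2)) = al' (4 * k + 2) :=
  conj_al'_even (by omega) even_before_last

theorem leftM_al_last : leftM k *ᵥ e (al (4 * k + 3)) = e (al' (4 * k + 2)) + e vf + e vg := by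
  simp only [leftM_mulVec, single_comp_conj, conj_al_last, adjM_al'_last, add_comp_conj,
    conj_al'_before_last, conj_vf, conj_vg]
theorem leftM_al'_last : leftM k *ᵥ e (al' (4 * k + 3)) = e (al (4 * k + 2)) + e b1 + e c1 := by
  simp only [leftM_mulVec, single_comp_conj, conj_al'_last, adjM_al_last, add_comp_conj,
    conj_al_before_last, conj_b1, conj_c1]
theorem leftM_b1 : leftM k *ᵥ e b1 = e (al' (4 * k + 3)) + e bb := by
  simp only [leftM_mulVec, single_comp_conj, conj_b1, adjM_b1, add_comp_conj, conj_al_last, conj_b2]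
theorem leftM_c1 : leftM k *ᵥ e c1 = e (al' (4 * k + 3)) + e cb := by
  simp only [leftM_mulVec, single_comp_conj, conj_c1, adjM_c1, add_comp_conj, conj_al_last, conj_c2]
theorem leftM_b2 : leftM k *ᵥ e b2 = e vg := by
  simp only [leftM_mulVec, single_comp_conj, conj_b2, adjM_bb, conj_vg]
theorem leftM_c2 : leftM k *ᵥ e c2 = e vg := by
  simp only [leftM_mulVec, single_comp_conj, conj_c2, adjM_cb, conj_vg]
theorem leftM_b3 : leftM k *ᵥ e b3 = e cb := by
  simp only [leftM_mulVec, single_comp_conj, conj_b3, adjM_c3, conj_c2]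
theorem leftM_c3 : leftM k *ᵥ e c3 = e bb := by
  simp only [leftM_mulVec, single_comp_conj, conj_c3, adjM_b3, conj_b2]
theorem leftM_bb : leftM k *ᵥ e bb = e b1 + e c3 := by
  simp only [leftM_mulVec, single_comp_conj, conj_bb, adjM_b2, add_comp_conj, conj_b1, conj_b3]
theorem leftM_cb : leftM k *ᵥ e cb = e c1 + e b3 := by
  simp only [leftM_mulVec, single_comp_conj, conj_cb, adjM_c2, add_comp_conj, conj_c1, conj_c3]
theorem leftM_vf : leftM k *ᵥ e vf = e (al (4 * k + 3)) := by
  simp only [leftM_mulVec, single_comp_conj, conj_vf, adjM_vf, conj_al'_last]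
theorem leftM_vg : leftM k *ᵥ e vg = e (al (4 * k + 3)) + e b2 + e c2 := by
  simp only [leftM_mulVec, single_comp_conj, conj_vg, adjM_vg, add_comp_conj, conj_al'_last,
    conj_bb, conj_cb]

theorem ext_single {X Y : Matrix (Vtx k) (Vtx k) ℚ} (h : ∀ x, X *ᵥ e x = Y *ᵥ e x) : X = Y :=
  Matrix.ext_of_mulVec_single h

/-- Along the paths both operators are nearest-neighbour sums, so only the branch needs thought.
There the exchange of β_3 and γ_3 is decisive: at β̄_2 one order gives the neighbours of β_1 and
γ_3, the other gives ᾱ-conjugated neighbours of g, and both are α_n + β_2 + γ_2. -/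
theorem commute_adjM_leftM : Commute (adjM k) (leftM k) := by
  apply ext_single
  intro x
  rw [← mulVec_mulVec, ← mulVec_mulVec]
  induction x using cases_vtx with
  | hal j hj =>
    rcases j with _ | _ | j
    · rw [leftM_al_zero, adjM_al_zero]
      have h : 0 + 2 < 4 * k + 4 := by omega
      rw [adjM_al'_succ h, leftM_al_succ h]
    · have h : 0 + 2 < 4 * k + 4 := by omega
      have h' : 1 + 2 < 4 * k + 4 := by omega
      rw [leftM_al_succ h, adjM_al_succ h, mulVec_add, mulVec_add, leftM_al_zero, adjM_al'_zero,
        leftM_al_succ h', adjM_al'_succ h']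
    · by_cases h1 : j + 2 = 4 * k + 3
      · obtain rfl : j = 4 * k + 1 := by omega
        have h : 4 * k + 1 + 2 < 4 * k + 4 := by omega
        simp only [leftM_al_last, adjM_al_last, leftM_al_succ h, adjM_al'_succ h, mulVec_add,
          adjM_vf, adjM_vg, leftM_b1, leftM_c1]
        abel
      · have h : j + 1 + 2 < 4 * k + 4 := by omega
        have h' : j + 2 < 4 * k + 4 := by omega
        rw [leftM_al_succ h, adjM_al_succ h, mulVec_add, mulVec_add, leftM_al_succ h',
          adjM_al'_succ h']
        congr 1
        by_cases h2 : j + 3 = 4 * k + 3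
        · obtain rfl : j = 4 * k := by omega
          rw [leftM_al_last, adjM_al'_last]
        · have h : j + 2 + 2 < 4 * k + 4 := by omega
          rw [leftM_al_succ h, adjM_al'_succ h]
  | hal' j hj =>
    rcases j with _ | _ | j
    · rw [leftM_al'_zero, adjM_al'_zero]
      have h : 0 + 2 < 4 * k + 4 := by omega
      rw [adjM_al_succ h, leftM_al'_succ h]
    · have h : 0 + 2 < 4 * k + 4 := by omega
      have h' : 1 + 2 < 4 * k + 4 := by omega
      rw [leftM_al'_succ h, adjM_al'_succ h, mulVec_add, mulVec_add, leftM_al'_zero, adjM_al_zero,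
        leftM_al'_succ h', adjM_al_succ h']
    · by_cases h1 : j + 2 = 4 * k + 3
      · obtain rfl : j = 4 * k + 1 := by omega
        have h : 4 * k + 1 + 2 < 4 * k + 4 := by omega
        simp only [leftM_al'_last, adjM_al'_last, leftM_al'_succ h, adjM_al_succ h, mulVec_add,
          adjM_b1, adjM_c1, leftM_vf, leftM_vg]
        abel
      · have h : j + 1 + 2 < 4 * k + 4 := by omega
        have h' : j + 2 < 4 * k + 4 := by omega
        rw [leftM_al'_succ h, adjM_al'_succ h, mulVec_add, mulVec_add, leftM_al'_succ h',
          adjM_al_succ h']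
        congr 1
        by_cases h2 : j + 3 = 4 * k + 3
        · obtain rfl : j = 4 * k := by omega
          rw [leftM_al'_last, adjM_al_last]
        · have h : j + 2 + 2 < 4 * k + 4 := by omega
          rw [leftM_al'_succ h, adjM_al_succ h]
  | _ =>
    simp only [leftM_b1, leftM_b2, leftM_b3, leftM_c1, leftM_c2, leftM_c3, leftM_vf, leftM_vg,
      leftM_bb, leftM_cb, adjM_b1, adjM_b2, adjM_b3, adjM_c1, adjM_c2, adjM_c3, adjM_vf, adjM_vg,
      adjM_bb, adjM_cb, mulVec_add, leftM_al_last, adjM_al_last, leftM_al'_last, adjM_al'_last] <;>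
    abel

/-! ### Eigenvectors of the squared adjacency matrix for the eigenvalues 0 and 2. -/

/-- Projection to the vertices with right coefficient `N`. -/
def projN (k : ℕ) : Matrix (Vtx k) (Vtx k) ℚ := diagonal fun x => if rt x = .N then 1 else 0

/-- The sequence `1, 0, -1, 0, 1, …`. -/
def nullSeq : ℕ → ℚ
  | 0 => 1
  | 1 => 0
  | n + 2 => -nullSeq n

/-- The sequence `1, 1, 1, 0, -1, -1, -1, 0, 1, …`. -/
def twoSeq : ℕ → ℚ
  | 0 => 1
  | 1 => 1
  | 2 => 1
  | 3 => 0
  | n + 4 => -twoSeq n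

theorem nullSeq_odd {j : ℕ} (h : ¬ Even j) : nullSeq j = 0 := by
  induction j using nullSeq.induct with
  | case1 => simp at h
  | case2 => rfl
  | case3 n ih => rw [nullSeq, ih (by grind), neg_zero]

theorem nullSeq_sq {j : ℕ} (h : Even j) : nullSeq j ^ 2 = 1 := by
  induction j using nullSeq.induct with
  | case1 => simp [nullSeq]
  | case2 => simp at h
  | case3 n ih => rw [nullSeq, neg_sq, ih (by grind)]

theorem twoSeq_sq {j : ℕ} (h : Even j) : twoSeq j ^ 2 = 1 := by
  induction j using twoSeq.induct with
  | case1 => simp [twoSeq]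
  | case2 => simp at h
  | case3 => simp [twoSeq]
  | case4 => grind
  | case5 n ih => rw [twoSeq, neg_sq, ih (by grind)]

theorem twoSeq_even {j : ℕ} (h : Even j) : twoSeq (j + 1) + twoSeq (j + 3) = twoSeq (j + 2) := by
  induction j using twoSeq.induct with
  | case1 => simp [twoSeq]
  | case2 => simp at h
  | case3 => simp [twoSeq]
  | case4 => grind
  | case5 n ih =>
    have := ih (by grind)
    rw [show n + 4 + 1 = (n + 1) + 4 by ring, show n + 4 + 3 = (n + 3) + 4 by ring,
      show n + 4 + 2 = (n + 2) + 4 by ring, twoSeq, twoSeq, twoSeq]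
    linarith

theorem twoSeq_odd {j : ℕ} (h : Even j) : twoSeq j + twoSeq (j + 2) = 2 * twoSeq (j + 1) := by
  induction j using twoSeq.induct with
  | case1 => norm_num [twoSeq]
  | case2 => simp at h
  | case3 => norm_num [twoSeq]
  | case4 => grind
  | case5 n ih =>
    have := ih (by grind)
    rw [show n + 4 + 1 = (n + 1) + 4 by ring, show n + 4 + 2 = (n + 2) + 4 by ring, twoSeq, twoSeq,
      twoSeq]
    linarith

/-- Here n ≡ 3 modulo 4 enters: the eigenvector for 2 has a node at α_n, so it can be continued into
the legs. -/
theorem twoSeq_last (k : ℕ) : twoSeq (4 * k + 3) = 0 := by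
  induction k with
  | zero => rfl
  | succ n ih => rw [show 4 * (n + 1) + 3 = 4 * n + 3 + 4 by ring, twoSeq, ih, neg_zero]

/-- The sign `(-1)^k`. -/
def sgn (k : ℕ) : ℚ := twoSeq (4 * k + 2)

theorem sgn_eq (k : ℕ) : sgn k = (-1) ^ k := by
  induction k with
  | zero => rfl
  | succ n ih =>
    rw [pow_succ, ← ih, sgn, show 4 * (n + 1) + 2 = 4 * n + 2 + 4 by ring, twoSeq, sgn]; ring

theorem sgn_sq (k : ℕ) : sgn k ^ 2 = 1 := twoSeq_sq even_before_last

/-- The value -1 at α_{n-1} is what the two values 1/2 at β_1 and γ_1 balance in `vecNull`; again n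
≡ 3 modulo 4 is used. -/
theorem nullSeq_before_last (k : ℕ) : nullSeq (4 * k + 2) = -1 := by
  induction k with
  | zero => simp [nullSeq]
  | succ n ih =>
    rw [show 4 * (n + 1) + 2 = 4 * n + 2 + 2 + 2 by ring, nullSeq, nullSeq, ih]; simp

/-- The eigenvector for `0` in the symmetric part of `V₁₁`. -/
def vecNull (k : ℕ) : Vtx k → ℚ
  | .inl (.alpha j) => nullSeq j
  | .inl .beta1 => 1 / 2
  | .inl .gamma1 => 1 / 2
  | .inl .beta3 => -1 / 2
  | .inl .gamma3 => -1 / 2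
  | _ => 0

/-- The eigenvector for `2` in the symmetric part of `V₁₁`. -/
def vecTwo (k : ℕ) : Vtx k → ℚ
  | .inl (.alpha j) => if Even (j : ℕ) then twoSeq j else 0
  | .inl .beta1 => -sgn k / 2
  | .inl .gamma1 => -sgn k / 2
  | .inl .beta3 => -sgn k / 2
  | .inl .gamma3 => -sgn k / 2
  | _ => 0

/-- The eigenvector for `2` in the symmetric part of `V₁₂`. -/
def vecTwoNM (k : ℕ) : Vtx k → ℚ
  | .inl (.alpha j) => if Even (j : ℕ) then 0 else twoSeq j
  | .inl .beta2 => -sgn k / 2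
  | .inl .gamma2 => -sgn k / 2
  | _ => 0

/-- The eigenvector for `2` in the symmetric part of `V₂₁`. -/
def vecTwoMN (k : ℕ) : Vtx k → ℚ
  | .inr (.alpha' j) => if Even (j : ℕ) then 0 else twoSeq j
  | .inr .beta2bar => -sgn k / 2
  | .inr .gamma2bar => -sgn k / 2
  | _ => 0

/-- The eigenvector for `2` in `V₂₂`. -/
def vecTwoMM (k : ℕ) : Vtx k → ℚ
  | .inr (.alpha' j) => if Even (j : ℕ) then twoSeq j else 0
  | .inr .g => -sgn k
  | _ => 0

section Values

theorem vecNull_al {j : ℕ} (hj : j < 4 * k + 4) : vecNull k (al j) = nullSeq j := by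
  simp only [vecNull, al, alpha_val_eq hj]
theorem vecNull_al' (j : ℕ) : vecNull k (al' j) = 0 := rfl
theorem vecTwo_al {j : ℕ} (hj : j < 4 * k + 4) :
    vecTwo k (al j) = if Even j then twoSeq j else 0 := by
  simp only [vecTwo, al, alpha_val_eq hj]
theorem vecTwo_al' (j : ℕ) : vecTwo k (al' j) = 0 := rfl
theorem vecTwoNM_al {j : ℕ} (hj : j < 4 * k + 4) :
    vecTwoNM k (al j) = if Even j then 0 else twoSeq j := by
  simp only [vecTwoNM, al, alpha_val_eq hj]
theorem vecTwoNM_al' (j : ℕ) : vecTwoNM k (al' j) = 0 := rfl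
theorem vecTwoMN_al' {j : ℕ} (hj : j < 4 * k + 4) :
    vecTwoMN k (al' j) = if Even j then 0 else twoSeq j := by
  simp only [vecTwoMN, al', alpha_val_eq hj]
theorem vecTwoMN_al (j : ℕ) : vecTwoMN k (al j) = 0 := rfl
theorem vecTwoMM_al' {j : ℕ} (hj : j < 4 * k + 4) :
    vecTwoMM k (al' j) = if Even j then twoSeq j else 0 := by
  simp only [vecTwoMM, al', alpha_val_eq hj]
theorem vecTwoMM_al (j : ℕ) : vecTwoMM k (al j) = 0 := rfl

end Values

theorem al_index_cases {p : ∀ j, j < 4 * k + 4 → Prop} (h0 : p 0 (by omega))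
    (h : ∀ j (hj : j + 2 < 4 * k + 4), p (j + 1) (by omega)) (hl : p (4 * k + 3) (by omega))
    (j : ℕ) (hj : j < 4 * k + 4) : p j hj := by
  rcases j with _ | j
  · exact h0
  · by_cases h1 : j + 2 < 4 * k + 4
    · exact h j h1
    · obtain rfl : j = 4 * k + 2 := by omega
      exact hl

theorem adjM_vecNull : adjM k *ᵥ vecNull k = 0 := by
  ext x
  induction x using cases_vtx with
  | hal j hj =>
    induction j, hj using al_index_cases with
    | h0 => rw [adjM_apply_al_zero, vecNull_al (by omega)]; rfl
    | h j hj =>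
      rw [adjM_apply_al_succ _ hj, vecNull_al (by omega), vecNull_al (by omega), nullSeq]; simp
    | hl =>
      rw [adjM_apply_al_last, vecNull_al (by omega), nullSeq_before_last]; norm_num [vecNull]
  | hal' j hj =>
    induction j, hj using al_index_cases with
    | h0 => rw [adjM_apply_al'_zero, vecNull_al']; rfl
    | h j hj => rw [adjM_apply_al'_succ _ hj, vecNull_al', vecNull_al']; simp
    | hl => rw [adjM_apply_al'_last, vecNull_al']; norm_num [vecNull]
  | _ =>
    simp (disch := omega) [adjM_apply_b1, adjM_apply_b2, adjM_apply_b3, adjM_apply_c1, adjM_apply_c2, adjM_apply_c3,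
      adjM_apply_vf, adjM_apply_vg, adjM_apply_bb, adjM_apply_cb, vecNull_al', vecNull_al]
    all_goals try rw [nullSeq_odd not_even_last]
    all_goals norm_num [vecNull]

/-- Together with `adjM_vecTwoNM` this is the eigenvalue 2 of A². The factor 2 is kept on one side
so that √2 does not appear. -/
theorem adjM_vecTwo : adjM k *ᵥ vecTwo k = (2 : ℚ) • vecTwoNM k := by
  ext x
  induction x using cases_vtx with
  | hal j hj =>
    simp only [Pi.smul_apply, smul_eq_mul]
    induction j, hj using al_index_cases with
    | h0 => rw [adjM_apply_al_zero, vecTwo_al (by omega), vecTwoNM_al (by omega)]; simp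
    | h j hj =>
      rw [adjM_apply_al_succ _ hj, vecTwo_al (by omega), vecTwo_al (by omega), vecTwoNM_al (by omega)]
      by_cases h : Even j
      · rw [if_pos h, if_pos (by grind), if_neg (by grind), twoSeq_odd h]
      · rw [if_neg h, if_neg (by grind), if_pos (by grind)]; simp
    | hl =>
      rw [adjM_apply_al_last, vecTwo_al (by omega), vecTwoNM_al (by omega), if_pos even_before_last,
        if_neg not_even_last, twoSeq_last]
      simp only [vecTwo, sgn]; ring
  | hal' j hj =>
    simp only [Pi.smul_apply, smul_eq_mul]
    induction j, hj using al_index_cases with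
    | h0 => rw [adjM_apply_al'_zero, vecTwo_al', vecTwoNM_al']; simp
    | h j hj => rw [adjM_apply_al'_succ _ hj, vecTwo_al', vecTwo_al', vecTwoNM_al']; simp
    | hl => rw [adjM_apply_al'_last, vecTwo_al', vecTwoNM_al']; norm_num [vecTwo]
  | _ =>
    simp (disch := omega) only [adjM_apply_b1, adjM_apply_b2, adjM_apply_b3, adjM_apply_c1, adjM_apply_c2, adjM_apply_c3, adjM_apply_vf, adjM_apply_vg, adjM_apply_bb, adjM_apply_cb, vecTwo_al', vecTwo_al, not_even_last, if_false, Pi.smul_apply, smul_eq_mul]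
    all_goals simp only [vecTwo, vecTwoNM]
    all_goals try ring

theorem adjM_vecTwoNM : adjM k *ᵥ vecTwoNM k = vecTwo k := by
  ext x
  induction x using cases_vtx with
  | hal j hj =>
    induction j, hj using al_index_cases with
    | h0 => rw [adjM_apply_al_zero, vecTwo_al (by omega), vecTwoNM_al (by omega)]; simp [twoSeq]
    | h j hj =>
      rw [adjM_apply_al_succ _ hj, vecTwoNM_al (by omega), vecTwoNM_al (by omega), vecTwo_al (by omega)]
      by_cases h : Even j
      · rw [if_pos h, if_pos (by grind), if_neg (by grind)]; simp
      · rw [if_neg h, if_neg (by grind), if_pos (by grind)]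
        obtain ⟨i, rfl⟩ : ∃ i, j = i + 1 := ⟨j - 1, by grind⟩
        exact twoSeq_even (by grind)
    | hl =>
      rw [adjM_apply_al_last, vecTwoNM_al (by omega), vecTwo_al (by omega), if_pos even_before_last,
        if_neg not_even_last]
      simp [vecTwoNM]
  | hal' j hj =>
    induction j, hj using al_index_cases with
    | h0 => rw [adjM_apply_al'_zero, vecTwo_al', vecTwoNM_al']
    | h j hj => rw [adjM_apply_al'_succ _ hj, vecTwoNM_al', vecTwoNM_al', vecTwo_al']; simp
    | hl => rw [adjM_apply_al'_last, vecTwo_al', vecTwoNM_al']; norm_num [vecTwoNM]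
  | _ =>
    simp (disch := omega) only [adjM_apply_b1, adjM_apply_b2, adjM_apply_b3, adjM_apply_c1, adjM_apply_c2, adjM_apply_c3, adjM_apply_vf, adjM_apply_vg, adjM_apply_bb, adjM_apply_cb, vecTwoNM_al', vecTwoNM_al, not_even_last, if_false, twoSeq_last]
    all_goals simp only [vecTwo, vecTwoNM]
    all_goals try ring

theorem adjM_vecTwoMN : adjM k *ᵥ vecTwoMN k = vecTwoMM k := by
  ext x
  induction x using cases_vtx with
  | hal' j hj =>
    induction j, hj using al_index_cases with
    | h0 => rw [adjM_apply_al'_zero, vecTwoMM_al' (by omega), vecTwoMN_al' (by omega)]; simp [twoSeq]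
    | h j hj =>
      rw [adjM_apply_al'_succ _ hj, vecTwoMN_al' (by omega), vecTwoMN_al' (by omega), vecTwoMM_al' (by omega)]
      by_cases h : Even j
      · rw [if_pos h, if_pos (by grind), if_neg (by grind)]; simp
      · rw [if_neg h, if_neg (by grind), if_pos (by grind)]
        obtain ⟨i, rfl⟩ : ∃ i, j = i + 1 := ⟨j - 1, by grind⟩
        exact twoSeq_even (by grind)
    | hl =>
      rw [adjM_apply_al'_last, vecTwoMN_al' (by omega), vecTwoMM_al' (by omega), if_pos even_before_last,
        if_neg not_even_last]
      simp [vecTwoMN]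
  | hal j hj =>
    induction j, hj using al_index_cases with
    | h0 => rw [adjM_apply_al_zero, vecTwoMM_al, vecTwoMN_al]
    | h j hj => rw [adjM_apply_al_succ _ hj, vecTwoMN_al, vecTwoMN_al, vecTwoMM_al]; simp
    | hl => rw [adjM_apply_al_last, vecTwoMM_al, vecTwoMN_al]; norm_num [vecTwoMN]
  | _ =>
    simp (disch := omega) only [adjM_apply_b1, adjM_apply_b2, adjM_apply_b3, adjM_apply_c1, adjM_apply_c2, adjM_apply_c3, adjM_apply_vf, adjM_apply_vg, adjM_apply_bb, adjM_apply_cb, vecTwoMN_al', vecTwoMN_al, not_even_last, if_false, twoSeq_last]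
    all_goals simp only [vecTwoMM, vecTwoMN]
    all_goals try ring

theorem adjM_vecTwoMM : adjM k *ᵥ vecTwoMM k = (2 : ℚ) • vecTwoMN k := by
  ext x
  induction x using cases_vtx with
  | hal' j hj =>
    simp only [Pi.smul_apply, smul_eq_mul]
    induction j, hj using al_index_cases with
    | h0 => rw [adjM_apply_al'_zero, vecTwoMM_al' (by omega), vecTwoMN_al' (by omega)]; simp
    | h j hj =>
      rw [adjM_apply_al'_succ _ hj, vecTwoMM_al' (by omega), vecTwoMM_al' (by omega), vecTwoMN_al' (by omega)]
      by_cases h : Even j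
      · rw [if_pos h, if_pos (by grind), if_neg (by grind), twoSeq_odd h]
      · rw [if_neg h, if_neg (by grind), if_pos (by grind)]; simp
    | hl =>
      rw [adjM_apply_al'_last, vecTwoMM_al' (by omega), vecTwoMN_al' (by omega), if_pos even_before_last,
        if_neg not_even_last, twoSeq_last]
      simp only [vecTwoMM, sgn]; ring
  | hal j hj =>
    simp only [Pi.smul_apply, smul_eq_mul]
    induction j, hj using al_index_cases with
    | h0 => rw [adjM_apply_al_zero, vecTwoMM_al, vecTwoMN_al]; simp
    | h j hj => rw [adjM_apply_al_succ _ hj, vecTwoMM_al, vecTwoMM_al, vecTwoMN_al]; simp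
    | hl => rw [adjM_apply_al_last, vecTwoMM_al, vecTwoMN_al]; norm_num [vecTwoMM]
  | _ =>
    simp (disch := omega) only [adjM_apply_b1, adjM_apply_b2, adjM_apply_b3, adjM_apply_c1, adjM_apply_c2, adjM_apply_c3, adjM_apply_vf, adjM_apply_vg, adjM_apply_bb, adjM_apply_cb, vecTwoMM_al', vecTwoMM_al, not_even_last, if_false, Pi.smul_apply, smul_eq_mul]
    all_goals simp only [vecTwoMM, vecTwoMN]
    all_goals try ring

/-- `β_1 - γ_1 + β_3 - γ_3`. -/
def antiPlus (k : ℕ) : Vtx k → ℚ := e b1 - e c1 + (e b3 - e c3)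
/-- `β_1 - γ_1 - (β_3 - γ_3)`. -/
def antiMinus (k : ℕ) : Vtx k → ℚ := e b1 - e c1 - (e b3 - e c3)
/-- `β_2 - γ_2`. -/
def antiNM (k : ℕ) : Vtx k → ℚ := e b2 - e c2
/-- `β̄_2 - γ̄_2`. -/
def antiMN (k : ℕ) : Vtx k → ℚ := e bb - e cb

/-- With `adjM_antiNM` this puts `antiPlus` in the eigenspace 2 of A², while `antiMinus` and
`antiMN` are in the kernel of A. The involution exchanges `antiPlus` and `antiMinus`. -/
theorem adjM_antiPlus : adjM k *ᵥ antiPlus k = (2 : ℚ) • antiNM k := by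
  simp only [antiPlus, antiNM, mulVec_add, mulVec_sub, adjM_b1, adjM_c1, adjM_b3, adjM_c3]; module
theorem adjM_antiMinus : adjM k *ᵥ antiMinus k = 0 := by
  simp only [antiMinus, mulVec_sub, adjM_b1, adjM_c1, adjM_b3, adjM_c3]; module
theorem adjM_antiNM : adjM k *ᵥ antiNM k = antiPlus k := by
  simp only [antiPlus, antiNM, mulVec_sub, adjM_b2, adjM_c2]; module
theorem adjM_antiMN : adjM k *ᵥ antiMN k = 0 := by
  simp only [antiMN, mulVec_sub, adjM_bb, adjM_cb]; module

theorem antiPlus_conj : antiPlus k ∘ conj k = antiMinus k := by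
  simp only [antiPlus, antiMinus, add_comp_conj, sub_comp_conj, single_comp_conj, conj_b1, conj_c1,
    conj_b3, conj_c3]; module
theorem antiMinus_conj : antiMinus k ∘ conj k = antiPlus k := by
  rw [← antiPlus_conj, comp_conj_comp_conj]
theorem antiNM_conj : antiNM k ∘ conj k = antiMN k := by
  simp only [antiNM, antiMN, sub_comp_conj, single_comp_conj, conj_b2, conj_c2]
theorem antiMN_conj : antiMN k ∘ conj k = antiNM k := by
  rw [← antiNM_conj, comp_conj_comp_conj]

theorem vecNull_conj : vecNull k ∘ conj k = vecNull k := by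
  ext x
  rw [Function.comp_apply]
  induction x using cases_vtx with
  | hal j hj =>
    by_cases h : Even j
    · rw [conj_al_even hj h]
    · rw [conj_al_odd hj h, vecNull_al hj, vecNull_al', nullSeq_odd h]
  | hal' j hj =>
    by_cases h : Even j
    · rw [conj_al'_even hj h]
    · rw [conj_al'_odd hj h, vecNull_al hj, vecNull_al', nullSeq_odd h]
  | _ => simp [vecNull]

theorem vecTwo_conj : vecTwo k ∘ conj k = vecTwo k := by
  ext x
  rw [Function.comp_apply]
  induction x using cases_vtx with
  | hal j hj =>
    by_cases h : Even j
    · rw [conj_al_even hj h]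
    · rw [conj_al_odd hj h, vecTwo_al hj, vecTwo_al', if_neg h]
  | hal' j hj =>
    by_cases h : Even j
    · rw [conj_al'_even hj h]
    · rw [conj_al'_odd hj h, vecTwo_al hj, vecTwo_al', if_neg h]
  | _ => simp [vecTwo]

theorem vecTwoNM_conj : vecTwoNM k ∘ conj k = vecTwoMN k := by
  ext x
  rw [Function.comp_apply]
  induction x using cases_vtx with
  | hal j hj =>
    by_cases h : Even j
    · rw [conj_al_even hj h, vecTwoNM_al hj, if_pos h, vecTwoMN_al]
    · rw [conj_al_odd hj h, vecTwoNM_al', vecTwoMN_al]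
  | hal' j hj =>
    by_cases h : Even j
    · rw [conj_al'_even hj h, vecTwoMN_al' hj, if_pos h, vecTwoNM_al']
    · rw [conj_al'_odd hj h, vecTwoNM_al hj, vecTwoMN_al' hj]
  | _ => simp [vecTwoNM, vecTwoMN]

theorem vecTwoMN_conj : vecTwoMN k ∘ conj k = vecTwoNM k := by
  rw [← vecTwoNM_conj, comp_conj_comp_conj]

theorem leftM_vecNull : leftM k *ᵥ vecNull k = 0 := by
  rw [leftM_mulVec, vecNull_conj, adjM_vecNull, zero_comp_conj]
theorem leftM_vecTwo : leftM k *ᵥ vecTwo k = (2 : ℚ) • vecTwoMN k := by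
  rw [leftM_mulVec, vecTwo_conj, adjM_vecTwo, smul_comp_conj, vecTwoNM_conj]
theorem leftM_vecTwoMN : leftM k *ᵥ vecTwoMN k = vecTwo k := by
  rw [leftM_mulVec, vecTwoMN_conj, adjM_vecTwoNM, vecTwo_conj]
theorem leftM_antiPlus : leftM k *ᵥ antiPlus k = 0 := by
  rw [leftM_mulVec, antiPlus_conj, adjM_antiMinus, zero_comp_conj]
theorem leftM_antiMinus : leftM k *ᵥ antiMinus k = (2 : ℚ) • antiMN k := by
  rw [leftM_mulVec, antiMinus_conj, adjM_antiPlus, smul_comp_conj, antiNM_conj]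
theorem leftM_antiMN : leftM k *ᵥ antiMN k = antiMinus k := by
  rw [leftM_mulVec, antiMN_conj, adjM_antiNM, antiPlus_conj]

/-! ### Right multiplication by β_1 - γ_1 and its commutation relations. -/

/-- The part of right multiplication by `β_1 - γ_1` on `V₁₁`. -/
def antiNN (k : ℕ) : Matrix (Vtx k) (Vtx k) ℚ :=
  (1 / 2 : ℚ) • (vecMulVec (antiPlus k) (vecNull k) + vecMulVec (vecNull k) (antiPlus k) +
    vecMulVec (antiMinus k) (vecTwo k) + vecMulVec (vecTwo k) (antiMinus k))

/-- The part of right multiplication by `β_1 - γ_1` on `V₂₁`. -/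
def antiMNM (k : ℕ) : Matrix (Vtx k) (Vtx k) ℚ :=
  vecMulVec (antiMN k) (vecTwoMN k) + vecMulVec (vecTwoMN k) (antiMN k)

/-- Right multiplication by `β_1 - γ_1`. -/
def antiM (k : ℕ) : Matrix (Vtx k) (Vtx k) ℚ := antiNN k + antiMNM k

theorem antiM_symm : (antiM k)ᵀ = antiM k := by
  simp only [antiM, antiNN, antiMNM, transpose_add, transpose_smul, transpose_vecMulVec]
  module

theorem leftM_symm : (leftM k)ᵀ = leftM k := by
  rw [leftM, transpose_submatrix, adjM_symm]

theorem vecMul_leftM (v : Vtx k → ℚ) : v ᵥ* leftM k = leftM k *ᵥ v := by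
  rw [← mulVec_transpose, leftM_symm]

theorem vecMul_adjM (v : Vtx k → ℚ) : v ᵥ* adjM k = adjM k *ᵥ v := by
  rw [← mulVec_transpose, adjM_symm]

/-- Left multiplication kills `antiPlus` and `vecNull`. It sends `antiMinus`, `vecTwo` to twice
`antiMN`, `vecTwoMN`, and those back without a factor, so the 2 cancels the 1/2 in `antiNN` and the
cross terms agree. -/
theorem commute_antiM_leftM : Commute (antiM k) (leftM k) := by
  rw [commute_iff_eq]
  simp only [antiM, antiNN, antiMNM, Matrix.add_mul, Matrix.mul_add, Matrix.smul_mul, Matrix.mul_smul, mul_vecMulVec,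
    vecMulVec_mul, vecMul_leftM, leftM_vecNull, leftM_vecTwo, leftM_vecTwoMN, leftM_antiPlus,
    leftM_antiMinus, leftM_antiMN, zero_vecMulVec, vecMulVec_zero, smul_vecMulVec, vecMulVec_smul]
  module

theorem antiM_mulVec (v : Vtx k → ℚ) :
    antiM k *ᵥ v = (1 / 2 : ℚ) • ((vecNull k ⬝ᵥ v) • antiPlus k + (antiPlus k ⬝ᵥ v) • vecNull k +
    (vecTwo k ⬝ᵥ v) • antiMinus k + (antiMinus k ⬝ᵥ v) • vecTwo k) +
    ((vecTwoMN k ⬝ᵥ v) • antiMN k + (antiMN k ⬝ᵥ v) • vecTwoMN k) := by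
  simp only [antiM, antiNN, antiMNM, add_mulVec, smul_mulVec, vecMulVec_mulVec]
  simp

theorem submatrix_vecMulVec (u v : Vtx k → ℚ) :
    (vecMulVec u v).submatrix (conj k) (conj k) = vecMulVec (u ∘ conj k) (v ∘ conj k) := rfl

theorem antiNN_conj : (antiNN k).submatrix (conj k) (conj k) =
  (1 / 2 : ℚ) • (vecMulVec (antiMinus k) (vecNull k) + vecMulVec (vecNull k) (antiMinus k) +
    vecMulVec (antiPlus k) (vecTwo k) + vecMulVec (vecTwo k) (antiPlus k)) := by
  rw [antiNN]
  simp only [submatrix_add, submatrix_smul, Pi.add_apply, Pi.smul_apply, submatrix_vecMulVec,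
    vecNull_conj, vecTwo_conj, antiPlus_conj, antiMinus_conj]

theorem antiMNM_conj : (antiMNM k).submatrix (conj k) (conj k) =
    vecMulVec (antiNM k) (vecTwoNM k) + vecMulVec (vecTwoNM k) (antiNM k) := by
  rw [antiMNM]
  simp only [submatrix_add, Pi.add_apply, submatrix_vecMulVec, vecTwoMN_conj, antiMN_conj]

theorem dot_conj (u v : Vtx k → ℚ) : (u ∘ conj k) ⬝ᵥ (v ∘ conj k) = u ⬝ᵥ v := by
  simp only [dotProduct, Function.comp_apply]
  exact Equiv.sum_comp (conj k) (fun x => u x * v x)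

theorem adjM_dot (u v : Vtx k → ℚ) : (adjM k *ᵥ u) ⬝ᵥ v = u ⬝ᵥ (adjM k *ᵥ v) := by
  rw [dotProduct_mulVec, vecMul_adjM]

/-- The kernel of the symmetric matrix A is orthogonal to its image. The next orthogonality
relations hold for the same reason, sometimes after conjugation. -/
theorem vecNull_dot_vecTwo : vecNull k ⬝ᵥ vecTwo k = 0 := by
  have := adjM_dot (vecNull k) (vecTwoNM k)
  rw [adjM_vecNull, adjM_vecTwoNM, zero_dotProduct] at this
  exact this.symm

theorem vecNull_dot_antiPlus : vecNull k ⬝ᵥ antiPlus k = 0 := by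
  have := adjM_dot (vecNull k) (antiNM k)
  rw [adjM_vecNull, adjM_antiNM, zero_dotProduct] at this
  exact this.symm

theorem vecNull_dot_antiMinus : vecNull k ⬝ᵥ antiMinus k = 0 := by
  rw [← dot_conj, vecNull_conj, antiMinus_conj, vecNull_dot_antiPlus]

theorem vecTwo_dot_antiMinus : vecTwo k ⬝ᵥ antiMinus k = 0 := by
  have := adjM_dot (vecTwoNM k) (antiMinus k)
  rw [adjM_antiMinus, adjM_vecTwoNM, dotProduct_zero] at this
  exact this

theorem vecTwo_dot_antiPlus : vecTwo k ⬝ᵥ antiPlus k = 0 := by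
  rw [← dot_conj, vecTwo_conj, antiPlus_conj, vecTwo_dot_antiMinus]

theorem antiPlus_dot_antiMinus : antiPlus k ⬝ᵥ antiMinus k = 0 := by
  have := adjM_dot (antiNM k) (antiMinus k)
  rw [adjM_antiMinus, adjM_antiNM, dotProduct_zero] at this
  exact this

theorem antiMinus_dot_antiMinus : antiMinus k ⬝ᵥ antiMinus k = antiPlus k ⬝ᵥ antiPlus k := by
  rw [← dot_conj, antiMinus_conj]

/-- The two vectors agree up to sign in every coordinate. -/
theorem vecTwo_dot_vecTwo : vecTwo k ⬝ᵥ vecTwo k = vecNull k ⬝ᵥ vecNull k := by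
  apply Finset.sum_congr rfl
  intro x _
  rw [← pow_two, ← pow_two]
  induction x using cases_vtx with
  | hal j hj =>
    rw [vecTwo_al hj, vecNull_al hj]
    split_ifs with h
    · rw [twoSeq_sq h, nullSeq_sq h]
    · rw [nullSeq_odd h]
  | hal' j hj => rfl
  | _ =>
    simp only [vecTwo, vecNull, div_pow, neg_sq, sgn_sq]
    try norm_num

theorem rt_eq_of_vecTwoMN {x : Vtx k} (h : vecTwoMN k x ≠ 0) : lt x = .M ∧ rt x = .N := by
  induction x using cases_vtx with
  | hal j hj => simp [vecTwoMN_al] at h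
  | hal' j hj =>
    rw [vecTwoMN_al' hj] at h
    rw [lt_al', rt_al' hj]
    by_cases h1 : Even j
    · simp [h1] at h
    · simp [h1]
  | _ => first | (refine ⟨rfl, ?_⟩; simp; done) | exact absurd rfl h

theorem rt_eq_of_vecTwo {x : Vtx k} (h : vecTwo k x ≠ 0) : lt x = .N ∧ rt x = .N := by
  induction x using cases_vtx with
  | hal' j hj => simp [vecTwo_al'] at h
  | hal j hj =>
    rw [vecTwo_al hj] at h
    rw [lt_al, rt_al hj]
    by_cases h1 : Even j
    · simp [h1]
    · simp [h1] at h
  | _ => first | (refine ⟨rfl, ?_⟩; simp; done) | exact absurd rfl h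

theorem rt_eq_of_vecNull {x : Vtx k} (h : vecNull k x ≠ 0) : lt x = .N ∧ rt x = .N := by
  induction x using cases_vtx with
  | hal' j hj => simp [vecNull_al'] at h
  | hal j hj =>
    rw [vecNull_al hj] at h
    rw [lt_al, rt_al hj]
    by_cases h1 : Even j
    · simp [h1]
    · exact absurd (nullSeq_odd h1) h
  | _ => first | (refine ⟨rfl, ?_⟩; simp; done) | exact absurd rfl h

theorem projN_mulVec (v : Vtx k → ℚ) (x : Vtx k) :
    (projN k *ᵥ v) x = if rt x = .N then v x else 0 := by
  simp [projN, mulVec_diagonal]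

theorem projN_conj : (projN k).submatrix (conj k) (conj k) =
    diagonal fun x => if lt x = .N then 1 else 0 := by
  rw [projN, submatrix_diagonal _ _ (conj k).injective]
  congr 1
  ext x
  simp [rt_conj]

theorem projN_symm : (projN k)ᵀ = projN k := by simp [projN]

theorem projN_single (x : Vtx k) : projN k *ᵥ e x = if rt x = .N then e x else 0 := by
  ext y
  rw [projN_mulVec]
  by_cases h : y = x
  · subst h; split_ifs <;> simp
  · split_ifs <;> simp [h]

theorem projN_eq_self {v : Vtx k → ℚ} (h : ∀ x, v x ≠ 0 → rt x = .N) : projN k *ᵥ v = v := by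
  ext x
  rw [projN_mulVec]
  split_ifs with hx
  · rfl
  · by_contra hv; exact hx (h x (Ne.symm hv))

theorem projN_antiPlus : projN k *ᵥ antiPlus k = antiPlus k := by
  simp [antiPlus, mulVec_add, mulVec_sub, projN_single, -mulVec_single]
theorem projN_antiMinus : projN k *ᵥ antiMinus k = antiMinus k := by
  simp [antiMinus, mulVec_sub, projN_single, -mulVec_single]
theorem projN_antiMN : projN k *ᵥ antiMN k = antiMN k := by
  simp [antiMN, mulVec_sub, projN_single, -mulVec_single]
theorem projN_vecTwo : projN k *ᵥ vecTwo k = vecTwo k :=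
  projN_eq_self fun _ h => (rt_eq_of_vecTwo h).2
theorem projN_vecNull : projN k *ᵥ vecNull k = vecNull k :=
  projN_eq_self fun _ h => (rt_eq_of_vecNull h).2
theorem projN_vecTwoMN : projN k *ᵥ vecTwoMN k = vecTwoMN k :=
  projN_eq_self fun _ h => (rt_eq_of_vecTwoMN h).2

theorem vecMul_projN (v : Vtx k → ℚ) : v ᵥ* projN k = projN k *ᵥ v := by
  rw [← mulVec_transpose, projN_symm]

theorem antiM_mul_projN : antiM k * projN k = antiM k := by
  simp only [antiM, antiNN, antiMNM, Matrix.add_mul, Matrix.smul_mul, vecMulVec_mul, vecMul_projN, projN_antiPlus,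
    projN_antiMinus, projN_antiMN, projN_vecTwo, projN_vecNull, projN_vecTwoMN]

theorem projN_mul_antiM : projN k * antiM k = antiM k := by
  have := congrArg transpose (antiM_mul_projN (k := k))
  rwa [transpose_mul, projN_symm, antiM_symm] at this

theorem commute_conj {X Y : Matrix (Vtx k) (Vtx k) ℚ}
    (h : Commute X (Y.submatrix (conj k) (conj k))) :
    Commute Y (X.submatrix (conj k) (conj k)) := by
  have h1 := congrArg (fun Z => Z.submatrix (conj k) (conj k)) h.eq
  simp only [← Matrix.submatrix_mul_equiv _ _ _ (conj k), submatrix_submatrix] at h1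
  have h2 : (conj k : Vtx k → Vtx k) ∘ conj k = id := by ext x; simp
  rw [h2, submatrix_id_id] at h1
  exact h1.symm

/-- Projection to the vertices with left coefficient `N`. -/
def projLeft (k : ℕ) : Matrix (Vtx k) (Vtx k) ℚ := (projN k).submatrix (conj k) (conj k)

theorem projLeft_mulVec (v : Vtx k → ℚ) : projLeft k *ᵥ v = (projN k *ᵥ (v ∘ conj k)) ∘ conj k :=
  Generates.submatrix_mulVec _ conj_conj _ _

theorem projLeft_symm : (projLeft k)ᵀ = projLeft k := by
  rw [projLeft, transpose_submatrix, projN_symm]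

theorem vecMul_projLeft (v : Vtx k → ℚ) : v ᵥ* projLeft k = projLeft k *ᵥ v := by
  rw [← mulVec_transpose, projLeft_symm]

theorem projLeft_antiPlus : projLeft k *ᵥ antiPlus k = antiPlus k := by
  rw [projLeft_mulVec, antiPlus_conj, projN_antiMinus, antiMinus_conj]
theorem projLeft_antiMinus : projLeft k *ᵥ antiMinus k = antiMinus k := by
  rw [projLeft_mulVec, antiMinus_conj, projN_antiPlus, antiPlus_conj]
theorem projLeft_vecNull : projLeft k *ᵥ vecNull k = vecNull k := by
  rw [projLeft_mulVec, vecNull_conj, projN_vecNull, vecNull_conj]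
theorem projLeft_vecTwo : projLeft k *ᵥ vecTwo k = vecTwo k := by
  rw [projLeft_mulVec, vecTwo_conj, projN_vecTwo, vecTwo_conj]
theorem projN_antiNM : projN k *ᵥ antiNM k = 0 := by
  simp [antiNM, mulVec_sub, projN_single, -mulVec_single]
theorem projN_vecTwoNM : projN k *ᵥ vecTwoNM k = 0 := by
  ext x
  rw [projN_mulVec]
  split_ifs with h
  · rw [← vecTwoMN_conj, Function.comp_apply]
    by_contra h1
    have := (rt_eq_of_vecTwoMN h1).1
    rw [lt_conj, h] at this
    cases this
  · rfl
theorem projLeft_antiMN : projLeft k *ᵥ antiMN k = 0 := by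
  rw [projLeft_mulVec, antiMN_conj, projN_antiNM, zero_comp_conj]
theorem projLeft_vecTwoMN : projLeft k *ᵥ vecTwoMN k = 0 := by
  rw [projLeft_mulVec, vecTwoMN_conj, projN_vecTwoNM, zero_comp_conj]

theorem antiNN_mul_projLeft : antiNN k * projLeft k = antiNN k := by
  simp only [antiNN, Matrix.add_mul, Matrix.smul_mul, vecMulVec_mul, vecMul_projLeft,
    projLeft_antiPlus, projLeft_antiMinus, projLeft_vecTwo, projLeft_vecNull]
theorem projLeft_mul_antiNN : projLeft k * antiNN k = antiNN k := by
  simp only [antiNN, Matrix.mul_add, Matrix.mul_smul, mul_vecMulVec,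
    projLeft_antiPlus, projLeft_antiMinus, projLeft_vecTwo, projLeft_vecNull]
theorem antiMNM_mul_projLeft : antiMNM k * projLeft k = 0 := by
  simp only [antiMNM, Matrix.add_mul, vecMulVec_mul, vecMul_projLeft, projLeft_antiMN,
    projLeft_vecTwoMN, vecMulVec_zero, add_zero]
theorem projLeft_mul_antiMNM : projLeft k * antiMNM k = 0 := by
  simp only [antiMNM, Matrix.mul_add, mul_vecMulVec, projLeft_antiMN,
    projLeft_vecTwoMN, zero_vecMulVec, add_zero]

theorem commute_antiM_projLeft : Commute (antiM k) (projLeft k) := by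
  rw [commute_iff_eq, antiM, Matrix.add_mul, Matrix.mul_add, antiNN_mul_projLeft,
    projLeft_mul_antiNN, antiMNM_mul_projLeft, projLeft_mul_antiMNM]

theorem projLeft_mul_antiM_conj : projLeft k * (antiM k).submatrix (conj k) (conj k) =
    (antiM k).submatrix (conj k) (conj k) := by
  rw [projLeft, Matrix.submatrix_mul_equiv, projN_mul_antiM]

/-- The blocks on V₂₁ and V₁₂ contribute nothing: the first is annihilated by the projection to left
coefficient N, the second by the projection to right coefficient N. -/
theorem antiM_mul_antiM_conj : antiM k * (antiM k).submatrix (conj k) (conj k) =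
    antiNN k * (antiNN k).submatrix (conj k) (conj k) := by
  have h1 : antiMNM k * (antiM k).submatrix (conj k) (conj k) = 0 := by
    rw [← projLeft_mul_antiM_conj, ← Matrix.mul_assoc, antiMNM_mul_projLeft, Matrix.zero_mul]
  have h2 : antiM k * (antiMNM k).submatrix (conj k) (conj k) = 0 := by
    rw [← antiM_mul_projN, Matrix.mul_assoc, antiMNM_conj]
    simp only [Matrix.mul_add, mul_vecMulVec, projN_antiNM, projN_vecTwoNM, zero_vecMulVec, add_zero,
      Matrix.mul_zero]
  have h3 : (antiM k).submatrix (conj k) (conj k) =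
    (antiNN k).submatrix (conj k) (conj k) + (antiMNM k).submatrix (conj k) (conj k) := rfl
  have h4 : antiMNM k * (antiMNM k).submatrix (conj k) (conj k) = 0 := by
    rw [antiM, Matrix.add_mul] at h2
    have h5 : antiNN k * (antiMNM k).submatrix (conj k) (conj k) = 0 := by
      have := congrArg (projLeft k * ·) h2
      simpa only [Matrix.mul_add, ← Matrix.mul_assoc, projLeft_mul_antiNN, projLeft_mul_antiMNM,
        Matrix.zero_mul, add_zero, Matrix.mul_zero] using this
    rw [h5, zero_add] at h2
    exact h2
  rw [h3, Matrix.mul_add] at h1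
  rw [h4, add_zero] at h1
  rw [h3, Matrix.mul_add, h2, add_zero, antiM, Matrix.add_mul, h1, add_zero]

/-- Orthogonality leaves four rank-one terms, which transposition exchanges in pairs. Their
coefficients are squared norms, equal within each pair by `vecTwo_dot_vecTwo` and
`antiMinus_dot_antiMinus`. -/
theorem antiNN_mul_conj_symm : (antiNN k * (antiNN k).submatrix (conj k) (conj k))ᵀ =
    antiNN k * (antiNN k).submatrix (conj k) (conj k) := by
  have h1 := vecTwo_dot_antiPlus (k := k)
  have h2 := vecTwo_dot_antiMinus (k := k)
  have h3 := vecNull_dot_antiPlus (k := k)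
  have h4 := vecNull_dot_antiMinus (k := k)
  have h5 := vecNull_dot_vecTwo (k := k)
  have h6 := antiPlus_dot_antiMinus (k := k)
  have h1' := h1; rw [dotProduct_comm] at h1'
  have h2' := h2; rw [dotProduct_comm] at h2'
  have h3' := h3; rw [dotProduct_comm] at h3'
  have h4' := h4; rw [dotProduct_comm] at h4'
  have h5' := h5; rw [dotProduct_comm] at h5'
  have h6' := h6; rw [dotProduct_comm] at h6'
  rw [antiNN_conj, antiNN]
  simp only [Matrix.add_mul, Matrix.mul_add, Matrix.smul_mul, Matrix.mul_smul,
    vecMulVec_mul_vecMulVec, h1, h2, h3, h4, h5, h6, h1', h2', h3', h4', h5', h6', zero_smul,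
    vecMulVec_zero, add_zero, zero_add, vecMulVec_smul, transpose_smul, transpose_add,
    transpose_vecMulVec, vecTwo_dot_vecTwo, antiMinus_dot_antiMinus]
  module

/-- A product of two symmetric matrices is symmetric exactly when they commute. -/
theorem commute_antiM_conj : Commute (antiM k) ((antiM k).submatrix (conj k) (conj k)) := by
  have h := antiNN_mul_conj_symm (k := k)
  rw [← antiM_mul_antiM_conj, transpose_mul, transpose_submatrix, antiM_symm] at h
  exact h.symm

theorem adjM_mulVec_ne {x y : Vtx k} (h : ¬ Adj x y) : adjM k x y = 0 := if_neg h

theorem commute_adjM_projLeft : Commute (adjM k) (projLeft k) := by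
  rw [commute_iff_eq, projLeft, projN_conj]
  ext x y
  rw [mul_diagonal, diagonal_mul]
  by_cases h : Adj x y
  · rw [h.lt_eq]; ring
  · rw [adjM_mulVec_ne h]; ring

theorem commute_projN_projLeft : Commute (projN k) (projLeft k) := by
  rw [projLeft, projN_conj, projN]
  exact commute_diagonal _ _

/-! ### The identity vector is cyclic. -/

/-- The identity vector `α_0 + α'_0`. -/
def oneVec (k : ℕ) : Vtx k → ℚ := e (al 0) + e (al' 0)

theorem projN_oneVec : projN k *ᵥ oneVec k = e (al 0) := by
  rw [oneVec, mulVec_add, projN_single, projN_single, rt_al (by omega), rt_al' (by omega)]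
  simp

theorem adjM_oneVec : adjM k *ᵥ oneVec k = e (al 1) + e (al' 1) := by
  rw [oneVec, mulVec_add, adjM_al_zero, adjM_al'_zero]

/-- Both `vecNull` and `vecTwo` equal 1 at α_0, so the result is half of `antiPlus` + `antiMinus`;
β_3 - γ_3 cancels. -/
theorem antiM_oneVec : antiM k *ᵥ oneVec k = e b1 - e c1 := by
  rw [antiM_mulVec, oneVec]
  simp (disch := omega) only [dotProduct_add, dotProduct_single_one, vecNull_al, vecNull_al', vecTwo_al, vecTwo_al',
    vecTwoMN_al, vecTwoMN_al']
  simp [antiPlus, antiMinus, antiMN, nullSeq, twoSeq, al, al']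
  module

theorem conj_al_zero : conj k (al 0) = al 0 := conj_al_even (by omega) (by simp)
theorem conj_al'_zero : conj k (al' 0) = al' 0 := conj_al'_even (by omega) (by simp)
theorem conj_al_one : conj k (al 1) = al' 1 := conj_al_odd (by omega) (by simp)
theorem conj_al'_one : conj k (al' 1) = al 1 := conj_al'_odd (by omega) (by simp)

/-- The generating set: right multiplication by `α_1 + ᾱ_1`, by `β_1 - γ_1` and by `α_0`. -/
def gens (k : ℕ) : Set (Matrix (Vtx k) (Vtx k) ℚ) := {adjM k, antiM k, projN k}

theorem adjM_mem : adjM k ∈ Algebra.adjoin ℚ (gens k) :=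
  Algebra.subset_adjoin (by simp [gens])
theorem antiM_mem : antiM k ∈ Algebra.adjoin ℚ (gens k) :=
  Algebra.subset_adjoin (by simp [gens])
theorem projN_mem : projN k ∈ Algebra.adjoin ℚ (gens k) :=
  Algebra.subset_adjoin (by simp [gens])

/-- The orbit of the identity vector. -/
def orbit (k : ℕ) : Submodule ℚ (Vtx k → ℚ) where
  carrier := {v | ∃ X ∈ Algebra.adjoin ℚ (gens k), X *ᵥ oneVec k = v}
  add_mem' := by
    rintro _ _ ⟨X, hX, rfl⟩ ⟨Y, hY, rfl⟩
    exact ⟨X + Y, add_mem hX hY, add_mulVec ..⟩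
  zero_mem' := ⟨0, zero_mem _, zero_mulVec _⟩
  smul_mem' := by
    rintro c _ ⟨X, hX, rfl⟩
    exact ⟨c • X, Subalgebra.smul_mem _ hX c, smul_mulVec ..⟩

theorem mulVec_mem_orbit {X : Matrix (Vtx k) (Vtx k) ℚ} (hX : X ∈ Algebra.adjoin ℚ (gens k))
    {v : Vtx k → ℚ} (hv : v ∈ orbit k) : X *ᵥ v ∈ orbit k := by
  obtain ⟨Y, hY, rfl⟩ := hv
  exact ⟨X * Y, mul_mem hX hY, (mulVec_mulVec ..).symm⟩

theorem al_mem_of_invariant (W : Submodule ℚ (Vtx k → ℚ)) {L : Matrix (Vtx k) (Vtx k) ℚ}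
    {a : ℕ → Vtx k} (hW : ∀ v ∈ W, L *ᵥ v ∈ W) (h0 : e (a 0) ∈ W) (ha0 : L *ᵥ e (a 0) = e (a 1))
    (ha : ∀ j, j + 2 < 4 * k + 4 → L *ᵥ e (a (j + 1)) = e (a j) + e (a (j + 2)))
    {j : ℕ} (hj : j < 4 * k + 4) : e (a j) ∈ W := by
  have h : ∀ j, j + 1 < 4 * k + 4 → e (a j) ∈ W ∧ e (a (j + 1)) ∈ W := by
    intro j
    induction j with
    | zero => exact fun _ => ⟨h0, by rw [← ha0]; exact hW _ h0⟩
    | succ j ih =>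
      intro hj
      obtain ⟨h1, h2⟩ := ih (by omega)
      refine ⟨h2, ?_⟩
      have := W.sub_mem (hW _ h2) h1
      rwa [ha j (by omega), add_sub_cancel_left] at this
  rcases j with _ | j
  · exact h0
  · exact (h j hj).2

/-- The adjacency matrix and α_0 produce the paths and the sums over both legs. The differences β_1
- γ_1 and β̄_2 - γ̄_2 come from `antiM`, and half-sums separate the legs. -/
theorem single_mem_orbit (x : Vtx k) : e x ∈ orbit k := by
  have hone : oneVec k ∈ orbit k := ⟨1, one_mem _, one_mulVec _⟩
  have hA : ∀ v ∈ orbit k, adjM k *ᵥ v ∈ orbit k := fun v => mulVec_mem_orbit adjM_mem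
  have h0 : e (al 0) ∈ orbit k := by
    rw [← projN_oneVec]; exact mulVec_mem_orbit projN_mem hone
  have h0' : e (al' 0) ∈ orbit k := by
    have := (orbit k).sub_mem hone h0
    rwa [oneVec, add_sub_cancel_left] at this
  have hal : ∀ j < 4 * k + 4, e (al j) ∈ orbit k := fun j hj =>
    al_mem_of_invariant _ hA h0 adjM_al_zero (fun j h => adjM_al_succ h) hj
  have hal' : ∀ j < 4 * k + 4, e (al' j) ∈ orbit k := fun j hj =>
    al_mem_of_invariant _ hA h0' adjM_al'_zero (fun j h => adjM_al'_succ h) hj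
  have hd1 : e b1 - e c1 ∈ orbit k := by
    rw [← antiM_oneVec]; exact mulVec_mem_orbit antiM_mem hone
  have hs1 : e b1 + e c1 ∈ orbit k := by
    have := (orbit k).sub_mem (hA _ (hal (4 * k + 3) (by omega))) (hal (4 * k + 2) (by omega))
    rw [adjM_al_last] at this
    convert this using 1; abel
  have hb1 : e b1 ∈ orbit k := by
    have := (orbit k).smul_mem (1 / 2) ((orbit k).add_mem hs1 hd1)
    convert this using 1; module
  have hc1 : e c1 ∈ orbit k := by
    have := (orbit k).sub_mem hs1 hb1
    rwa [add_sub_cancel_left] at this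
  have hb2 : e b2 ∈ orbit k := by
    have := (orbit k).sub_mem (hA _ hb1) (hal (4 * k + 3) (by omega))
    rwa [adjM_b1, add_sub_cancel_left] at this
  have hc2 : e c2 ∈ orbit k := by
    have := (orbit k).sub_mem (hA _ hc1) (hal (4 * k + 3) (by omega))
    rwa [adjM_c1, add_sub_cancel_left] at this
  have hb3 : e b3 ∈ orbit k := by
    have := (orbit k).sub_mem (hA _ hb2) hb1
    rwa [adjM_b2, add_sub_cancel_left] at this
  have hc3 : e c3 ∈ orbit k := by
    have := (orbit k).sub_mem (hA _ hc2) hc1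
    rwa [adjM_c2, add_sub_cancel_left] at this
  have hfg : e vf + e vg ∈ orbit k := by
    have := (orbit k).sub_mem (hA _ (hal' (4 * k + 3) (by omega))) (hal' (4 * k + 2) (by omega))
    rw [adjM_al'_last] at this
    convert this using 1; abel
  have hsb : e bb + e cb ∈ orbit k := by
    have := (orbit k).sub_mem (hA _ hfg) ((orbit k).smul_mem 2 (hal' (4 * k + 3) (by omega)))
    rw [mulVec_add, adjM_vf, adjM_vg] at this
    convert this using 1; module
  -- At ᾱ_1 only `vecTwoMN` is nonzero among the vectors defining `antiM`, with value 1, so the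
  -- image is `antiMN`.
  have hdb : e bb - e cb ∈ orbit k := by
    have := mulVec_mem_orbit antiM_mem (hal' 1 (by omega))
    rw [antiM_mulVec] at this
    simp (disch := omega) only [dotProduct_single_one, vecNull_al', vecTwo_al', vecTwoMN_al'] at this
    simpa [antiPlus, antiMinus, antiMN, nullSeq, twoSeq, al, al'] using this
  have hbb : e bb ∈ orbit k := by
    have := (orbit k).smul_mem (1 / 2) ((orbit k).add_mem hsb hdb)
    convert this using 1; module
  have hcb : e cb ∈ orbit k := by
    have := (orbit k).sub_mem hsb hbb
    rwa [add_sub_cancel_left] at this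
  have hg : e vg ∈ orbit k := by
    rw [← adjM_bb]; exact hA _ hbb
  have hf : e vf ∈ orbit k := by
    have := (orbit k).sub_mem hfg hg
    rwa [add_sub_cancel_right] at this
  induction x using cases_vtx with
  | hal j hj => exact hal j hj
  | hal' j hj => exact hal' j hj
  | _ => assumption

theorem mem_of_single_mem {W : Submodule ℚ (Vtx k → ℚ)} (h : ∀ x, e x ∈ W) (v : Vtx k → ℚ) :
    v ∈ W := by
  rw [pi_eq_sum_univ' v]
  refine W.sum_mem fun x _ => W.smul_mem _ ?_
  convert h x using 1

theorem generates (k : ℕ) : Generates (conj k) (oneVec k) (gens k) where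
  invol := conj_conj
  symm := by
    rintro X (rfl | rfl | rfl)
    exacts [adjM_symm, antiM_symm, projN_symm]
  conj_one := by
    rw [oneVec, add_comp_conj, single_comp_conj, single_comp_conj, conj_al_zero, conj_al'_zero]
  conj_apply_one := by
    rintro X (rfl | rfl | rfl)
    · rw [adjM_oneVec, add_comp_conj, single_comp_conj, single_comp_conj, conj_al_one, conj_al'_one,
        add_comm]
    · rw [antiM_oneVec, sub_comp_conj, single_comp_conj, single_comp_conj, conj_b1, conj_c1]
    · rw [projN_oneVec, single_comp_conj, conj_al_zero]
  comm := by
    rintro X (rfl | rfl | rfl) Y (rfl | rfl | rfl)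
    · exact commute_adjM_leftM
    · exact commute_conj commute_antiM_leftM
    · exact commute_adjM_projLeft
    · exact commute_antiM_leftM
    · exact commute_antiM_conj
    · exact commute_antiM_projLeft
    · exact commute_conj commute_adjM_projLeft
    · exact commute_conj commute_antiM_projLeft
    · exact commute_projN_projLeft
  cyclic := fun v => mem_of_single_mem single_mem_orbit v

/-! ### Chebyshev polynomials in the adjacency matrix. -/

/-- The Chebyshev polynomials in the adjacency matrix. -/
noncomputable def cheb (k : ℕ) : ℕ → Matrix (Vtx k) (Vtx k) ℚ
  | 0 => 1
  | 1 => adjM k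
  | m + 2 => adjM k * cheb k (m + 1) - cheb k m

theorem cheb_induction {p : ℕ → Prop} (h0 : p 0) (h1 : p 1)
    (h : ∀ m, p m → p (m + 1) → p (m + 2)) (m : ℕ) : p m := by
  have : p m ∧ p (m + 1) := by
    induction m with
    | zero => exact ⟨h0, h1⟩
    | succ m ih => exact ⟨ih.2, h m ih.1 ih.2⟩
  exact this.1

theorem cheb_mem (m : ℕ) : cheb k m ∈ Algebra.adjoin ℚ (gens k) := by
  induction m using cheb_induction with
  | h0 => exact one_mem _
  | h1 => exact adjM_mem
  | h m h h' => exact sub_mem (mul_mem adjM_mem h') h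

theorem commute_cheb {X : Matrix (Vtx k) (Vtx k) ℚ} (hX : Commute X (adjM k)) (m : ℕ) :
    Commute X (cheb k m) := by
  induction m using cheb_induction with
  | h0 => exact Commute.one_right _
  | h1 => exact hX
  | h m h h' => exact (hX.mul_right h').sub_right h

theorem cheb_comm (m l : ℕ) : cheb k m * cheb k l = cheb k l * cheb k m :=
  commute_cheb (commute_cheb (Commute.refl _) m).symm l

theorem cheb_symm (m : ℕ) : (cheb k m)ᵀ = cheb k m := by
  induction m using cheb_induction with
  | h0 => exact transpose_one
  | h1 => exact adjM_symm
  | h m h h' =>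
    rw [cheb, transpose_sub, transpose_mul, h, h', adjM_symm,
      (commute_cheb (Commute.refl (adjM k)) (m + 1)).eq]

theorem cheb_succ_succ (m : ℕ) (v : Vtx k → ℚ) :
    cheb k (m + 2) *ᵥ v = adjM k *ᵥ (cheb k (m + 1) *ᵥ v) - cheb k m *ᵥ v := by
  rw [cheb, sub_mulVec, mulVec_mulVec]

/-- The Chebyshev linearization U_{m+1} U_{m+d+1} = U_m U_{m+d+2} + U_d: iterating it writes any
product as a sum of U_l, with no minus sign. -/
theorem cheb_mul_sub (m d : ℕ) :
    cheb k (m + 1) * cheb k (m + d + 1) = cheb k m * cheb k (m + d + 2) + cheb k d := by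
  induction m with
  | zero =>
    rw [zero_add, zero_add, cheb, cheb, cheb, one_mul, sub_add_cancel]
  | succ m ih =>
    have h1 : cheb k (m + 1 + 1) = adjM k * cheb k (m + 1) - cheb k m := rfl
    have h2 : cheb k (m + 1 + d + 2) = adjM k * cheb k (m + d + 2) - cheb k (m + d + 1) := by
      rw [show m + 1 + d + 2 = m + d + 1 + 2 by ring]; rfl
    have h3 : cheb k (m + 1 + d + 1) = cheb k (m + d + 2) := by
      rw [show m + 1 + d + 1 = m + d + 2 by ring]
    rw [h1, h2, h3, Matrix.sub_mul, Matrix.mul_sub, ih, ← Matrix.mul_assoc (cheb k (m + 1)),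
      (commute_cheb (Commute.refl (adjM k)) (m + 1)).eq]
    abel

/-- Until the branch is reached the Chebyshev recursion just walks along the path. -/
theorem cheb_apply_start {a : ℕ → Vtx k} (ha0 : adjM k *ᵥ e (a 0) = e (a 1))
    (ha : ∀ j, j + 2 < 4 * k + 4 → adjM k *ᵥ e (a (j + 1)) = e (a j) + e (a (j + 2)))
    {j : ℕ} (hj : j < 4 * k + 4) : cheb k j *ᵥ e (a 0) = e (a j) := by
  revert hj
  induction j using cheb_induction with
  | h0 => exact fun _ => one_mulVec _
  | h1 => exact fun _ => ha0
  | h m h h' =>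
    intro hj
    rw [cheb_succ_succ, h (by omega), h' (by omega), ha m hj, add_sub_cancel_left]

theorem cheb_al {j : ℕ} (hj : j < 4 * k + 4) : cheb k j *ᵥ e (al 0) = e (al j) :=
  cheb_apply_start adjM_al_zero (fun _ h => adjM_al_succ h) hj

theorem cheb_al' {j : ℕ} (hj : j < 4 * k + 4) : cheb k j *ᵥ e (al' 0) = e (al' j) :=
  cheb_apply_start adjM_al'_zero (fun _ h => adjM_al'_succ h) hj

theorem R_al {j : ℕ} (hj : j < 4 * k + 4) :
    (generates k).R (e (al j)) = cheb k j * projN k :=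
  (generates k).R_unique (mul_mem (cheb_mem j) projN_mem)
    (by rw [← mulVec_mulVec, projN_oneVec, cheb_al hj])

theorem R_al' {j : ℕ} (hj : j < 4 * k + 4) :
    (generates k).R (e (al' j)) = cheb k j * (1 - projN k) :=
  (generates k).R_unique (mul_mem (cheb_mem j) (sub_mem (one_mem _) projN_mem))
    (by rw [← mulVec_mulVec, sub_mulVec, projN_oneVec, one_mulVec, oneVec, add_sub_cancel_left,
      cheb_al' hj])

/-! ### Waves leaving the branch along the path. -/

section Waves

/-- A wave absent from the path at the start enters only through the branch and moves with speed one
towards the end `a 0`. The bound on `m` stops before a reflection at that end can be felt. -/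
theorem tail_shift {W : ℕ → Vtx k → ℚ} (hW : ∀ m, W (m + 2) = adjM k *ᵥ W (m + 1) - W m)
    {a : ℕ → Vtx k} (ha0 : ∀ u, (adjM k *ᵥ u) (a 0) = u (a 1))
    (ha : ∀ u j, j + 2 < 4 * k + 4 → (adjM k *ᵥ u) (a (j + 1)) = u (a j) + u (a (j + 2)))
    (h0 : ∀ j < 4 * k + 4, W 0 (a j) = 0) (h1 : ∀ j < 4 * k + 3, W 1 (a j) = 0) (m : ℕ)
    (hm : m ≤ 4 * k + 4) {j : ℕ} (hj : j < 4 * k + 3) : W (m + 1) (a j) = W m (a (j + 1)) := by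
  induction m using Nat.strong_induction_on generalizing j with
  | _ m ih =>
    rcases m with _ | m
    · rw [h1 j hj, h0 _ (by omega)]
    · rw [hW, Pi.sub_apply]
      rcases j with _ | j
      · rw [ha0]
        -- The value at the end of the path is traced back along a diagonal of space-time to time 0,
        -- where the path is empty.
        have hc : ∀ i ≤ m, W (m - i) (a i) = W m (a 0) := by
          intro i
          induction i with
          | zero => simp
          | succ i ih' =>
            intro hi
            rw [← ih' (by omega), ← ih (m - (i + 1)) (by omega) (by omega) (by omega)]
            congr 2; omega
        rw [← hc m le_rfl, Nat.sub_self, h0 m (by omega)]; simp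
      · rw [ha _ _ (by omega), ih m (by omega) (by omega) (by omega)]; ring

/-- Each value on the path is an earlier value at the branch end, or an initial zero. -/
theorem tail_nonneg {W : ℕ → Vtx k → ℚ} {a : ℕ → Vtx k}
    (h0 : ∀ j < 4 * k + 4, W 0 (a j) = 0)
    (hs : ∀ m ≤ 4 * k + 4, ∀ j < 4 * k + 3, W (m + 1) (a j) = W m (a (j + 1)))
    (m : ℕ) (hm : m ≤ 4 * k + 5) (hn : ∀ i ≤ m, 0 ≤ W i (a (4 * k + 3))) {j : ℕ}
    (hj : j < 4 * k + 4) : 0 ≤ W m (a j) := by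
  induction m generalizing j with
  | zero => rw [h0 j hj]
  | succ m ih =>
    by_cases h : j = 4 * k + 3
    · subst h; exact hn _ le_rfl
    · rw [hs m (by omega) j (by omega)]
      exact ih (by omega) (fun i hi => hn i (by omega)) (by omega)

/-- The rules for a solution of the wave equation at the branch vertices of `Γ_k`, when no wave
comes in along the path. -/
structure BranchWave (k : ℕ) (W : ℕ → Vtx k → ℚ) : Prop where
  al : ∀ m ≤ 4 * k + 4, W (m + 2) (al (4 * k + 3)) = W (m + 1) b1 + W (m + 1) c1
  b1 : ∀ m, W (m + 2) b1 = W (m + 1) (Vtx.al (4 * k + 3)) + W (m + 1) b2 - W m b1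
  b2 : ∀ m, W (m + 2) b2 = W (m + 1) Vtx.b1 + W (m + 1) b3 - W m b2
  b3 : ∀ m, W (m + 2) b3 = W (m + 1) Vtx.b2 - W m b3
  c1 : ∀ m, W (m + 2) c1 = W (m + 1) (Vtx.al (4 * k + 3)) + W (m + 1) c2 - W m c1
  c2 : ∀ m, W (m + 2) c2 = W (m + 1) Vtx.c1 + W (m + 1) c3 - W m c2
  c3 : ∀ m, W (m + 2) c3 = W (m + 1) Vtx.c2 - W m c3
  nonneg : ∀ m ≤ 4 * k + 5, (∀ i ≤ m, 0 ≤ W i (Vtx.al (4 * k + 3))) → ∀ j < 4 * k + 4,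
    0 ≤ W m (Vtx.al j)

/-- The rules for a solution of the wave equation at the branch vertices of `Γ'_k`, when no wave
comes in along the path. -/
structure BranchWave' (k : ℕ) (W : ℕ → Vtx k → ℚ) : Prop where
  al : ∀ m ≤ 4 * k + 4, W (m + 2) (al' (4 * k + 3)) = W (m + 1) vf + W (m + 1) vg
  vf : ∀ m, W (m + 2) vf = W (m + 1) (al' (4 * k + 3)) - W m vf
  vg : ∀ m, W (m + 2) vg = W (m + 1) (al' (4 * k + 3)) + W (m + 1) bb + W (m + 1) cb - W m vg
  bb : ∀ m, W (m + 2) bb = W (m + 1) Vtx.vg - W m bb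
  cb : ∀ m, W (m + 2) cb = W (m + 1) Vtx.vg - W m cb
  nonneg : ∀ m ≤ 4 * k + 5, (∀ i ≤ m, 0 ≤ W i (al' (4 * k + 3))) → ∀ j < 4 * k + 4,
    0 ≤ W m (al' j)

/-- At α_n the neighbour α_{n-1} carries the value α_n had one step before, which cancels the
subtracted term of the wave equation. The branch thus evolves by itself, whatever the length of the
path. -/
theorem branchWave {W : ℕ → Vtx k → ℚ} (hW : ∀ m, W (m + 2) = adjM k *ᵥ W (m + 1) - W m)
    (h0 : ∀ j < 4 * k + 4, W 0 (al j) = 0) (h1 : ∀ j < 4 * k + 3, W 1 (al j) = 0) :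
    BranchWave k W := by
  have hs := fun m hm j hj => tail_shift hW adjM_apply_al_zero (fun u j h => adjM_apply_al_succ u h)
    h0 h1 m hm (j := j) hj
  refine ⟨fun m hm => ?_, fun m => ?_, fun m => ?_, fun m => ?_, fun m => ?_, fun m => ?_,
    fun m => ?_, fun m hm h j hj => tail_nonneg h0 hs m hm h hj⟩
  · rw [hW, Pi.sub_apply, adjM_apply_al_last, hs m hm (4 * k + 2) (by omega)]; ring
  · rw [hW, Pi.sub_apply, adjM_apply_b1]
  · rw [hW, Pi.sub_apply, adjM_apply_b2]
  · rw [hW, Pi.sub_apply, adjM_apply_b3]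
  · rw [hW, Pi.sub_apply, adjM_apply_c1]
  · rw [hW, Pi.sub_apply, adjM_apply_c2]
  · rw [hW, Pi.sub_apply, adjM_apply_c3]

theorem branchWave' {W : ℕ → Vtx k → ℚ} (hW : ∀ m, W (m + 2) = adjM k *ᵥ W (m + 1) - W m)
    (h0 : ∀ j < 4 * k + 4, W 0 (al' j) = 0)
    (h1 : ∀ j < 4 * k + 3, W 1 (al' j) = 0) : BranchWave' k W := by
  have hs := fun m hm j hj => tail_shift hW adjM_apply_al'_zero (fun u j h => adjM_apply_al'_succ u h)
    h0 h1 m hm (j := j) hj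
  refine ⟨fun m hm => ?_, fun m => ?_, fun m => ?_, fun m => ?_, fun m => ?_,
    fun m hm h j hj => tail_nonneg h0 hs m hm h hj⟩
  · rw [hW, Pi.sub_apply, adjM_apply_al'_last, hs m hm (4 * k + 2) (by omega)]; ring
  · rw [hW, Pi.sub_apply, adjM_apply_vf]
  · rw [hW, Pi.sub_apply, adjM_apply_vg]
  · rw [hW, Pi.sub_apply, adjM_apply_bb]
  · rw [hW, Pi.sub_apply, adjM_apply_cb]

end Waves

/-! ### Tribonacci formulas for the waves at the branch. -/

/-- The Tribonacci sequence `1, 0, 0, 1, 1, 2, 4, 7, …`. -/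
def trib : ℕ → ℚ
  | 0 => 1
  | 1 => 0
  | 2 => 0
  | n + 3 => trib n + trib (n + 1) + trib (n + 2)

/-- The sequence `1, 0, 0, -1, 1, 0, 0, -1, …`. -/
def altSeq : ℕ → ℚ
  | 0 => 1
  | 1 => 0
  | 2 => 0
  | 3 => -1
  | n + 4 => altSeq n

theorem trib_rec (n : ℕ) : trib (n + 3) = trib n + trib (n + 1) + trib (n + 2) := rfl

theorem trib_nonneg (n : ℕ) : 0 ≤ trib n := by
  induction n using trib.induct with
  | case1 => simp [trib]
  | case2 => simp [trib]
  | case3 => simp [trib]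
  | case4 n h1 h2 h3 => rw [trib]; positivity

/-- Absorbs the sign (-1)^i in `wave_betaBar`. -/
theorem one_le_trib_add (n : ℕ) : 1 ≤ trib n + trib (n + 2) := by
  induction n using trib.induct with
  | case1 => simp [trib]
  | case2 => simp [trib]
  | case3 => simp [trib]
  | case4 n h1 h2 h3 =>
    have := trib_nonneg (n + 1)
    have := trib_nonneg (n + 2)
    have := trib_nonneg (n + 3)
    have := trib_nonneg (n + 4)
    rw [trib_rec, trib_rec (n + 2)]; rw [show n + 2 + 2 = n + 4 by ring, show n + 2 + 1 = n + 3 by ring]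
    linarith

theorem altSeq_rec (n : ℕ) : altSeq (n + 3) = -(altSeq n + altSeq (n + 1) + altSeq (n + 2)) := by
  induction n using altSeq.induct with
  | case1 => simp [altSeq]
  | case2 => simp [altSeq]
  | case3 => simp [altSeq]
  | case4 => simp [altSeq]
  | case5 n ih =>
    rw [show n + 4 + 3 = n + 3 + 4 by ring, show n + 4 + 1 = n + 1 + 4 by ring,
      show n + 4 + 2 = n + 2 + 4 by ring]
    simp only [altSeq] at ih ⊢
    exact ih

/-- The difference between the two legs never exceeds their sum, so each leg separately has
nonnegative values in `wave_beta`. -/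
theorem abs_altSeq_le (n : ℕ) : |altSeq n| ≤ trib n := by
  induction n using altSeq.induct with
  | case1 => simp [altSeq, trib]
  | case2 => simp [altSeq, trib]
  | case3 => simp [altSeq, trib]
  | case4 => simp [altSeq, trib]
  | case5 n ih =>
    have := trib_nonneg (n + 1)
    have := trib_nonneg (n + 2)
    have h1 := trib_rec n
    have h2 : trib (n + 4) = trib (n + 1) + trib (n + 2) + trib (n + 3) := trib_rec (n + 1)
    change |altSeq n| ≤ trib (n + 4)
    linarith

/-- By the bipartition, even times see β_1, γ_1, β_3, γ_3 and odd times see α_n, β_2, γ_2. The sum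
over the legs follows the Tribonacci recursion, and the difference, which does not interact with the
path, follows the periodic `altSeq`. -/
theorem wave_beta {W : ℕ → Vtx k → ℚ} (h : BranchWave k W) (h0 : W 0 = e b1)
    (h1 : W 1 = e (al (4 * k + 3))) (i : ℕ) (hi : 2 * i ≤ 4 * k + 4) :
    (W (2 * i) (al (4 * k + 3)) = 0 ∧
    W (2 * i) b1 = (trib (i + 3) - altSeq (i + 3)) / 2 ∧
    W (2 * i) c1 = (trib (i + 3) + altSeq (i + 3)) / 2 ∧
    W (2 * i) b2 = 0 ∧ W (2 * i) c2 = 0 ∧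
    W (2 * i) b3 = (trib (i + 1) + altSeq (i + 1)) / 2 ∧
    W (2 * i) c3 = (trib (i + 1) - altSeq (i + 1)) / 2) ∧
    (W (2 * i + 1) (al (4 * k + 3)) = trib (i + 3) ∧
    W (2 * i + 1) b1 = 0 ∧ W (2 * i + 1) c1 = 0 ∧
    W (2 * i + 1) b2 = (trib (i + 1) + trib (i + 2) + altSeq (i + 1) + altSeq (i + 2)) / 2 ∧
    W (2 * i + 1) c2 = (trib (i + 1) + trib (i + 2) - altSeq (i + 1) - altSeq (i + 2)) / 2 ∧
    W (2 * i + 1) b3 = 0 ∧ W (2 * i + 1) c3 = 0) := by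
  induction i with
  | zero => simp [reduceCtorEq, h0, h1, trib, altSeq, al]
  | succ i ih =>
    obtain ⟨⟨a0, a1, a2, a3, a4, a5, a6⟩, ⟨d0, d1, d2, d3, d4, d5, d6⟩⟩ := ih (by omega)
    have t1 := trib_rec (i + 1)
    have t2 := altSeq_rec (i + 1)
    have A1 : W (2 * i + 2) (al (4 * k + 3)) = 0 := by rw [h.al _ (by omega)]; linarith
    have A2 := h.b1 (2 * i)
    have A3 := h.c1 (2 * i)
    have A4 := h.b2 (2 * i)
    have A5 := h.c2 (2 * i)
    have A6 := h.b3 (2 * i)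
    have A7 := h.c3 (2 * i)
    have B1 := h.al (2 * i + 1) (by omega)
    have B2 := h.b1 (2 * i + 1)
    have B3 := h.c1 (2 * i + 1)
    have B4 := h.b2 (2 * i + 1)
    have B5 := h.c2 (2 * i + 1)
    have B6 := h.b3 (2 * i + 1)
    have B7 := h.c3 (2 * i + 1)
    simp only [show 2 * (i + 1) = 2 * i + 2 by ring, show 2 * i + 1 + 2 = 2 * i + 3 by ring,
      show 2 * i + 1 + 1 = 2 * i + 2 by ring,
      show i + 1 + 1 = i + 2 by ring, show i + 1 + 2 = i + 3 by ring, show i + 1 + 3 = i + 4 by ring] at *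
    refine ⟨⟨?_, ?_, ?_, ?_, ?_, ?_, ?_⟩, ⟨?_, ?_, ?_, ?_, ?_, ?_, ?_⟩⟩ <;> linarith

/-- The start is symmetric in the legs, so `altSeq` does not occur. The closed form fails at times 0
and 1, hence the shift by two. -/
theorem wave_alpha {W : ℕ → Vtx k → ℚ} (h : BranchWave k W) (h0 : W 0 = e b1 + e c1)
    (h1 : W 1 = e (al (4 * k + 3)) + e b2 + e c2) (i : ℕ) (hi : 2 * i + 2 ≤ 4 * k + 4) :
    (W (2 * i + 2) (al (4 * k + 3)) = 0 ∧
    W (2 * i + 2) b1 = trib (i + 2) + trib (i + 3) ∧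
    W (2 * i + 2) c1 = trib (i + 2) + trib (i + 3) ∧
    W (2 * i + 2) b2 = 0 ∧ W (2 * i + 2) c2 = 0 ∧
    W (2 * i + 2) b3 = trib i + trib (i + 1) ∧ W (2 * i + 2) c3 = trib i + trib (i + 1)) ∧
    (W (2 * i + 3) (al (4 * k + 3)) = 2 * (trib (i + 2) + trib (i + 3)) ∧
    W (2 * i + 3) b1 = 0 ∧ W (2 * i + 3) c1 = 0 ∧
    W (2 * i + 3) b2 = trib (i + 1) + trib (i + 3) ∧
    W (2 * i + 3) c2 = trib (i + 1) + trib (i + 3) ∧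
    W (2 * i + 3) b3 = 0 ∧ W (2 * i + 3) c3 = 0) := by
  have key : ∀ i, 2 * i ≤ 4 * k + 4 → _ := fun i hi => (⟨h.al (2 * i) hi, h.b1 (2 * i),
    h.c1 (2 * i), h.b2 (2 * i), h.c2 (2 * i), h.b3 (2 * i), h.c3 (2 * i)⟩ : _ ∧ _ ∧ _ ∧ _ ∧ _ ∧ _ ∧ _)
  have key' : ∀ i, 2 * i + 1 ≤ 4 * k + 4 → _ := fun i hi => (⟨h.al (2 * i + 1) hi, h.b1 (2 * i + 1),
    h.c1 (2 * i + 1), h.b2 (2 * i + 1), h.c2 (2 * i + 1), h.b3 (2 * i + 1), h.c3 (2 * i + 1)⟩ :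
      _ ∧ _ ∧ _ ∧ _ ∧ _ ∧ _ ∧ _)
  induction i with
  | zero =>
    obtain ⟨A1, A2, A3, A4, A5, A6, A7⟩ := key 0 (by omega)
    obtain ⟨B1, B2, B3, B4, B5, B6, B7⟩ := key' 0 (by omega)
    simp [reduceCtorEq, h0, h1, al] at A1 A2 A3 A4 A5 A6 A7
    simp [reduceCtorEq, h1, al] at B1 B2 B3 B4 B5 B6 B7
    simp [trib, al] at *
    refine ⟨⟨?_, ?_, ?_, ?_, ?_, ?_, ?_⟩, ⟨?_, ?_, ?_, ?_, ?_, ?_, ?_⟩⟩ <;> linarith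
  | succ i ih =>
    obtain ⟨⟨a0, a1, a2, a3, a4, a5, a6⟩, ⟨d0, d1, d2, d3, d4, d5, d6⟩⟩ := ih (by omega)
    have t0 := trib_rec i
    have t1 := trib_rec (i + 1)
    obtain ⟨A1, A2, A3, A4, A5, A6, A7⟩ := key (i + 1) (by omega)
    obtain ⟨B1, B2, B3, B4, B5, B6, B7⟩ := key' (i + 1) (by omega)
    simp only [
      show 2 * (i + 1) = 2 * i + 2 by ring, show 2 * i + 2 + 1 = 2 * i + 3 by ring,
      show i + 1 + 1 = i + 2 by ring, show i + 1 + 2 = i + 3 by ring, show i + 1 + 3 = i + 4 by ring] at *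
    refine ⟨⟨?_, ?_, ?_, ?_, ?_, ?_, ?_⟩, ⟨?_, ?_, ?_, ?_, ?_, ?_, ?_⟩⟩ <;> linarith

theorem wave_alpha' {W : ℕ → Vtx k → ℚ} (h : BranchWave' k W) (h0 : W 0 = e vf + e vg)
    (h1 : W 1 = e (al' (4 * k + 3)) + e bb + e cb) (i : ℕ) (hi : 2 * i + 2 ≤ 4 * k + 4) :
    (W (2 * i + 2) (al' (4 * k + 3)) = 0 ∧
    W (2 * i + 2) vf = 2 * trib (i + 2) ∧ W (2 * i + 2) vg = 2 * trib (i + 3) ∧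
    W (2 * i + 2) bb = 0 ∧ W (2 * i + 2) cb = 0) ∧
    (W (2 * i + 3) (al' (4 * k + 3)) = 2 * (trib (i + 2) + trib (i + 3)) ∧
    W (2 * i + 3) vf = 0 ∧ W (2 * i + 3) vg = 0 ∧
    W (2 * i + 3) bb = trib (i + 1) + trib (i + 3) ∧
    W (2 * i + 3) cb = trib (i + 1) + trib (i + 3)) := by
  have key : ∀ i, 2 * i ≤ 4 * k + 4 → _ := fun i hi => (⟨h.al (2 * i) hi, h.vf (2 * i),
    h.vg (2 * i), h.bb (2 * i), h.cb (2 * i)⟩ : _ ∧ _ ∧ _ ∧ _ ∧ _)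
  have key' : ∀ i, 2 * i + 1 ≤ 4 * k + 4 → _ := fun i hi => (⟨h.al (2 * i + 1) hi, h.vf (2 * i + 1),
    h.vg (2 * i + 1), h.bb (2 * i + 1), h.cb (2 * i + 1)⟩ : _ ∧ _ ∧ _ ∧ _ ∧ _)
  induction i with
  | zero =>
    obtain ⟨A1, A2, A3, A4, A5⟩ := key 0 (by omega)
    obtain ⟨B1, B2, B3, B4, B5⟩ := key' 0 (by omega)
    simp [reduceCtorEq, h0, h1, al'] at A1 A2 A3 A4 A5
    simp [reduceCtorEq, h1, al'] at B1 B2 B3 B4 B5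
    simp [trib, al'] at *
    refine ⟨⟨?_, ?_, ?_, ?_, ?_⟩, ⟨?_, ?_, ?_, ?_, ?_⟩⟩ <;> linarith
  | succ i ih =>
    obtain ⟨⟨a0, a1, a2, a3, a4⟩, ⟨d0, d1, d2, d3, d4⟩⟩ := ih (by omega)
    have t0 := trib_rec i
    have t1 := trib_rec (i + 1)
    obtain ⟨A1, A2, A3, A4, A5⟩ := key (i + 1) (by omega)
    obtain ⟨B1, B2, B3, B4, B5⟩ := key' (i + 1) (by omega)
    simp only [
      show 2 * (i + 1) = 2 * i + 2 by ring, show 2 * i + 2 + 1 = 2 * i + 3 by ring,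
      show i + 1 + 1 = i + 2 by ring, show i + 1 + 2 = i + 3 by ring, show i + 1 + 3 = i + 4 by ring] at *
    refine ⟨⟨?_, ?_, ?_, ?_, ?_⟩, ⟨?_, ?_, ?_, ?_, ?_⟩⟩ <;> linarith

theorem wave_f {W : ℕ → Vtx k → ℚ} (h : BranchWave' k W) (h0 : W 0 = e vf)
    (h1 : W 1 = e (al' (4 * k + 3))) (i : ℕ) (hi : 2 * i ≤ 4 * k + 4) :
    (W (2 * i) (al' (4 * k + 3)) = 0 ∧
    W (2 * i) vf = trib i + trib (i + 1) ∧ W (2 * i) vg = trib (i + 1) + trib (i + 2) ∧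
    W (2 * i) bb = 0 ∧ W (2 * i) cb = 0) ∧
    (W (2 * i + 1) (al' (4 * k + 3)) = trib i + 2 * trib (i + 1) + trib (i + 2) ∧
    W (2 * i + 1) vf = 0 ∧ W (2 * i + 1) vg = 0 ∧
    W (2 * i + 1) bb = trib (i + 2) ∧ W (2 * i + 1) cb = trib (i + 2)) := by
  induction i with
  | zero => simp [reduceCtorEq, h0, h1, trib, al']
  | succ i ih =>
    obtain ⟨⟨a0, a1, a2, a3, a4⟩, ⟨d0, d1, d2, d3, d4⟩⟩ := ih (by omega)
    have t1 := trib_rec i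
    have A1 := h.al (2 * i) (by omega)
    have A2 := h.vf (2 * i)
    have A3 := h.vg (2 * i)
    have A4 := h.bb (2 * i)
    have A5 := h.cb (2 * i)
    have B1 := h.al (2 * i + 1) (by omega)
    have B2 := h.vf (2 * i + 1)
    have B3 := h.vg (2 * i + 1)
    have B4 := h.bb (2 * i + 1)
    have B5 := h.cb (2 * i + 1)
    simp only [show 2 * (i + 1) = 2 * i + 2 by ring, show 2 * i + 1 + 2 = 2 * i + 3 by ring,
      show 2 * i + 1 + 1 = 2 * i + 2 by ring,
      show i + 1 + 1 = i + 2 by ring, show i + 1 + 2 = i + 3 by ring] at *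
    refine ⟨⟨?_, ?_, ?_, ?_, ?_⟩, ⟨?_, ?_, ?_, ?_, ?_⟩⟩ <;> linarith

/-- The difference β̄_2 - γ̄_2 lies in the kernel of A, so it only changes sign every second step;
this is the term (-1)^i. -/
theorem wave_betaBar {W : ℕ → Vtx k → ℚ} (h : BranchWave' k W) (h0 : W 0 = e bb)
    (h1 : W 1 = e vg) (i : ℕ) (hi : 2 * i ≤ 4 * k + 4) :
    (W (2 * i) (al' (4 * k + 3)) = trib (i + 1) + trib (i + 2) ∧
    W (2 * i) vf = 0 ∧ W (2 * i) vg = 0 ∧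
    W (2 * i) bb = (trib i + trib (i + 2) + (-1) ^ i) / 2 ∧
    W (2 * i) cb = (trib i + trib (i + 2) - (-1) ^ i) / 2) ∧
    (W (2 * i + 1) (al' (4 * k + 3)) = 0 ∧
    W (2 * i + 1) vf = trib (i + 2) ∧ W (2 * i + 1) vg = trib (i + 3) ∧
    W (2 * i + 1) bb = 0 ∧ W (2 * i + 1) cb = 0) := by
  induction i with
  | zero => simp [reduceCtorEq, h0, h1, trib, al']
  | succ i ih =>
    obtain ⟨⟨a0, a1, a2, a3, a4⟩, ⟨d0, d1, d2, d3, d4⟩⟩ := ih (by omega)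
    have t0 := trib_rec i
    have t1 := trib_rec (i + 1)
    have A1 := h.al (2 * i) (by omega)
    have A2 := h.vf (2 * i)
    have A3 := h.vg (2 * i)
    have A4 := h.bb (2 * i)
    have A5 := h.cb (2 * i)
    have B1 := h.al (2 * i + 1) (by omega)
    have B2 := h.vf (2 * i + 1)
    have B3 := h.vg (2 * i + 1)
    have B4 := h.bb (2 * i + 1)
    have B5 := h.cb (2 * i + 1)
    simp only [show 2 * (i + 1) = 2 * i + 2 by ring, show 2 * i + 1 + 2 = 2 * i + 3 by ring,
      show 2 * i + 1 + 1 = 2 * i + 2 by ring,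
      show i + 1 + 1 = i + 2 by ring, show i + 1 + 2 = i + 3 by ring, show i + 1 + 3 = i + 4 by ring,
      pow_succ] at *
    refine ⟨⟨?_, ?_, ?_, ?_, ?_⟩, ⟨?_, ?_, ?_, ?_, ?_⟩⟩ <;> linarith

/-! ### Chebyshev polynomials of degree at most n have natural entries. -/

/-- A vector of natural numbers. -/
def NatV (u : Vtx k → ℚ) : Prop := ∀ x, ∃ n : ℕ, u x = n

theorem NatV.add {u v : Vtx k → ℚ} (hu : NatV u) (hv : NatV v) : NatV (u + v) := fun x => by
  obtain ⟨n, hn⟩ := hu x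
  obtain ⟨m, hm⟩ := hv x
  exact ⟨n + m, by simp [hn, hm]⟩

theorem natV_zero : NatV (0 : Vtx k → ℚ) := fun _ => ⟨0, by simp⟩

theorem single_apply_nonneg (y x : Vtx k) : 0 ≤ e y x := by
  by_cases h : x = y
  · subst h; simp
  · simp [h]

theorem single_apply_ne {x y : Vtx k} (h : x ≠ y) : e y x = 0 := by simp [h]

theorem NatV.comp {u : Vtx k → ℚ} (hu : NatV u) (s : Vtx k → Vtx k) : NatV (u ∘ s) :=
  fun x => hu (s x)

/-- Integrality is automatic because A has integer entries, so only nonnegativity is at stake. -/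
theorem cheb_mem_range (m : ℕ) : cheb k m ∈ (Int.castRingHom ℚ).mapMatrix.range := by
  have hA : adjM k ∈ (Int.castRingHom ℚ).mapMatrix.range := by
    classical
    refine ⟨Matrix.of fun x y => if Adj x y then 1 else 0, ?_⟩
    ext x y
    simp only [RingHom.mapMatrix_apply, Matrix.map_apply, adjM, Matrix.of_apply]
    split_ifs <;> simp
  induction m using cheb_induction with
  | h0 => exact one_mem _
  | h1 => exact hA
  | h m h h' => exact sub_mem (mul_mem hA h') h

theorem natV_cheb_single {m : ℕ} {y : Vtx k} (h : ∀ x, 0 ≤ (cheb k m *ᵥ e y) x) :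
    NatV (cheb k m *ᵥ e y) := by
  intro x
  obtain ⟨B, hB⟩ := cheb_mem_range (k := k) m
  have hx : (cheb k m *ᵥ e y) x = (B x y : ℚ) := by
    rw [e, mulVec_single_one, ← hB]; rfl
  have h0 := h x
  rw [hx] at h0 ⊢
  obtain ⟨n, hn⟩ := Int.eq_ofNat_of_zero_le (Int.cast_nonneg_iff.1 h0)
  exact ⟨n, by rw [hn]; simp⟩

theorem projLeft_apply (v : Vtx k → ℚ) (x : Vtx k) :
    (projLeft k *ᵥ v) x = if lt x = .N then v x else 0 := by
  rw [projLeft_mulVec, Function.comp_apply, projN_mulVec, rt_conj]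
  simp only [Function.comp_apply, conj_conj]

/-- No edge joins the two graphs. -/
theorem cheb_apply_of_lt_ne (m : ℕ) {x y : Vtx k} (h : lt x ≠ lt y) :
    (cheb k m *ᵥ e y) x = 0 := by
  have hc := (commute_cheb (commute_adjM_projLeft (k := k)).symm m).eq
  have hv := congrFun (congrArg (· *ᵥ e y) hc) x
  simp only [← mulVec_mulVec] at hv
  have hy : projLeft k *ᵥ e y = if lt y = .N then e y else 0 := by
    ext z
    rw [projLeft_apply]
    by_cases hz : z = y
    · subst hz; split_ifs <;> simp
    · split_ifs <;> simp [hz]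
  rw [projLeft_apply, hy] at hv
  cases hx : lt x <;> cases hy' : lt y <;> simp_all

/-- The offset `r` is the time at which observation of the wave begins; it is chosen so that the
path is still empty then. -/
theorem wave_cheb (r : ℕ) (v : Vtx k → ℚ) (m : ℕ) :
    cheb k (r + (m + 2)) *ᵥ v = adjM k *ᵥ (cheb k (r + (m + 1)) *ᵥ v) - cheb k (r + m) *ᵥ v :=
  cheb_succ_succ (r + m) v

theorem cheb_one_mulVec (v : Vtx k → ℚ) : cheb k 1 *ᵥ v = adjM k *ᵥ v := rfl

theorem cheb_zero_mulVec (v : Vtx k → ℚ) : cheb k 0 *ᵥ v = v := one_mulVec v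

theorem cheb_two_b3 : cheb k 2 *ᵥ e b3 = e b1 := by
  rw [cheb_succ_succ, cheb_one_mulVec, cheb_zero_mulVec, adjM_b3, adjM_b2, add_sub_cancel_right]

theorem cheb_three_b3 : cheb k 3 *ᵥ e b3 = e (al (4 * k + 3)) := by
  rw [cheb_succ_succ, cheb_two_b3, cheb_one_mulVec, adjM_b3, adjM_b1, add_sub_cancel_right]

/-- Starting at β_3, two steps bring the wave to β_1 and a third to α_n, hence the offset 2. -/
theorem branchWave_b3 : BranchWave k (fun m => cheb k (2 + m) *ᵥ e b3) :=
  branchWave (wave_cheb 2 _) (fun j hj => by simp only [add_zero]; rw [cheb_two_b3]; simp [al])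
    (fun j hj => by
      have := (al_inj (k := k) (i := j) (j := 4 * k + 3) (by omega) (by omega)).not.2 (by omega)
      simp only [show 2 + 1 = 3 from rfl, cheb_three_b3]
      rw [single_apply_ne this])

theorem cheb_b3_nonneg {l : ℕ} (hl : l ≤ 4 * k + 7) (x : Vtx k) : 0 ≤ (cheb k l *ᵥ e b3) x := by
  rcases l with _ | _ | m
  · rw [cheb_zero_mulVec]; exact single_apply_nonneg _ _
  · rw [zero_add, cheb_one_mulVec, adjM_b3]; exact single_apply_nonneg _ _
  rw [show m + 1 + 1 = 2 + m by ring]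
  have key : ∀ m ≤ 4 * k + 5, 0 ≤ (cheb k (2 + m) *ᵥ e b3) (al (4 * k + 3)) ∧
      0 ≤ (cheb k (2 + m) *ᵥ e b3) b1 ∧ 0 ≤ (cheb k (2 + m) *ᵥ e b3) b2 ∧
      0 ≤ (cheb k (2 + m) *ᵥ e b3) b3 ∧ 0 ≤ (cheb k (2 + m) *ᵥ e b3) c1 ∧
      0 ≤ (cheb k (2 + m) *ᵥ e b3) c2 ∧ 0 ≤ (cheb k (2 + m) *ᵥ e b3) c3 := by
    intro m hm
    rcases Nat.even_or_odd' m with ⟨i, rfl | rfl⟩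
    · obtain ⟨⟨a0, a1, a2, a3, a4, a5, a6⟩, -⟩ := wave_beta (branchWave_b3 (k := k)) cheb_two_b3 cheb_three_b3 i (by omega)
      have h1 := abs_le.1 (abs_altSeq_le (i + 1))
      have h3 := abs_le.1 (abs_altSeq_le (i + 3))
      rw [a0, a1, a2, a3, a4, a5, a6]
      refine ⟨?_, ?_, ?_, ?_, ?_, ?_, ?_⟩ <;> linarith
    · obtain ⟨-, ⟨a0, a1, a2, a3, a4, a5, a6⟩⟩ := wave_beta (branchWave_b3 (k := k)) cheb_two_b3 cheb_three_b3 i (by omega)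
      have h1 := abs_le.1 (abs_altSeq_le (i + 1))
      have h3 := abs_le.1 (abs_altSeq_le (i + 2))
      have h4 := trib_nonneg (i + 3)
      rw [a0, a1, a2, a3, a4, a5, a6]
      refine ⟨?_, ?_, ?_, ?_, ?_, ?_, ?_⟩ <;> linarith
  obtain ⟨k0, k1, k2, k3, k4, k5, k6⟩ := key m (by omega)
  induction x using cases_vtx with
  | hal j hj =>
    exact branchWave_b3.nonneg m (by omega) (fun i hi => (key i (by omega)).1) j hj
  | hb1 => exact k1
  | hb2 => exact k2
  | hb3 => exact k3
  | hc1 => exact k4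
  | hc2 => exact k5
  | hc3 => exact k6
  | _ => rw [cheb_apply_of_lt_ne _ (by simp [lt, al'])]

theorem cheb_al_zero_next : cheb k (4 * k + 4) *ᵥ e (al 0) = e b1 + e c1 := by
  rw [cheb_succ_succ, cheb_al (by omega), cheb_al (by omega), adjM_al_last]; abel

theorem cheb_al_zero_next' : cheb k (4 * k + 5) *ᵥ e (al 0) = e (al (4 * k + 3)) + e b2 + e c2 := by
  rw [cheb_succ_succ, cheb_al_zero_next, cheb_al (by omega), mulVec_add, adjM_b1, adjM_c1]; abel

/-- A wave from α_0 has crossed the whole path after n + 1 = 4k + 4 steps and sits at β_1 + γ_1. -/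
theorem branchWave_al_zero : BranchWave k (fun m => cheb k (4 * k + 4 + m) *ᵥ e (al 0)) :=
  branchWave (wave_cheb _ _) (fun j hj => by simp only [add_zero]; rw [cheb_al_zero_next]; simp [al])
    (fun j hj => by
      have := (al_inj (k := k) (i := j) (j := 4 * k + 3) (by omega) (by omega)).not.2 (by omega)
      simp only [show 4 * k + 4 + 1 = 4 * k + 5 from rfl, cheb_al_zero_next', Pi.add_apply]
      rw [single_apply_ne this]
      simp [al])

theorem cheb_al_zero_nonneg {l : ℕ} (hl : l ≤ 8 * k + 7) (x : Vtx k) :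
    0 ≤ (cheb k l *ᵥ e (al 0)) x := by
  by_cases hl' : l < 4 * k + 4
  · rw [cheb_al hl']; exact single_apply_nonneg _ _
  obtain ⟨m, rfl⟩ := Nat.exists_eq_add_of_le (not_lt.1 hl')
  have key : ∀ m ≤ 4 * k + 5, 0 ≤ (cheb k (4 * k + 4 + m) *ᵥ e (al 0)) (al (4 * k + 3)) ∧
      0 ≤ (cheb k (4 * k + 4 + m) *ᵥ e (al 0)) b1 ∧ 0 ≤ (cheb k (4 * k + 4 + m) *ᵥ e (al 0)) b2 ∧
      0 ≤ (cheb k (4 * k + 4 + m) *ᵥ e (al 0)) b3 ∧ 0 ≤ (cheb k (4 * k + 4 + m) *ᵥ e (al 0)) c1 ∧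
      0 ≤ (cheb k (4 * k + 4 + m) *ᵥ e (al 0)) c2 ∧
      0 ≤ (cheb k (4 * k + 4 + m) *ᵥ e (al 0)) c3 := by
    intro m hm
    by_cases h2 : 2 ≤ m
    · obtain ⟨l, rfl⟩ := Nat.exists_eq_add_of_le' h2
      rcases Nat.even_or_odd' l with ⟨i, rfl | rfl⟩
      · obtain ⟨⟨a0, a1, a2, a3, a4, a5, a6⟩, -⟩ := wave_alpha (branchWave_al_zero (k := k))
          cheb_al_zero_next cheb_al_zero_next' i (by omega)
        have h0 := trib_nonneg i
        have h1 := trib_nonneg (i + 1)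
        have h2 := trib_nonneg (i + 2)
        have h3 := trib_nonneg (i + 3)
        rw [a0, a1, a2, a3, a4, a5, a6]
        refine ⟨?_, ?_, ?_, ?_, ?_, ?_, ?_⟩ <;> linarith
      · obtain ⟨-, ⟨a0, a1, a2, a3, a4, a5, a6⟩⟩ := wave_alpha (branchWave_al_zero (k := k))
          cheb_al_zero_next cheb_al_zero_next' i (by omega)
        have h1 := trib_nonneg (i + 1)
        have h2 := trib_nonneg (i + 2)
        have h3 := trib_nonneg (i + 3)
        rw [show 2 * i + 1 + 2 = 2 * i + 3 by ring, a0, a1, a2, a3, a4, a5, a6]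
        refine ⟨?_, ?_, ?_, ?_, ?_, ?_, ?_⟩ <;> linarith
    · have h3 : m = 0 ∨ m = 1 := by omega
      rcases h3 with rfl | rfl
      · simp only [add_zero, cheb_al_zero_next, Pi.add_apply]
        refine ⟨?_, ?_, ?_, ?_, ?_, ?_, ?_⟩ <;> exact add_nonneg (single_apply_nonneg _ _) (single_apply_nonneg _ _)
      · simp only [show 4 * k + 4 + 1 = 4 * k + 5 from rfl, cheb_al_zero_next', Pi.add_apply]
        refine ⟨?_, ?_, ?_, ?_, ?_, ?_, ?_⟩ <;>
          exact add_nonneg (add_nonneg (single_apply_nonneg _ _) (single_apply_nonneg _ _)) (single_apply_nonneg _ _)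
  obtain ⟨k0, k1, k2, k3, k4, k5, k6⟩ := key m (by omega)
  induction x using cases_vtx with
  | hal j hj =>
    exact branchWave_al_zero.nonneg m (by omega) (fun i hi => (key i (by omega)).1) j hj
  | hb1 => exact k1
  | hb2 => exact k2
  | hb3 => exact k3
  | hc1 => exact k4
  | hc2 => exact k5
  | hc3 => exact k6
  | _ => rw [cheb_apply_of_lt_ne _ (by simp [lt, al', al])]

theorem cheb_al'_zero_next : cheb k (4 * k + 4) *ᵥ e (al' 0) = e vf + e vg := by
  rw [cheb_succ_succ, cheb_al' (by omega), cheb_al' (by omega), adjM_al'_last]; abel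

theorem cheb_al'_zero_next' :
    cheb k (4 * k + 5) *ᵥ e (al' 0) = e (al' (4 * k + 3)) + e bb + e cb := by
  rw [cheb_succ_succ, cheb_al'_zero_next, cheb_al' (by omega), mulVec_add, adjM_vf, adjM_vg]; abel

theorem branchWave'_al'_zero : BranchWave' k (fun m => cheb k (4 * k + 4 + m) *ᵥ e (al' 0)) :=
  branchWave' (wave_cheb _ _) (fun j hj => by simp only [add_zero]; rw [cheb_al'_zero_next]; simp [al'])
    (fun j hj => by
      have := (al'_inj (k := k) (i := j) (j := 4 * k + 3) (by omega) (by omega)).not.2 (by omega)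
      simp only [show 4 * k + 4 + 1 = 4 * k + 5 from rfl, cheb_al'_zero_next', Pi.add_apply]
      rw [single_apply_ne this]
      simp [al'])

theorem cheb_al'_zero_nonneg {l : ℕ} (hl : l ≤ 8 * k + 7) (x : Vtx k) :
    0 ≤ (cheb k l *ᵥ e (al' 0)) x := by
  by_cases hl' : l < 4 * k + 4
  · rw [cheb_al' hl']; exact single_apply_nonneg _ _
  obtain ⟨m, rfl⟩ := Nat.exists_eq_add_of_le (not_lt.1 hl')
  have key : ∀ m ≤ 4 * k + 5, 0 ≤ (cheb k (4 * k + 4 + m) *ᵥ e (al' 0)) (al' (4 * k + 3)) ∧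
      0 ≤ (cheb k (4 * k + 4 + m) *ᵥ e (al' 0)) vf ∧ 0 ≤ (cheb k (4 * k + 4 + m) *ᵥ e (al' 0)) vg ∧
      0 ≤ (cheb k (4 * k + 4 + m) *ᵥ e (al' 0)) bb ∧
      0 ≤ (cheb k (4 * k + 4 + m) *ᵥ e (al' 0)) cb := by
    intro m hm
    by_cases h2 : 2 ≤ m
    · obtain ⟨l, rfl⟩ := Nat.exists_eq_add_of_le' h2
      rcases Nat.even_or_odd' l with ⟨i, rfl | rfl⟩
      · obtain ⟨⟨a0, a1, a2, a3, a4⟩, -⟩ := wave_alpha' (branchWave'_al'_zero (k := k))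
          cheb_al'_zero_next cheb_al'_zero_next' i (by omega)
        have h2 := trib_nonneg (i + 2)
        have h3 := trib_nonneg (i + 3)
        rw [a0, a1, a2, a3, a4]
        refine ⟨?_, ?_, ?_, ?_, ?_⟩ <;> linarith
      · obtain ⟨-, ⟨a0, a1, a2, a3, a4⟩⟩ := wave_alpha' (branchWave'_al'_zero (k := k))
          cheb_al'_zero_next cheb_al'_zero_next' i (by omega)
        have h1 := trib_nonneg (i + 1)
        have h2 := trib_nonneg (i + 2)
        have h3 := trib_nonneg (i + 3)
        rw [show 2 * i + 1 + 2 = 2 * i + 3 by ring, a0, a1, a2, a3, a4]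
        refine ⟨?_, ?_, ?_, ?_, ?_⟩ <;> linarith
    · have h3 : m = 0 ∨ m = 1 := by omega
      rcases h3 with rfl | rfl
      · simp only [add_zero, cheb_al'_zero_next, Pi.add_apply]
        refine ⟨?_, ?_, ?_, ?_, ?_⟩ <;> exact add_nonneg (single_apply_nonneg _ _) (single_apply_nonneg _ _)
      · simp only [show 4 * k + 4 + 1 = 4 * k + 5 from rfl, cheb_al'_zero_next', Pi.add_apply]
        refine ⟨?_, ?_, ?_, ?_, ?_⟩ <;>
          exact add_nonneg (add_nonneg (single_apply_nonneg _ _) (single_apply_nonneg _ _)) (single_apply_nonneg _ _)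
  obtain ⟨k0, k1, k2, k3, k4⟩ := key m (by omega)
  induction x using cases_vtx with
  | hal' j hj =>
    exact branchWave'_al'_zero.nonneg m (by omega) (fun i hi => (key i (by omega)).1) j hj
  | hf => exact k1
  | hg => exact k2
  | hbb => exact k3
  | hcb => exact k4
  | _ => rw [cheb_apply_of_lt_ne _ (by simp [lt, al', al])]

theorem branchWave'_vf : BranchWave' k (fun m => cheb k (0 + m) *ᵥ e vf) :=
  branchWave' (wave_cheb _ _)
    (fun j hj => by simp only [add_zero]; rw [cheb_zero_mulVec]; simp [al'])
    (fun j hj => by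
      have := (al'_inj (k := k) (i := j) (j := 4 * k + 3) (by omega) (by omega)).not.2 (by omega)
      simp only [show 0 + 1 = 1 from rfl, cheb_one_mulVec, adjM_vf]
      rw [single_apply_ne this])

theorem cheb_vf_nonneg {l : ℕ} (hl : l ≤ 4 * k + 5) (x : Vtx k) : 0 ≤ (cheb k l *ᵥ e vf) x := by
  rw [← zero_add l]
  have key : ∀ m ≤ 4 * k + 5, 0 ≤ (cheb k (0 + m) *ᵥ e vf) (al' (4 * k + 3)) ∧
      0 ≤ (cheb k (0 + m) *ᵥ e vf) vf ∧ 0 ≤ (cheb k (0 + m) *ᵥ e vf) vg ∧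
      0 ≤ (cheb k (0 + m) *ᵥ e vf) bb ∧ 0 ≤ (cheb k (0 + m) *ᵥ e vf) cb := by
    intro m hm
    rcases Nat.even_or_odd' m with ⟨i, rfl | rfl⟩
    · obtain ⟨⟨a0, a1, a2, a3, a4⟩, -⟩ := wave_f (branchWave'_vf (k := k)) (cheb_zero_mulVec _) adjM_vf i (by omega)
      have h0 := trib_nonneg i
      have h1 := trib_nonneg (i + 1)
      have h2 := trib_nonneg (i + 2)
      rw [a0, a1, a2, a3, a4]
      refine ⟨?_, ?_, ?_, ?_, ?_⟩ <;> linarith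
    · obtain ⟨-, ⟨a0, a1, a2, a3, a4⟩⟩ := wave_f (branchWave'_vf (k := k)) (cheb_zero_mulVec _) adjM_vf i (by omega)
      have h0 := trib_nonneg i
      have h1 := trib_nonneg (i + 1)
      have h2 := trib_nonneg (i + 2)
      rw [a0, a1, a2, a3, a4]
      refine ⟨?_, ?_, ?_, ?_, ?_⟩ <;> linarith
  obtain ⟨k0, k1, k2, k3, k4⟩ := key l (by omega)
  induction x using cases_vtx with
  | hal' j hj =>
    exact branchWave'_vf.nonneg l (by omega) (fun i hi => (key i (by omega)).1) j hj
  | hf => exact k1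
  | hg => exact k2
  | hbb => exact k3
  | hcb => exact k4
  | _ => rw [cheb_apply_of_lt_ne _ (by simp [lt, al])]

theorem branchWave'_bb : BranchWave' k (fun m => cheb k (0 + m) *ᵥ e bb) :=
  branchWave' (wave_cheb _ _)
    (fun j hj => by simp only [add_zero]; rw [cheb_zero_mulVec]; simp [al'])
    (fun j hj => by
      simp only [show 0 + 1 = 1 from rfl, cheb_one_mulVec, adjM_bb]
      simp [al'])

theorem cheb_bb_nonneg {l : ℕ} (hl : l ≤ 4 * k + 5) (x : Vtx k) : 0 ≤ (cheb k l *ᵥ e bb) x := by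
  rw [← zero_add l]
  have key : ∀ m ≤ 4 * k + 5, 0 ≤ (cheb k (0 + m) *ᵥ e bb) (al' (4 * k + 3)) ∧
      0 ≤ (cheb k (0 + m) *ᵥ e bb) vf ∧ 0 ≤ (cheb k (0 + m) *ᵥ e bb) vg ∧
      0 ≤ (cheb k (0 + m) *ᵥ e bb) bb ∧ 0 ≤ (cheb k (0 + m) *ᵥ e bb) cb := by
    intro m hm
    rcases Nat.even_or_odd' m with ⟨i, rfl | rfl⟩
    · obtain ⟨⟨a0, a1, a2, a3, a4⟩, -⟩ := wave_betaBar (branchWave'_bb (k := k)) (cheb_zero_mulVec _) adjM_bb i (by omega)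
      have h1 := trib_nonneg (i + 1)
      have h2 := trib_nonneg (i + 2)
      have h3 := one_le_trib_add i
      rw [a0, a1, a2, a3, a4]
      rcases neg_one_pow_eq_or ℚ i with h | h <;> rw [h] <;>
      refine ⟨?_, ?_, ?_, ?_, ?_⟩ <;> linarith
    · obtain ⟨-, ⟨a0, a1, a2, a3, a4⟩⟩ := wave_betaBar (branchWave'_bb (k := k)) (cheb_zero_mulVec _) adjM_bb i (by omega)
      have h2 := trib_nonneg (i + 2)
      have h3 := trib_nonneg (i + 3)
      rw [a0, a1, a2, a3, a4]
      refine ⟨?_, ?_, ?_, ?_, ?_⟩ <;> linarith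
  obtain ⟨k0, k1, k2, k3, k4⟩ := key l (by omega)
  induction x using cases_vtx with
  | hal' j hj =>
    exact branchWave'_bb.nonneg l (by omega) (fun i hi => (key i (by omega)).1) j hj
  | hf => exact k1
  | hg => exact k2
  | hbb => exact k3
  | hcb => exact k4
  | _ => rw [cheb_apply_of_lt_ne _ (by simp [lt, al])]

/-- The linearization `cheb_mul_sub` expands the product into a sum of U_l with l ≤ p + q. Hence
only the orbits of a few starting vertices need to be examined. -/
theorem NatV.cheb_cheb {v : Vtx k → ℚ} {L : ℕ} (h : ∀ l ≤ L, NatV (cheb k l *ᵥ v)) {p q : ℕ}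
    (hpq : p + q ≤ L) : NatV (cheb k p *ᵥ (cheb k q *ᵥ v)) := by
  have key : ∀ p d, 2 * p + d ≤ L → NatV ((cheb k p * cheb k (p + d)) *ᵥ v) := by
    intro p
    induction p with
    | zero => intro d hd; rw [zero_add, cheb, Matrix.one_mul]; exact h d (by omega)
    | succ p ih =>
      intro d hd
      rw [show p + 1 + d = p + d + 1 by ring, cheb_mul_sub, add_mulVec]
      exact (ih (d + 2) (by omega)).add (h d (by omega))
  rcases le_total p q with hle | hle
  · obtain ⟨d, rfl⟩ := Nat.exists_eq_add_of_le hle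
    rw [mulVec_mulVec]
    exact key p d (by omega)
  · obtain ⟨d, rfl⟩ := Nat.exists_eq_add_of_le hle
    rw [mulVec_mulVec, cheb_comm]
    exact key q d (by omega)

/-- The automorphism of the two graphs that exchanges the legs. -/
def legSwap : Vtx k → Vtx k
  | .inl .beta1 => c1
  | .inl .beta2 => c2
  | .inl .beta3 => c3
  | .inl .gamma1 => b1
  | .inl .gamma2 => b2
  | .inl .gamma3 => b3
  | .inr .beta2bar => cb
  | .inr .gamma2bar => bb
  | .inl (.alpha j) => .inl (.alpha j)
  | .inr (.alpha' j) => .inr (.alpha' j)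
  | .inr .f => vf
  | .inr .g => vg

theorem legSwap_legSwap (x : Vtx k) : legSwap (legSwap x) = x := by
  rcases x with (_ | _ | _ | _ | _ | _ | _) | (_ | _ | _ | _ | _) <;> rfl

theorem single_comp_legSwap (x : Vtx k) : e x ∘ legSwap = e (legSwap x) := by
  ext y
  by_cases h : y = legSwap x
  · subst h; simp [legSwap_legSwap]
  · have : legSwap y ≠ x := fun h' => h (by rw [← h', legSwap_legSwap])
    rw [Function.comp_apply, single_apply_ne this, single_apply_ne h]

theorem adjM_comp_legSwap (v : Vtx k → ℚ) :
    adjM k *ᵥ (v ∘ legSwap) = (adjM k *ᵥ v) ∘ legSwap := by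
  have h1 : ∀ j, legSwap (al j : Vtx k) = al j := fun _ => rfl
  have h2 : ∀ j, legSwap (al' j : Vtx k) = al' j := fun _ => rfl
  have h3 : legSwap (b1 : Vtx k) = c1 := rfl
  have h4 : legSwap (b2 : Vtx k) = c2 := rfl
  have h5 : legSwap (b3 : Vtx k) = c3 := rfl
  have h6 : legSwap (c1 : Vtx k) = b1 := rfl
  have h7 : legSwap (c2 : Vtx k) = b2 := rfl
  have h8 : legSwap (c3 : Vtx k) = b3 := rfl
  have h9 : legSwap (bb : Vtx k) = cb := rfl
  have h10 : legSwap (cb : Vtx k) = bb := rfl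
  have h11 : legSwap (vf : Vtx k) = vf := rfl
  have h12 : legSwap (vg : Vtx k) = vg := rfl
  ext x
  induction x using cases_vtx with
  | hal j hj =>
    induction j, hj using al_index_cases with
    | h0 => simp only [Function.comp_apply, h1, adjM_apply_al_zero]
    | h j hj => rw [Function.comp_apply, h1, adjM_apply_al_succ _ hj, adjM_apply_al_succ _ hj]; rfl
    | hl => simp only [Function.comp_apply, h1, h3, h6, adjM_apply_al_last]; ring
  | hal' j hj =>
    induction j, hj using al_index_cases with
    | h0 => simp only [Function.comp_apply, h2, adjM_apply_al'_zero]
    | h j hj => rw [Function.comp_apply, h2, adjM_apply_al'_succ _ hj, adjM_apply_al'_succ _ hj]; rfl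
    | hl => simp only [Function.comp_apply, h2, h11, h12, adjM_apply_al'_last]
  | _ =>
    simp only [Function.comp_apply, h1, h2, h3, adjM_apply_b1, adjM_apply_b2, adjM_apply_b3,
      adjM_apply_c1, adjM_apply_c2, adjM_apply_c3, adjM_apply_vf, adjM_apply_vg, adjM_apply_bb,
      adjM_apply_cb, h4, h5, h6, h7, h8, h9, h10, h11, h12] <;> ring

theorem cheb_comp_legSwap (m : ℕ) (v : Vtx k → ℚ) :
    cheb k m *ᵥ (v ∘ legSwap) = (cheb k m *ᵥ v) ∘ legSwap := by
  induction m using cheb_induction with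
  | h0 => rw [cheb_zero_mulVec, cheb_zero_mulVec]
  | h1 => exact adjM_comp_legSwap v
  | h m h h' => rw [cheb_succ_succ, h, h', adjM_comp_legSwap, cheb_succ_succ]; rfl

theorem cheb_c3 (m : ℕ) : cheb k m *ᵥ e c3 = (cheb k m *ᵥ e b3) ∘ legSwap := by
  rw [← cheb_comp_legSwap, single_comp_legSwap]; rfl

theorem natV_cheb_leg {m : ℕ} (hm : m ≤ 4 * k + 3) :
    NatV (cheb k m *ᵥ e b1) ∧ NatV (cheb k m *ᵥ e b2) ∧ NatV (cheb k m *ᵥ e b3) := by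
  have h : ∀ l ≤ 4 * k + 7, NatV (cheb k l *ᵥ e b3) := fun l hl =>
    natV_cheb_single (cheb_b3_nonneg hl)
  refine ⟨?_, ?_, h m (by omega)⟩
  · rw [← cheb_two_b3]; exact NatV.cheb_cheb h (by omega)
  · rw [← adjM_b3, ← cheb_one_mulVec]; exact NatV.cheb_cheb h (by omega)

theorem natV_cheb_bb {m : ℕ} (hm : m ≤ 4 * k + 3) :
    NatV (cheb k m *ᵥ e bb) ∧ NatV (cheb k m *ᵥ e vg) := by
  have h : ∀ l ≤ 4 * k + 5, NatV (cheb k l *ᵥ e bb) := fun l hl =>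
    natV_cheb_single (cheb_bb_nonneg hl)
  refine ⟨h m (by omega), ?_⟩
  rw [← adjM_bb, ← cheb_one_mulVec]; exact NatV.cheb_cheb h (by omega)

/-- Up to exchange of the legs, every vertex is U_j(A) applied to one of α_0, α'_0, β_3, β̄_2 and f,
whose waves are known to be nonnegative for long enough. -/
theorem natV_cheb {m : ℕ} (hm : m ≤ 4 * k + 3) (x : Vtx k) : NatV (cheb k m *ᵥ e x) := by
  have hs : ∀ y : Vtx k, NatV (cheb k m *ᵥ e y) → NatV (cheb k m *ᵥ e (legSwap y)) := by
    intro y hy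
    rw [← single_comp_legSwap, cheb_comp_legSwap]
    exact hy.comp _
  induction x using cases_vtx with
  | hal j hj =>
    rw [← cheb_al hj]
    exact NatV.cheb_cheb (L := 8 * k + 7) (fun l hl => natV_cheb_single (cheb_al_zero_nonneg hl))
      (by omega)
  | hal' j hj =>
    rw [← cheb_al' hj]
    exact NatV.cheb_cheb (L := 8 * k + 7) (fun l hl => natV_cheb_single (cheb_al'_zero_nonneg hl))
      (by omega)
  | hb1 => exact (natV_cheb_leg hm).1
  | hb2 => exact (natV_cheb_leg hm).2.1
  | hb3 => exact (natV_cheb_leg hm).2.2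
  | hc1 => exact hs _ (natV_cheb_leg hm).1
  | hc2 => exact hs _ (natV_cheb_leg hm).2.1
  | hc3 => exact hs _ (natV_cheb_leg hm).2.2
  | hf => exact natV_cheb_single (cheb_vf_nonneg (by omega))
  | hg => exact (natV_cheb_bb hm).2
  | hbb => exact (natV_cheb_bb hm).1
  | hcb => exact hs _ (natV_cheb_bb hm).1

/-! ### Structure constants and their symmetries. -/

/-- The product of the based ring on `Vtx k`. -/
noncomputable abbrev vmul (u v : Vtx k → ℚ) : Vtx k → ℚ := (generates k).mul u v

/-- The structure constants of the based ring on `Vtx k`. -/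
noncomputable def coef (x y z : Vtx k) : ℚ := vmul (e x) (e y) z

theorem dot_single (u : Vtx k → ℚ) (z : Vtx k) : u ⬝ᵥ e z = u z := by simp [e]

theorem coef_eq_conj_right (x y z : Vtx k) : coef x y z = coef z (conj k y) x := by
  rw [coef, coef, ← dot_single (vmul (e x) (e y)), Generates.mul_dot, single_comp_conj, dotProduct_comm, dot_single]

theorem coef_eq_conj_left (x y z : Vtx k) : coef x y z = coef (conj k x) z y := by
  rw [coef, coef, ← dot_single (vmul (e x) (e y)), Generates.mul_dot', single_comp_conj, dotProduct_comm, dot_single]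

theorem coef_conj (x y z : Vtx k) : coef x y z = coef (conj k y) (conj k x) (conj k z) := by
  have h := congrFun ((generates k).mul_conj (e x) (e y)) (conj k z)
  rw [single_comp_conj, single_comp_conj, Function.comp_apply, conj_conj] at h
  exact h

theorem vmul_apply (u : Vtx k → ℚ) (y z : Vtx k) : vmul u (e y) z = ∑ x, u x * coef x y z := by
  have h : ∀ x, coef x y z = (generates k).R (e y) z x := fun x => by
    rw [coef, vmul, Generates.mul_def, e, mulVec_single_one]; rfl
  simp only [h, vmul, Generates.mul_def, mulVec, dotProduct, mul_comm (u _)]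

theorem NatV.sum {ι : Type*} (s : Finset ι) {f : ι → ℚ} (h : ∀ i ∈ s, ∃ n : ℕ, f i = n) :
    ∃ n : ℕ, ∑ i ∈ s, f i = n := by
  classical
  choose! g hg using h
  exact ⟨∑ i ∈ s, g i, by rw [Finset.sum_congr rfl hg]; push_cast; rfl⟩

/-- Right multiplication by `y` has natural coefficients. -/
def Good (y : Vtx k) : Prop := ∀ x z, ∃ n : ℕ, coef x y z = n

theorem NatV.mul {u : Vtx k → ℚ} (hu : NatV u) {y : Vtx k} (hy : Good y) : NatV (vmul u (e y)) := by
  intro z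
  rw [vmul_apply]
  refine NatV.sum _ fun x _ => ?_
  obtain ⟨a, ha⟩ := hu x
  obtain ⟨b, hb⟩ := hy x z
  exact ⟨a * b, by rw [ha, hb]; push_cast; rfl⟩

theorem good_iff {y : Vtx k} : Good y ↔ ∀ x, NatV (vmul (e x) (e y)) := Iff.rfl

theorem Good.conj {y : Vtx k} (hy : Good y) : Good (conj k y) := fun x z => by
  rw [← coef_eq_conj_right]; exact hy z x

/-- By reciprocity it suffices that one of the three vertices in a coefficient be good, whatever its
position; see also `Good.target`. -/
theorem Good.left {x : Vtx k} (hx : Good x) (y z : Vtx k) : ∃ n : ℕ, coef x y z = n := by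
  rw [coef_conj]; exact hx.conj _ _

theorem Good.target {z : Vtx k} (hz : Good z) (x y : Vtx k) : ∃ n : ℕ, coef x y z = n := by
  rw [coef_eq_conj_left]; exact hz _ _

theorem NatV.mul_left {v : Vtx k → ℚ} (hv : NatV v) {x : Vtx k} (hx : Good x) :
    NatV (vmul (e x) v) := by
  have h := (hv.comp (Vtx.conj k)).mul hx.conj
  have h2 : vmul (v ∘ Vtx.conj k) (e (Vtx.conj k x)) = vmul (e x) v ∘ Vtx.conj k := by
    rw [(generates k).mul_conj, single_comp_conj]
  rw [h2] at h
  have h3 := h.comp (Vtx.conj k)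
  rwa [comp_conj_comp_conj] at h3

/-- By associativity, right multiplication by a product is a composite of two natural matrices. -/
theorem Good.of_mul {x y z : Vtx k} (h : vmul (e x) (e y) = e z) (hx : Good x) (hy : Good y) :
    Good z := fun w => by
  change NatV (vmul (e w) (e z))
  rw [← h, vmul, ← Generates.mul_assoc]
  exact NatV.mul (hx w) hy

theorem vmul_al (u : Vtx k → ℚ) {j : ℕ} (hj : j < 4 * k + 4) :
    vmul u (e (al j)) = cheb k j *ᵥ (projN k *ᵥ u) := by
  rw [vmul, Generates.mul_def, R_al hj, mulVec_mulVec]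

theorem vmul_al' (u : Vtx k → ℚ) {j : ℕ} (hj : j < 4 * k + 4) :
    vmul u (e (al' j)) = cheb k j *ᵥ (u - projN k *ᵥ u) := by
  rw [vmul, Generates.mul_def, R_al' hj, ← mulVec_mulVec, sub_mulVec, one_mulVec]

theorem single_vmul_al {x : Vtx k} (h : rt x = .N) {j : ℕ} (hj : j < 4 * k + 4) :
    vmul (e x) (e (al j)) = cheb k j *ᵥ e x := by
  rw [vmul_al _ hj, projN_single, if_pos h]

theorem single_vmul_al' {x : Vtx k} (h : rt x = .M) {j : ℕ} (hj : j < 4 * k + 4) :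
    vmul (e x) (e (al' j)) = cheb k j *ᵥ e x := by
  rw [vmul_al' _ hj, projN_single, if_neg (by rw [h]; simp), sub_zero]

theorem single_vmul_al_of_ne {x : Vtx k} (h : rt x = .M) {j : ℕ} (hj : j < 4 * k + 4) :
    vmul (e x) (e (al j)) = 0 := by
  rw [vmul_al _ hj, projN_single, if_neg (by rw [h]; simp), mulVec_zero]

theorem single_vmul_al'_of_ne {x : Vtx k} (h : rt x = .N) {j : ℕ} (hj : j < 4 * k + 4) :
    vmul (e x) (e (al' j)) = 0 := by
  rw [vmul_al' _ hj, projN_single, if_pos h, sub_self, mulVec_zero]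

theorem good_al {j : ℕ} (hj : j < 4 * k + 4) : Good (al j : Vtx k) := by
  rw [good_iff]
  intro x
  cases h : rt x
  · rw [single_vmul_al h hj]; exact natV_cheb (by omega) x
  · rw [single_vmul_al_of_ne h hj]; exact natV_zero

theorem good_al' {j : ℕ} (hj : j < 4 * k + 4) : Good (al' j : Vtx k) := by
  rw [good_iff]
  intro x
  cases h : rt x
  · rw [single_vmul_al'_of_ne h hj]; exact natV_zero
  · rw [single_vmul_al' h hj]; exact natV_cheb (by omega) x

theorem vmul_al_zero (u : Vtx k → ℚ) : vmul u (e (al 0)) = projN k *ᵥ u := by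
  rw [vmul_al _ (by omega), cheb_zero_mulVec]

theorem al_zero_vmul (u : Vtx k → ℚ) : vmul (e (al 0)) u = projLeft k *ᵥ u := by
  rw [projLeft_mulVec, ← vmul_al_zero, vmul, vmul, (generates k).mul_conj, comp_conj_comp_conj,
    single_comp_conj, conj_al_zero]

theorem projLeft_single (y : Vtx k) : projLeft k *ᵥ e y = if lt y = .N then e y else 0 := by
  ext z
  rw [projLeft_apply]
  by_cases hz : z = y
  · subst hz; split_ifs <;> simp
  · split_ifs <;> simp [hz]

/-- Multiplication by α_0 on either side is a projection to one coefficient; inserting α_0 in each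
of the three possible places and using associativity gives the three matching conditions. -/
theorem coef_ne_zero {x y z : Vtx k} (h : coef x y z ≠ 0) :
    lt z = lt x ∧ rt z = rt y ∧ rt x = lt y := by
  have h1 := (generates k).mul_assoc (e x) (e y) (e (al 0))
  have h2 := (generates k).mul_assoc (e (al 0)) (e x) (e y)
  have h3 := (generates k).mul_assoc (e x) (e (al 0)) (e y)
  change vmul (vmul (e x) (e y)) (e (al 0)) = vmul (e x) (vmul (e y) (e (al 0))) at h1
  change vmul (vmul (e (al 0)) (e x)) (e y) = vmul (e (al 0)) (vmul (e x) (e y)) at h2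
  change vmul (vmul (e x) (e (al 0))) (e y) = vmul (e x) (vmul (e (al 0)) (e y)) at h3
  rw [vmul_al_zero, vmul_al_zero, projN_single] at h1
  rw [al_zero_vmul, al_zero_vmul, projLeft_single] at h2
  rw [vmul_al_zero, al_zero_vmul, projLeft_single, projN_single] at h3
  replace h1 := congrFun h1 z
  replace h2 := congrFun h2 z
  replace h3 := congrFun h3 z
  rw [projN_mulVec] at h1
  rw [projLeft_apply] at h2
  have hz1 : vmul (0 : Vtx k → ℚ) (e y) = 0 := (generates k).zero_mul _
  have hz2 : vmul (e x) (0 : Vtx k → ℚ) = 0 := (generates k).mul_zero _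
  change vmul (e x) (e y) z ≠ 0 at h
  refine ⟨?_, ?_, ?_⟩
  · cases hx : lt x <;> cases hy : lt z <;> simp_all
  · cases hx : rt z <;> cases hy : rt y <;> simp_all
  · cases hx : rt x <;> cases hy : lt y <;> simp_all

/-! ### Integrality of multiplication by the legs and by f. -/

theorem trib_mod_four (m : ℕ) : ∃ a b c : ℕ, trib (4 * m) = 4 * a + 1 ∧ trib (4 * m + 1) = 2 * b ∧
    trib (4 * m + 2) = 4 * c := by
  induction m with
  | zero => exact ⟨0, 0, 0, by simp [trib], by simp [trib], by simp [trib]⟩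
  | succ m ih =>
    obtain ⟨a, b, c, h0, h1, h2⟩ := ih
    have h3 := trib_rec (4 * m)
    have h4 : trib (4 * m + 4) = _ := trib_rec (4 * m + 1)
    have h5 : trib (4 * m + 5) = _ := trib_rec (4 * m + 2)
    have h6 : trib (4 * m + 6) = _ := trib_rec (4 * m + 3)
    rw [show 4 * m + 1 + 1 = 4 * m + 2 by ring, show 4 * m + 1 + 2 = 4 * m + 3 by ring] at h4
    rw [show 4 * m + 2 + 1 = 4 * m + 3 by ring, show 4 * m + 2 + 2 = 4 * m + 4 by ring] at h5
    rw [show 4 * m + 3 + 1 = 4 * m + 4 by ring, show 4 * m + 3 + 2 = 4 * m + 5 by ring] at h6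
    refine ⟨a + b + 2 * c, 4 * a + 3 * b + 8 * c + 1, 4 * a + 3 * b + 7 * c + 1, ?_, ?_, ?_⟩
    · rw [show 4 * (m + 1) = 4 * m + 4 by ring]; push_cast; linarith
    · rw [show 4 * (m + 1) + 1 = 4 * m + 5 by ring]; push_cast; linarith
    · rw [show 4 * (m + 1) + 2 = 4 * m + 6 by ring]; push_cast; linarith

theorem altSeq_four_mul_add (m r : ℕ) : altSeq (4 * m + r) = altSeq r := by
  induction m with
  | zero => simp
  | succ m ih => rw [← ih, show 4 * (m + 1) + r = 4 * m + r + 4 by ring]; rfl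

theorem exists_nat_trib (n : ℕ) : ∃ m : ℕ, trib n = m := by
  induction n using trib.induct with
  | case1 => exact ⟨1, by simp [trib]⟩
  | case2 => exact ⟨0, by simp [trib]⟩
  | case3 => exact ⟨0, by simp [trib]⟩
  | case4 n h1 h2 h3 =>
    obtain ⟨a, ha⟩ := h1
    obtain ⟨b, hb⟩ := h2
    obtain ⟨c, hc⟩ := h3
    exact ⟨a + b + c, by rw [trib_rec, ha, hb, hc]; push_cast; rfl⟩

theorem cheb_al_zero_next₂ : cheb k (4 * k + 6) *ᵥ e (al 0) =
    e (al (4 * k + 2)) + e b1 + e c1 + e b3 + e c3 := by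
  rw [cheb_succ_succ, cheb_al_zero_next', cheb_al_zero_next, mulVec_add, mulVec_add, adjM_al_last,
    adjM_b2, adjM_c2]
  abel

theorem cheb_two_sub : cheb k 2 *ᵥ (e b1 - e c1) = e b3 - e c3 := by
  rw [cheb_succ_succ, cheb_one_mulVec, cheb_zero_mulVec, mulVec_sub, adjM_b1, adjM_c1,
    add_sub_add_left_eq_sub, mulVec_sub, adjM_b2, adjM_c2]
  abel

/-- β_3 is half of (β_3 + γ_3) + (β_3 - γ_3). The sum is U_{n+3} - U_{n+1} - U_{n-1} applied to α_0,
and the difference is U_2 applied to β_1 - γ_1. The indices are left unsimplified to match the times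
in `wave_beta`. -/
theorem R_b3 : (generates k).R (e b3) = (1 / 2 : ℚ) • ((cheb k (2 + 2 * (2 * k + 2)) -
    cheb k (2 + 2 * (2 * k + 1)) - cheb k (2 + 2 * (2 * k))) * projN k + cheb k 2 * antiM k) := by
  refine (generates k).R_unique (Subalgebra.smul_mem _ (add_mem (mul_mem (sub_mem (sub_mem
    (cheb_mem _) (cheb_mem _)) (cheb_mem _)) projN_mem) (mul_mem (cheb_mem _) antiM_mem)) _) ?_
  rw [smul_mulVec, add_mulVec, ← mulVec_mulVec, ← mulVec_mulVec, projN_oneVec, antiM_oneVec,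
    sub_mulVec, sub_mulVec, show 2 + 2 * (2 * k + 2) = 4 * k + 6 by ring,
    show 2 + 2 * (2 * k + 1) = 4 * k + 4 by ring, show 2 + 2 * (2 * k) = 4 * k + 2 by ring,
    cheb_two_sub, cheb_al_zero_next₂, cheb_al_zero_next, cheb_al (by omega)]
  module

theorem vmul_b3 {x : Vtx k} (hx : rt x = .N) : vmul (e x) (e b3) = (1 / 2 : ℚ) •
    (cheb k (2 + 2 * (2 * k + 2)) *ᵥ e x - cheb k (2 + 2 * (2 * k + 1)) *ᵥ e x -
      cheb k (2 + 2 * (2 * k)) *ᵥ e x + cheb k 2 *ᵥ (antiM k *ᵥ e x)) := by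
  rw [vmul, Generates.mul_def, R_b3, smul_mulVec, add_mulVec, ← mulVec_mulVec, ← mulVec_mulVec,
    projN_single, if_pos hx, sub_mulVec, sub_mulVec]

theorem cheb_two_antiPlus : cheb k 2 *ᵥ antiPlus k = antiPlus k := by
  rw [cheb_succ_succ, cheb_one_mulVec, cheb_zero_mulVec, adjM_antiPlus, mulVec_smul, adjM_antiNM]
  module
theorem cheb_two_antiMinus : cheb k 2 *ᵥ antiMinus k = -antiMinus k := by
  rw [cheb_succ_succ, cheb_one_mulVec, cheb_zero_mulVec, adjM_antiMinus, mulVec_zero, zero_sub]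
theorem cheb_two_vecNull : cheb k 2 *ᵥ vecNull k = -vecNull k := by
  rw [cheb_succ_succ, cheb_one_mulVec, cheb_zero_mulVec, adjM_vecNull, mulVec_zero, zero_sub]
theorem cheb_two_vecTwo : cheb k 2 *ᵥ vecTwo k = vecTwo k := by
  rw [cheb_succ_succ, cheb_one_mulVec, cheb_zero_mulVec, adjM_vecTwo, mulVec_smul, adjM_vecTwoNM]
  module

theorem cheb_two_antiM_leg {x : Vtx k} (hx : x = b3 ∨ x = c3) : cheb k 2 *ᵥ (antiM k *ᵥ e x) =
    (1 / 2 : ℚ) • (vecNull k x • antiPlus k - antiPlus k x • vecNull k - vecTwo k x • antiMinus k +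
      antiMinus k x • vecTwo k) := by
  have h1 : antiMN k x = 0 := by rcases hx with rfl | rfl <;> simp [antiMN]
  have h2 : vecTwoMN k x = 0 := by rcases hx with rfl | rfl <;> rfl
  rw [antiM_mulVec]
  simp only [dotProduct_single_one, h1, h2, mulVec_add, mulVec_smul, cheb_two_antiPlus,
    cheb_two_antiMinus, cheb_two_vecNull, cheb_two_vecTwo, zero_smul, add_zero]
  module

/-- After the Tribonacci recursion, the leg-symmetric part is trib(2k)/4 at β_3, γ_3 and
trib(2k+2)/4 at β_1, γ_1. One of these Tribonacci numbers is 1 modulo 4 and the other 0, according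
to the parity of k. The terms from `altSeq` and `antiM` depend on the same parity and supply exactly
the missing quarters. -/
theorem exists_nat_leg {x z : Vtx k} (hx : x = b3 ∨ x = c3)
    (hz : z = b1 ∨ z = c1 ∨ z = b3 ∨ z = c3) : ∃ n : ℕ, coef x b3 z = n := by
  have hW := fun i hi => wave_beta (branchWave_b3 (k := k)) cheb_two_b3 cheb_three_b3 i hi
  -- The three half-times 2k+2, 2k+1, 2k belong to the three Chebyshev terms of `R_b3`.
  obtain ⟨⟨-, p1, p2, -, -, p5, p6⟩, -⟩ := hW (2 * k + 2) (by omega)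
  obtain ⟨⟨-, q1, q2, -, -, q5, q6⟩, -⟩ := hW (2 * k + 1) (by omega)
  obtain ⟨⟨-, r1, r2, -, -, r5, r6⟩, -⟩ := hW (2 * k) (by omega)
  have t1 := trib_rec (2 * k)
  have t2 : trib (2 * k + 5) = _ := trib_rec (2 * k + 2)
  have hrt : rt x = .N := by rcases hx with rfl | rfl <;> simp
  simp only [show 2 * k + 2 + 3 = 2 * k + 5 by ring, show 2 * k + 2 + 1 = 2 * k + 3 by ring,
    show 2 * k + 1 + 3 = 2 * k + 4 by ring, show 2 * k + 1 + 1 = 2 * k + 2 by ring] at *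
  have alt : ∀ m r, altSeq (2 * (2 * m) + r) = altSeq r := fun m r => by
    rw [← altSeq_four_mul_add m r]; ring_nf
  have alt' : ∀ m r, altSeq (2 * (2 * m + 1) + r) = altSeq (2 + r) := fun m r => by
    rw [← altSeq_four_mul_add m (2 + r)]; ring_nf
  have s1 : legSwap (b1 : Vtx k) = c1 := rfl
  have s2 : legSwap (c1 : Vtx k) = b1 := rfl
  have s3 : legSwap (b3 : Vtx k) = c3 := rfl
  have s4 : legSwap (c3 : Vtx k) = b3 := rfl
  have key : ∃ a c : ℕ, (sgn k = 1 ∧ trib (2 * k) = 4 * a + 1 ∧ trib (2 * k + 2) = 4 * c ∧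
      altSeq (2 * k + 5) = 0 ∧ altSeq (2 * k + 4) = 1 ∧ altSeq (2 * k + 3) = -1 ∧
      altSeq (2 * k + 2) = 0 ∧ altSeq (2 * k + 1) = 0) ∨
      (sgn k = -1 ∧ trib (2 * k + 2) = 4 * a + 1 ∧ trib (2 * k) = 4 * c ∧
      altSeq (2 * k + 5) = -1 ∧ altSeq (2 * k + 4) = 0 ∧ altSeq (2 * k + 3) = 0 ∧
      altSeq (2 * k + 2) = 1 ∧ altSeq (2 * k + 1) = -1) := by
    rcases Nat.even_or_odd' k with ⟨m, hm | hm⟩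
    · obtain ⟨a, b, c, ha, hb, hc⟩ := trib_mod_four m
      refine ⟨a, c, .inl ⟨by rw [sgn_eq, Even.neg_one_pow ⟨m, by omega⟩], ?_, ?_, ?_⟩⟩
      · rw [← ha, hm]; ring_nf
      · rw [← hc, hm]; ring_nf
      · rw [hm]; simp only [alt]; simp [altSeq]
    · obtain ⟨a, -, -, ha, -, -⟩ := trib_mod_four (m + 1)
      obtain ⟨-, -, c, -, -, hc⟩ := trib_mod_four m
      refine ⟨a, c, .inr ⟨by rw [sgn_eq, Odd.neg_one_pow ⟨m, hm⟩], ?_, ?_, ?_⟩⟩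
      · rw [← ha, hm]; ring_nf
      · rw [← hc, hm]; ring_nf
      · rw [hm]; simp only [alt']; simp [altSeq]
  rw [coef, vmul_b3 hrt, cheb_two_antiM_leg hx]
  obtain ⟨a, c, ⟨hk, u1, u2, a5, a4, a3, a2, a1⟩ | ⟨hk, u1, u2, a5, a4, a3, a2, a1⟩⟩ := key <;>
  rcases hx with rfl | rfl <;> rcases hz with rfl | rfl | rfl | rfl <;>
  simp only [Pi.smul_apply, Pi.add_apply, Pi.sub_apply, smul_eq_mul, cheb_c3,
    Function.comp_apply, s1, s2, s3, s4, p1, p2, p5, p6, q1, q2, q5, q6, r1, r2, r5, r6, a1, a2,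
    a3, a4, a5, vecNull, vecTwo, antiPlus, antiMinus, hk, u1, u2, t1, t2] <;>
  simp only [Pi.single_apply, Sum.inl.injEq, reduceCtorEq, if_true, if_false] <;>
  first
  | exact ⟨a, by linarith⟩
  | exact ⟨c, by linarith⟩
  | exact ⟨a + 1, by push_cast; linarith⟩

/-- Only the products β_3·β_3 and γ_3·β_3 need computation. The other vertices with right
coefficient N either are good already or arise as a good vertex times β_3 or γ_3, so associativity
reduces them to these two products. -/
theorem good_b3 : Good (b3 : Vtx k) := by
  have rtN : ∀ {x : Vtx k}, rt x = .N → ∀ {j : ℕ}, j < 4 * k + 4 →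
    vmul (e x) (e (al j)) = cheb k j *ᵥ e x := fun h _ hj => single_vmul_al h hj
  have leg : ∀ {x : Vtx k}, x = b3 ∨ x = c3 → NatV (vmul (e x) (e b3)) := by
    intro x hx z
    change ∃ n : ℕ, coef x b3 z = n
    by_cases hz : coef x b3 z = 0
    · exact ⟨0, by rw [hz]; simp⟩
    have hs := coef_ne_zero hz
    -- Coefficients at α_j are settled by reciprocity, the grading excludes most of the rest, and
    -- four explicit targets remain.
    induction z using cases_vtx with
    | hal j hj => exact (good_al hj).target _ _
    | hal' j hj => exact (good_al' hj).target _ _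
    | hb1 | hc1 | hb3 | hc3 => exact exists_nat_leg hx (by simp)
    | _ => rcases hx with rfl | rfl <;> simp [lt] at hs
  have h2 : vmul (e b3) (e (al 2)) = e (b1 : Vtx k) := by
    rw [rtN (by simp) (by omega), cheb_two_b3]
  have h1 : vmul (e b3) (e (al 1)) = e (b2 : Vtx k) := by
    rw [rtN (by simp) (by omega), cheb_one_mulVec, adjM_b3]
  have h2' : vmul (e c3) (e (al 2)) = e (c1 : Vtx k) := by
    rw [rtN (by simp) (by omega), cheb_c3, cheb_two_b3, single_comp_legSwap]; rfl
  have h1' : vmul (e c3) (e (al 1)) = e (c2 : Vtx k) := by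
    rw [rtN (by simp) (by omega), cheb_one_mulVec, adjM_c3]
  have conj2 : conj k (al 2) = al 2 := conj_al_even (by omega) (by norm_num)
  have flip : ∀ {x y z : Vtx k}, vmul (e x) (e y) = e z →
      vmul (e (conj k y)) (e (conj k x)) = e (conj k z) := by
    intro x y z h
    rw [← single_comp_conj, ← single_comp_conj, vmul, ← Generates.mul_conj, ← single_comp_conj z,
      ← h]
  have step : ∀ {x y z : Vtx k}, vmul (e x) (e y) = e z → Good x → (y = b3 ∨ y = c3) →
      NatV (vmul (e z) (e b3)) := by
    intro x y z h hx hy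
    rw [← h, vmul, Generates.mul_assoc]
    exact NatV.mul_left (leg hy) hx
  rw [good_iff]
  intro x
  induction x using cases_vtx with
  | hal j hj => exact (good_al hj).left _
  | hal' j hj => exact (good_al' hj).left _
  | hb3 => exact leg (.inl rfl)
  | hc3 => exact leg (.inr rfl)
  | hb1 =>
    have h := flip h2
    rw [conj2, conj_b3, conj_b1] at h
    exact step h (good_al (by omega)) (.inr rfl)
  | hc1 =>
    have h := flip h2'
    rw [conj2, conj_c3, conj_c1] at h
    exact step h (good_al (by omega)) (.inl rfl)
  | hbb =>
    have h := flip h1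
    rw [conj_al_one, conj_b3, conj_b2] at h
    exact step h (good_al' (by omega)) (.inr rfl)
  | hcb =>
    have h := flip h1'
    rw [conj_al_one, conj_c3, conj_c2] at h
    exact step h (good_al' (by omega)) (.inl rfl)
  | _ =>
    intro z
    change ∃ n : ℕ, coef _ b3 z = n
    refine ⟨0, ?_⟩
    by_contra h
    have hs := (coef_ne_zero (z := z) (by simpa using h)).2.2
    simp [lt] at hs

/-- The remaining vertices are conjugates of leg vertices or products of a leg vertex with α_1 or
α_2; f is not obtained in this way. -/
theorem good_of_ne {x : Vtx k} (hx : x ≠ vf) : Good x := by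
  have hc3 : Good (c3 : Vtx k) := by
    have := (good_b3 (k := k)).conj
    rwa [conj_b3] at this
  have hb2 : Good (b2 : Vtx k) := Good.of_mul
    (by rw [single_vmul_al (by simp) (by omega), cheb_one_mulVec, adjM_b3])
    good_b3 (good_al (j := 1) (by omega))
  have hc2 : Good (c2 : Vtx k) := Good.of_mul
    (by rw [single_vmul_al (by simp) (by omega), cheb_one_mulVec, adjM_c3])
    hc3 (good_al (j := 1) (by omega))
  have hbb : Good (bb : Vtx k) := by
    have := hb2.conj
    rwa [conj_b2] at this
  induction x using cases_vtx with
  | hal j hj => exact good_al hj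
  | hal' j hj => exact good_al' hj
  | hb1 =>
    exact Good.of_mul (by rw [single_vmul_al (by simp) (by omega), cheb_two_b3])
      good_b3 (good_al (j := 2) (by omega))
  | hb2 => exact hb2
  | hb3 => exact good_b3
  | hc1 =>
    exact Good.of_mul
      (by rw [single_vmul_al (by simp) (by omega), cheb_c3, cheb_two_b3, single_comp_legSwap]; rfl)
      hc3 (good_al (j := 2) (by omega))
  | hc2 => exact hc2
  | hc3 => exact hc3
  | hf => exact absurd rfl hx
  | hg =>
    exact Good.of_mul (by rw [single_vmul_al (by simp) (by omega), cheb_one_mulVec, adjM_bb])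
      hbb (good_al (j := 1) (by omega))
  | hbb => exact hbb
  | hcb =>
    have := hc2.conj
    rwa [conj_c2] at this

/-- As g = ᾱ_1 β_2 and f ᾱ_1 = ᾱ_n, the product f g is ᾱ_n β_2. Conjugating turns its coefficient
into one of U_n(A) at β̄_2. -/
theorem coef_vf_vg_vf : coef (vf : Vtx k) vg vf = trib (2 * k + 3) := by
  have h1 : vmul (e vf) (e (al' 1)) = e (al' (4 * k + 3) : Vtx k) := by
    rw [single_vmul_al' (by simp) (by omega), cheb_one_mulVec, adjM_vf]
  have h2 : vmul (e (al' 1)) (e b2) = e (vg : Vtx k) := by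
    have h : vmul (e bb) (e (al 1)) = e (vg : Vtx k) := by
      rw [single_vmul_al (by simp) (by omega), cheb_one_mulVec, adjM_bb]
    have h3 := (generates k).mul_conj (e bb) (e (al 1))
    change vmul _ _ ∘ _ = _ at h3
    rw [h, single_comp_conj, single_comp_conj, single_comp_conj, conj_vg, conj_al_one,
      conj_bb] at h3
    exact h3.symm
  have h3 : coef (vf : Vtx k) vg vf = coef (al' (4 * k + 3) : Vtx k) b2 vf := by
    rw [coef, ← h2, vmul, ← Generates.mul_assoc]
    change vmul (vmul _ _) _ _ = _
    rw [h1]; rfl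
  rw [h3, coef_conj, conj_b2, conj_al'_last, conj_vf, coef,
    single_vmul_al (by simp) (by omega)]
  have := (wave_betaBar (branchWave'_bb (k := k)) (cheb_zero_mulVec _) adjM_bb (2 * k + 1)
    (by omega)).2.2.1
  rw [show 0 + (2 * (2 * k + 1) + 1) = 4 * k + 3 by ring,
    show 2 * k + 1 + 2 = 2 * k + 3 by ring] at this
  exact this

/-- f + g is U_{n+1}(A) applied to α'_0, so f·f + f·g is read off from the wave starting at f, and
`coef_vf_vg_vf` is subtracted. -/
theorem coef_vf_vf_vf : coef (vf : Vtx k) vf vf = trib (2 * k + 2) := by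
  have hR : (generates k).R (e vf + e vg) = cheb k (4 * k + 4) * (1 - projN k) :=
    (generates k).R_unique (mul_mem (cheb_mem _) (sub_mem (one_mem _) projN_mem))
      (by rw [← mulVec_mulVec, sub_mulVec, projN_oneVec, one_mulVec, oneVec, add_sub_cancel_left,
        cheb_al'_zero_next])
  have h : vmul (e vf) (e vf) + vmul (e vf) (e vg) = cheb k (4 * k + 4) *ᵥ e vf := by
    rw [vmul, vmul, ← Generates.mul_add, Generates.mul_def, hR, ← mulVec_mulVec, sub_mulVec,
      projN_single, if_neg (by simp), one_mulVec, sub_zero]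
  have h1 := congrFun h vf
  have h2 : coef (vf : Vtx k) vf vf + coef vf vg vf = (cheb k (4 * k + 4) *ᵥ e vf) vf := h1
  have := (wave_f (branchWave'_vf (k := k)) (cheb_zero_mulVec _) adjM_vf (2 * k + 2)
    (by omega)).1.2.1
  rw [show 0 + 2 * (2 * k + 2) = 4 * k + 4 by ring,
    show 2 * k + 2 + 1 = 2 * k + 3 by ring] at this
  rw [this, coef_vf_vg_vf] at h2
  linarith

/-- The structure constants are natural numbers. -/
theorem exists_nat_coef (x y z : Vtx k) : ∃ n : ℕ, coef x y z = n := by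
  by_cases hx : x = vf
  · by_cases hy : y = vf
    · by_cases hz : z = vf
      · rw [hx, hy, hz, coef_vf_vf_vf]; exact exists_nat_trib _
      · exact (good_of_ne hz).target _ _
    · exact good_of_ne hy _ _
  · exact (good_of_ne hx).left _ _

/-! ### Passage between the graded sets and the set of all vertices. -/

namespace V

/-- The vertex underlying an element of `V`. -/
def toVtx : ∀ {P Q : Side}, V k P Q → Vtx k
  | .N, .N, x => .inl x.v11
  | .N, .M, x => .inl x.v12
  | .M, .N, x => .inr x.v21
  | .M, .M, x => .inr x.v22

theorem toVtx_injective {P Q : Side} : Function.Injective (toVtx : V k P Q → Vtx k) := by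
  intro x y h
  cases P <;> cases Q
  · exact Subtype.ext (Sum.inl_injective h)
  · exact Subtype.ext (Sum.inl_injective h)
  · exact Subtype.ext (Sum.inr_injective h)
  · exact Subtype.ext (Sum.inr_injective h)

theorem lt_toVtx {P Q : Side} (x : V k P Q) : lt x.toVtx = P := by
  cases P <;> cases Q <;> rfl

theorem rt_toVtx {P Q : Side} (x : V k P Q) : rt x.toVtx = Q := by
  cases P <;> cases Q
  · exact if_pos x.2
  · exact if_neg (Nat.not_even_iff_odd.2 x.2)
  · exact if_neg (Nat.not_even_iff_odd.2 x.2)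
  · exact if_pos x.2

theorem exists_toVtx (x : Vtx k) {P Q : Side} (hl : lt x = P) (hr : rt x = Q) :
    ∃ v : V k P Q, v.toVtx = x := by
  subst hl hr
  rcases x with x | x
  · by_cases h : Even x.depth
    · have : rt (.inl x : Vtx k) = .N := if_pos h
      rw [this]
      exact ⟨⟨x, h⟩, rfl⟩
    · have : rt (.inl x : Vtx k) = .M := if_neg h
      rw [this]
      exact ⟨⟨x, Nat.not_even_iff_odd.1 h⟩, rfl⟩
  · by_cases h : Even x.depth
    · have : rt (.inr x : Vtx k) = .M := if_pos h
      rw [this]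
      exact ⟨⟨x, h⟩, rfl⟩
    · have : rt (.inr x : Vtx k) = .N := if_neg h
      rw [this]
      exact ⟨⟨x, Nat.not_even_iff_odd.1 h⟩, rfl⟩

/-- A vertex as an element of `V`. -/
noncomputable def ofVtx (x : Vtx k) {P Q : Side} (hl : lt x = P) (hr : rt x = Q) : V k P Q :=
  (exists_toVtx x hl hr).choose

theorem toVtx_ofVtx (x : Vtx k) {P Q : Side} (hl : lt x = P) (hr : rt x = Q) :
    (ofVtx x hl hr).toVtx = x := (exists_toVtx x hl hr).choose_spec

theorem toVtx_alphaOdd (j : Fin (4 * k + 4)) (hj : Odd (j : ℕ)) :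
    (alphaOdd k j hj).toVtx = al j := by
  change Sum.inl (GVertex.alpha j) = al (j : ℕ)
  rw [al, Fin.ofNat_eq_cast, Fin.cast_val_eq_self]

theorem toVtx_alphaOddBar (j : Fin (4 * k + 4)) (hj : Odd (j : ℕ)) :
    (alphaOddBar k j hj).toVtx = al' j := by
  change Sum.inr (GVertex'.alpha' j) = al' (j : ℕ)
  rw [al', Fin.ofNat_eq_cast, Fin.cast_val_eq_self]

theorem toVtx_alpha0 : (alpha0 k).toVtx = al 0 := rfl
theorem toVtx_alpha0' : (alpha0' k).toVtx = al' 0 := rfl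
theorem toVtx_alpha1 : (alpha1 k).toVtx = al 1 := toVtx_alphaOdd _ _
theorem toVtx_alpha1Bar : (alpha1Bar k).toVtx = al' 1 := toVtx_alphaOddBar _ _
theorem toVtx_beta2 : (beta2 k).toVtx = b2 := rfl
theorem toVtx_gamma2 : (gamma2 k).toVtx = c2 := rfl
theorem toVtx_beta2Bar : (beta2Bar k).toVtx = bb := rfl
theorem toVtx_gamma2Bar : (gamma2Bar k).toVtx = cb := rfl

theorem sum_toVtx {P Q : Side} {M : Type*} [AddCommMonoid M] (f : Vtx k → M)
    (hf : ∀ x, f x ≠ 0 → lt x = P ∧ rt x = Q) : ∑ v : V k P Q, f v.toVtx = ∑ x, f x := by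
  refine Finset.sum_of_injOn toVtx toVtx_injective.injOn (by simp) (fun x _ hx => ?_)
    (fun _ _ => rfl)
  by_contra h
  obtain ⟨hl, hr⟩ := hf x h
  obtain ⟨v, hv⟩ := exists_toVtx x hl hr
  exact hx ⟨v, by simp, hv⟩

end V

/-! ### Existence of the fusion ring. -/

section Existence

open V

/-- The structure constants of the fusion ring. -/
noncomputable def natCoef (x y z : Vtx k) : ℕ := (exists_nat_coef x y z).choose

theorem natCoef_cast (x y z : Vtx k) : (natCoef x y z : ℚ) = coef x y z :=
  (exists_nat_coef x y z).choose_spec.symm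

/-- The element of the based ring on `Vtx k` with the given coefficients. -/
def extend {P Q : Side} (a : V k P Q → ℤ) : Vtx k → ℚ := ∑ x, (a x : ℚ) • e x.toVtx

theorem extend_toVtx {P Q : Side} (a : V k P Q → ℤ) (x : V k P Q) : extend a x.toVtx = a x := by
  rw [extend, Finset.sum_apply, Finset.sum_eq_single x]
  · simp
  · intro y _ hy
    rw [Pi.smul_apply, single_apply_ne (toVtx_injective.ne hy.symm), smul_zero]
  · simp

theorem extend_injective {P Q : Side} : Function.Injective (extend : (V k P Q → ℤ) → _) := by
  intro a b h
  ext x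
  have := congrFun h x.toVtx
  rw [extend_toVtx, extend_toVtx] at this
  exact_mod_cast this

theorem vmul_eq_sum {P Q R : Side} (x : V k P Q) (y : V k Q R) :
    vmul (e x.toVtx) (e y.toVtx) = ∑ z : V k P R, coef x.toVtx y.toVtx z.toVtx • e z.toVtx := by
  rw [sum_toVtx (fun z => coef x.toVtx y.toVtx z • e z) (fun z hz => ?_)]
  · ext w
    rw [Finset.sum_apply, Finset.sum_eq_single w]
    · simp [coef]
    · intro z _ hz
      rw [Pi.smul_apply, single_apply_ne hz.symm, smul_zero]
    · simp
  · have h : coef x.toVtx y.toVtx z ≠ 0 := fun h => hz (by rw [h, zero_smul])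
    have h1 := coef_ne_zero h
    rw [lt_toVtx, rt_toVtx] at h1
    exact ⟨h1.1, h1.2.1⟩

/-- Makes the extension by zero multiplicative, so that associativity of the graded product is
inherited from `Generates.mul_assoc`. -/
theorem extend_gradedProd {P Q R : Side} (a : V k P Q → ℤ) (b : V k Q R → ℤ) :
    extend (gradedProd (fun _ _ _ x y z => natCoef x.toVtx y.toVtx z.toVtx) a b) =
      vmul (extend a) (extend b) := by
  rw [extend, extend, extend, vmul, Generates.mul_sum]
  simp only [Generates.sum_mul, Generates.mul_smul, Generates.smul_mul]
  have h : ∀ (x : V k P Q) (y : V k Q R), (generates k).mul (e x.toVtx) (e y.toVtx) =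
      ∑ z : V k P R, coef x.toVtx y.toVtx z.toVtx • e z.toVtx := vmul_eq_sum
  simp only [h, Finset.smul_sum, gradedProd]
  push_cast
  simp only [natCoef_cast, Finset.sum_smul]
  simp only [smul_smul]
  rw [Finset.sum_comm]
  refine Eq.trans ?_ Finset.sum_comm
  refine Finset.sum_congr rfl fun x _ => ?_
  rw [Finset.sum_comm]
  refine Finset.sum_congr rfl fun y _ => Finset.sum_congr rfl fun z _ => ?_
  congr 1
  ring

theorem natCoef_eq_iff {x y z : Vtx k} {n : ℕ} : natCoef x y z = n ↔ coef x y z = n := by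
  rw [← natCoef_cast]; exact_mod_cast Iff.rfl

theorem natCoef_eq_natCoef {x y z x' y' z' : Vtx k} (h : coef x y z = coef x' y' z') :
    natCoef x y z = natCoef x' y' z' := by
  rw [natCoef_eq_iff, natCoef_cast, h]

theorem coef_al_zero {x : Vtx k} (hx : rt x = .N) (z : Vtx k) : coef x (al 0) z = e x z := by
  rw [coef, vmul_al_zero, projN_single, if_pos hx]

theorem coef_al'_zero {x : Vtx k} (hx : rt x = .M) (z : Vtx k) : coef x (al' 0) z = e x z := by
  rw [coef, single_vmul_al' hx (by omega), cheb_zero_mulVec]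

theorem single_toVtx {P Q : Side} (x y : V k P Q) :
    e x.toVtx y.toVtx = ((if x = y then 1 else 0 : ℕ) : ℚ) := by
  by_cases h : x = y
  · subst h; simp
  · rw [single_apply_ne (toVtx_injective.ne (Ne.symm h)), if_neg h, Nat.cast_zero]

/-- The involution of the fusion ring. -/
noncomputable def V.conj {P Q : Side} (x : V k P Q) : V k Q P :=
  ofVtx (Vtx.conj k x.toVtx) (by rw [lt_conj, rt_toVtx]) (by rw [rt_conj, lt_toVtx])

theorem V.toVtx_conj {P Q : Side} (x : V k P Q) : x.conj.toVtx = Vtx.conj k x.toVtx :=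
  toVtx_ofVtx _ _ _

/-- The identity objects of the fusion ring. -/
def V.one (k : ℕ) : ∀ P : Side, V k P P
  | .N => alpha0 k
  | .M => alpha0' k

theorem natCoef_conj_right {P Q R : Side} (x : V k P Q) (y : V k Q R) (z : V k P R) :
    natCoef x.toVtx y.toVtx z.toVtx = natCoef z.toVtx y.conj.toVtx x.toVtx :=
  natCoef_eq_natCoef (by rw [toVtx_conj, ← coef_eq_conj_right])

theorem natCoef_conj_left {P Q R : Side} (x : V k P Q) (y : V k Q R) (z : V k P R) :
    natCoef x.toVtx y.toVtx z.toVtx = natCoef x.conj.toVtx z.toVtx y.toVtx :=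
  natCoef_eq_natCoef (by rw [toVtx_conj, ← coef_eq_conj_left])

theorem V.conj_conj {P Q : Side} (x : V k P Q) : x.conj.conj = x :=
  toVtx_injective (by rw [toVtx_conj, toVtx_conj, Vtx.conj_conj])

theorem natCoef_conj {P Q R : Side} (x : V k P Q) (y : V k Q R) (z : V k P R) :
    natCoef x.toVtx y.toVtx z.toVtx = natCoef y.conj.toVtx x.conj.toVtx z.conj.toVtx :=
  natCoef_eq_natCoef (by rw [toVtx_conj, toVtx_conj, toVtx_conj, ← coef_conj])

theorem natCoef_one {P Q : Side} (x y : V k P Q) :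
    natCoef x.toVtx (V.one k Q).toVtx y.toVtx = if x = y then 1 else 0 := by
  rw [natCoef_eq_iff, ← single_toVtx]
  cases Q
  · exact coef_al_zero (rt_toVtx x) _
  · exact coef_al'_zero (rt_toVtx x) _

theorem V.conj_one (P : Side) : (V.one k P).conj = V.one k P := by
  refine toVtx_injective ?_
  rw [toVtx_conj]
  cases P
  · exact conj_al_zero
  · exact conj_al'_zero

/-- The fusion ring of the pair of graphs. -/
noncomputable def graphFusionRing (k : ℕ) : FusionRing (V k) where
  N _ _ _ x y z := natCoef x.toVtx y.toVtx z.toVtx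
  conj _ _ x := x.conj
  one := V.one k
  mul_assoc P Q R S a b c := extend_injective (by
    rw [extend_gradedProd, extend_gradedProd, extend_gradedProd, extend_gradedProd]
    exact (generates k).mul_assoc _ _ _)
  conj_conj _ _ x := x.conj_conj
  frobenius₁ _ _ _ x y z := natCoef_conj_right x y z
  frobenius₂ _ _ _ x y z := natCoef_conj_left x y z
  frobenius₃ _ _ _ x y z := natCoef_conj x y z
  frobenius₄ _ _ _ x y z := by rw [natCoef_conj_left, natCoef_conj, V.conj_conj]
  frobenius₅ _ _ _ x y z := by rw [natCoef_conj_right, natCoef_conj, V.conj_conj]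
  mul_one _ _ x y := natCoef_one x y
  one_mul P Q x y := by
    rw [natCoef_conj, V.conj_one, natCoef_one]
    exact if_congr ⟨fun h => by rw [← V.conj_conj x, h, V.conj_conj], fun h => by rw [h]⟩ rfl rfl

theorem coef_al_one {x : Vtx k} (hx : rt x = .N) (z : Vtx k) : coef x (al 1) z = adjM k z x := by
  rw [coef, single_vmul_al hx (by omega), cheb_one_mulVec, mulVec_single_one]; rfl

theorem coef_al'_one {x : Vtx k} (hx : rt x = .M) (z : Vtx k) : coef x (al' 1) z = adjM k z x := by
  rw [coef, single_vmul_al' hx (by omega), cheb_one_mulVec, mulVec_single_one]; rfl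

open Classical in
theorem adjM_toVtx (x z : Vtx k) : adjM k z x = ((if Adj x z then 1 else 0 : ℕ) : ℚ) := by
  simp only [adjM, adj_comm (x := z)]
  split_ifs <;> simp

theorem graphCompatible_graphFusionRing (k : ℕ) : GraphCompatible k (graphFusionRing k) where
  one_N := rfl
  one_M := rfl
  conj_alpha j hj := toVtx_injective (by
    change (V.conj _).toVtx = _
    rw [toVtx_conj, toVtx_alphaOdd, toVtx_alphaOddBar,
      conj_al_odd j.2 (Nat.not_even_iff_odd.2 hj)])
  conj_beta2 := toVtx_injective ((toVtx_conj _).trans conj_b2)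
  conj_gamma2 := toVtx_injective ((toVtx_conj _).trans conj_c2)
  edge_NN x y := by
    change natCoef _ _ _ = _
    rw [natCoef_eq_iff, toVtx_alpha1, coef_al_one (rt_toVtx x), adjM_toVtx]; rfl
  edge_MN x y := by
    change natCoef _ _ _ = _
    rw [natCoef_eq_iff, toVtx_alpha1, coef_al_one (rt_toVtx x), adjM_toVtx]; rfl
  edge_NM x y := by
    change natCoef _ _ _ = _
    rw [natCoef_eq_iff, toVtx_alpha1Bar, coef_al'_one (rt_toVtx x), adjM_toVtx]; rfl
  edge_MM x y := by
    change natCoef _ _ _ = _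
    rw [natCoef_eq_iff, toVtx_alpha1Bar, coef_al'_one (rt_toVtx x), adjM_toVtx]; rfl

end Existence

/-! ### Uniqueness of right multiplication by β_1 - γ_1. -/

/-- The properties that determine right multiplication by `β_1 - γ_1`. -/
structure IsAnti (X : Matrix (Vtx k) (Vtx k) ℚ) : Prop where
  symm : Xᵀ = X
  comm : Commute X (leftM k)
  mul_projN : X * projN k = X
  apply_al_zero : X *ᵥ e (al 0) = e b1 - e c1
  anticomm : cheb k 2 * X = -(X * cheb k 2)

theorem cheb_two_vecTwoMN : cheb k 2 *ᵥ vecTwoMN k = vecTwoMN k := by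
  rw [cheb_succ_succ, cheb_one_mulVec, cheb_zero_mulVec, adjM_vecTwoMN, adjM_vecTwoMM]
  module

theorem cheb_two_antiMN : cheb k 2 *ᵥ antiMN k = -antiMN k := by
  rw [cheb_succ_succ, cheb_one_mulVec, cheb_zero_mulVec, adjM_antiMN, mulVec_zero, zero_sub]

theorem vecMul_cheb (m : ℕ) (v : Vtx k → ℚ) : v ᵥ* cheb k m = cheb k m *ᵥ v := by
  rw [← mulVec_transpose, cheb_symm]

theorem isAnti_antiM : IsAnti (antiM k) where
  symm := antiM_symm
  comm := commute_antiM_leftM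
  mul_projN := antiM_mul_projN
  apply_al_zero := by
    rw [← projN_oneVec, mulVec_mulVec, antiM_mul_projN, antiM_oneVec]
  anticomm := by
    simp only [antiM, antiNN, antiMNM, Matrix.add_mul, Matrix.mul_add, Matrix.smul_mul,
      Matrix.mul_smul, mul_vecMulVec, vecMulVec_mul, vecMul_cheb, cheb_two_antiPlus,
      cheb_two_antiMinus, cheb_two_vecNull, cheb_two_vecTwo, cheb_two_vecTwoMN, cheb_two_antiMN,
      neg_vecMulVec, vecMulVec_neg]
    module

theorem cheb_two_sub₃ : cheb k 2 *ᵥ (e b3 - e c3) = e b1 - e c1 := by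
  rw [cheb_succ_succ, cheb_one_mulVec, cheb_zero_mulVec, mulVec_sub, adjM_b3, adjM_c3,
    mulVec_sub, adjM_b2, adjM_c2]
  abel

/-- The difference E of two solutions vanishes on everything that left multiplication reaches from
α_0. Being symmetric, it acts only on the span of β_1 - γ_1, β_3 - γ_3 and β̄_2 - γ̄_2.
Anticommutation with A² - 1 restricts it to exchanging eigenvalues, and commutation with left
multiplication kills what is left. -/
theorem IsAnti.unique {X Y : Matrix (Vtx k) (Vtx k) ℚ} (hX : IsAnti X) (hY : IsAnti Y) : X = Y := by
  set E := X - Y with hE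
  have hsymm : Eᵀ = E := by rw [hE, transpose_sub, hX.symm, hY.symm]
  have hL : ∀ v, E *ᵥ (leftM k *ᵥ v) = leftM k *ᵥ (E *ᵥ v) := fun v => by
    rw [mulVec_mulVec, mulVec_mulVec, (hX.comm.sub_left hY.comm).eq]
  have hM : ∀ x, rt x = .M → E *ᵥ e x = 0 := fun x hx => by
    have : E * projN k = E := by rw [hE, Matrix.sub_mul, hX.mul_projN, hY.mul_projN]
    rw [← this, ← mulVec_mulVec, projN_single, if_neg (by rw [hx]; simp), mulVec_zero]
  have h0 : E *ᵥ e (al 0) = 0 := by rw [hE, sub_mulVec, hX.apply_al_zero, hY.apply_al_zero, sub_self]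
  have hc : ∀ v, cheb k 2 *ᵥ (E *ᵥ v) = -(E *ᵥ (cheb k 2 *ᵥ v)) := fun v => by
    rw [mulVec_mulVec, mulVec_mulVec, ← neg_mulVec, hE, Matrix.mul_sub, hX.anticomm, hY.anticomm,
      Matrix.sub_mul]
    congr 1; abel
  have hdot : ∀ u v, (E *ᵥ u) ⬝ᵥ v = u ⬝ᵥ (E *ᵥ v) := fun u v => by
    rw [dotProduct_mulVec, ← mulVec_transpose, hsymm]
  have hal : ∀ j < 4 * k + 4, E *ᵥ e (al j) = 0 ∧ E *ᵥ e (al' j) = 0 := by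
    intro j
    induction j using cheb_induction with
    | h0 => exact fun _ => ⟨h0, hM _ (by rw [rt_al' (by omega)]; simp)⟩
    | h1 =>
      refine fun _ => ⟨hM _ (by rw [rt_al (by omega)]; simp), ?_⟩
      rw [← leftM_al_zero, hL, h0, mulVec_zero]
    | h j h h' =>
      intro hj
      have h1 := h (by omega)
      have h2 := h' (by omega)
      have h3 := hL (e (al' (j + 1)))
      have h4 := hL (e (al (j + 1)))
      rw [leftM_al'_succ hj, h2.2, mulVec_zero, mulVec_add, h1.1, zero_add] at h3
      rw [leftM_al_succ hj, h2.1, mulVec_zero, mulVec_add, h1.2, zero_add] at h4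
      exact ⟨h3, h4⟩
  have hs1 : E *ᵥ (e b1 + e c1) = 0 := by
    have := hL (e (al' (4 * k + 3)))
    rw [leftM_al'_last, (hal _ (by omega)).2, mulVec_zero, mulVec_add, mulVec_add,
      (hal _ (by omega)).1, zero_add] at this
    rw [mulVec_add, this]
  have hsb : E *ᵥ (e bb + e cb) = 0 := by
    have := hL (e b1 + e c1)
    rw [hs1, mulVec_zero, mulVec_add, leftM_b1, leftM_c1, mulVec_add, mulVec_add, mulVec_add,
      (hal _ (by omega)).2, zero_add, zero_add] at this
    rw [mulVec_add, this]
  have hs3 : E *ᵥ (e b3 + e c3) = 0 := by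
    have := hL (e bb + e cb)
    rw [hsb, mulVec_zero, mulVec_add, leftM_bb, leftM_cb,
      show e b1 + e c3 + (e c1 + e b3) = e b1 + e c1 + (e b3 + e c3 : Vtx k → ℚ) by abel, mulVec_add,
      hs1, zero_add] at this
    exact this
  -- The image of a symmetric matrix is orthogonal to its kernel, which contains all sums over the
  -- legs.
  have hform : ∀ v, E *ᵥ v = (E *ᵥ v) b1 • (e b1 - e c1) + (E *ᵥ v) b3 • (e b3 - e c3) +
      (E *ᵥ v) bb • (e bb - e cb) := by
    intro v
    have hker : ∀ u, E *ᵥ u = 0 → (E *ᵥ v) ⬝ᵥ u = 0 := fun u hu => by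
      rw [hdot, hu, dotProduct_zero]
    have k1 := hker _ hs1
    have k2 := hker _ hs3
    have k3 := hker _ hsb
    rw [dotProduct_add, dot_single, dot_single] at k1 k2 k3
    have kz : ∀ z, E *ᵥ e z = 0 → (E *ᵥ v) z = 0 := fun z hz => by
      rw [← dot_single (E *ᵥ v), hker _ hz]
    ext z
    induction z using cases_vtx with
    | hal j hj => rw [kz _ (hal j hj).1]; simp [al]
    | hal' j hj => rw [kz _ (hal j hj).2]; simp [al']
    | hb2 => rw [kz _ (hM _ (by simp))]; simp
    | hc2 => rw [kz _ (hM _ (by simp))]; simp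
    | hf => rw [kz _ (hM _ (by simp))]; simp
    | hg => rw [kz _ (hM _ (by simp))]; simp
    | _ => simp [-mulVec_single] <;> linarith
  have hcheb : ∀ v, cheb k 2 *ᵥ (E *ᵥ v) = (E *ᵥ v) b1 • (e b3 - e c3) +
      (E *ᵥ v) b3 • (e b1 - e c1) - (E *ᵥ v) bb • (e bb - e cb) := fun v => by
    conv_lhs => rw [hform v]
    rw [mulVec_add, mulVec_add, mulVec_smul, mulVec_smul, mulVec_smul, cheb_two_sub, cheb_two_sub₃,
      show (e bb - e cb : Vtx k → ℚ) = antiMN k from rfl, cheb_two_antiMN]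
    module
  -- U_2(A) is -1 on `antiMN`, so the image has eigenvalue 1 and is a multiple of `antiPlus`. In the
  -- same way `antiPlus` is sent into the span of `antiMinus` and `antiMN`.
  have hdb : (E *ᵥ antiMN k) b1 = (E *ᵥ antiMN k) b3 ∧ (E *ᵥ antiMN k) bb = 0 := by
    have h1 := hc (antiMN k)
    rw [cheb_two_antiMN, mulVec_neg, neg_neg, hcheb] at h1
    have h2 := congrFun h1 b1
    have h3 := congrFun h1 bb
    simp [-mulVec_single] at h2 h3
    exact ⟨h2.symm, by linarith⟩
  have hdp : (E *ᵥ antiPlus k) b1 = -(E *ᵥ antiPlus k) b3 := by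
    have h1 := hc (antiPlus k)
    rw [cheb_two_antiPlus, hcheb] at h1
    have h2 := congrFun h1 b3
    simpa [-mulVec_single] using h2
  have hdb' : E *ᵥ antiMN k = (E *ᵥ antiMN k) b1 • antiPlus k := by
    conv_lhs => rw [hform, ← hdb.1, hdb.2]
    rw [antiPlus]; module
  have hdp' : E *ᵥ antiPlus k = (E *ᵥ antiPlus k) b1 • antiMinus k +
      (E *ᵥ antiPlus k) bb • antiMN k := by
    conv_lhs => rw [hform, show (E *ᵥ antiPlus k) b3 = -(E *ᵥ antiPlus k) b1 by rw [hdp, neg_neg]]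
    rw [antiMinus, antiMN]; module
  -- `antiMinus` is the left translate of `antiMN`, whose image is a multiple of `antiPlus`, and
  -- left multiplication kills that.
  have hdm : E *ᵥ antiMinus k = 0 := by
    rw [← leftM_antiMN, hL, hdb', mulVec_smul, leftM_antiPlus, smul_zero]
  have hdp0 : E *ᵥ antiPlus k = 0 := by
    have h1 : (E *ᵥ antiPlus k) b1 = 0 := by
      have h := hdot (antiPlus k) (antiMinus k)
      rw [hdm, dotProduct_zero, antiMinus, dotProduct_sub, dotProduct_sub, dotProduct_sub,
        dot_single, dot_single, dot_single, dot_single, hdp'] at h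
      simp [antiMinus, antiMN, -mulVec_single] at h
      linarith
    have h2 : (E *ᵥ antiPlus k) bb = 0 := by
      have h := hL (antiPlus k)
      rw [leftM_antiPlus, mulVec_zero, hdp', h1, zero_smul, zero_add, mulVec_smul, leftM_antiMN] at h
      have h' := congrFun h b1
      simpa [antiMinus, -mulVec_single] using h'.symm
    rw [hdp', h1, h2, zero_smul, zero_smul, zero_add]
  have hdb0 : E *ᵥ antiMN k = 0 := by
    have h := hdot (antiMN k) (antiPlus k)
    rw [hdp0, dotProduct_zero, antiPlus, dotProduct_add, dotProduct_sub, dotProduct_sub,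
      dot_single, dot_single, dot_single, dot_single, hdb'] at h
    have h1 : (E *ᵥ antiMN k) b1 = 0 := by
      simp [antiPlus, -mulVec_single] at h
      linarith
    rw [hdb', h1, zero_smul]
  have hE0 : E = 0 := by
    refine ext_single fun x => ?_
    rw [zero_mulVec]
    have comb : ∀ {u v w : Vtx k → ℚ} (a b c : ℚ) {y : Vtx k → ℚ}, y = a • u + b • v + c • w →
        E *ᵥ u = 0 → E *ᵥ v = 0 → E *ᵥ w = 0 → E *ᵥ y = 0 := by
      rintro u v w a b c _ rfl hu hv hw
      rw [mulVec_add, mulVec_add, mulVec_smul, mulVec_smul, mulVec_smul, hu, hv, hw]; simp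
    induction x using cases_vtx with
    | hal j hj => exact (hal j hj).1
    | hal' j hj => exact (hal j hj).2
    | hb1 => exact comb (1 / 2) (1 / 4) (1 / 4) (by rw [antiPlus, antiMinus]; module) hs1 hdp0 hdm
    | hc1 =>
      exact comb (1 / 2) (-1 / 4) (-1 / 4) (by rw [antiPlus, antiMinus]; module) hs1 hdp0 hdm
    | hb3 =>
      exact comb (1 / 2) (1 / 4) (-1 / 4) (by rw [antiPlus, antiMinus]; module) hs3 hdp0 hdm
    | hc3 =>
      exact comb (1 / 2) (-1 / 4) (1 / 4) (by rw [antiPlus, antiMinus]; module) hs3 hdp0 hdm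
    | hbb => exact comb (1 / 2) (1 / 2) 0 (by rw [antiMN]; module) hsb hdb0 hdb0
    | hcb => exact comb (1 / 2) (-1 / 2) 0 (by rw [antiMN]; module) hsb hdb0 hdb0
    | _ => exact hM _ (by simp)
  exact sub_eq_zero.1 hE0

/-! ### Rigidity: every compatible based ring is the constructed one. -/

/-- A based ring on `Vtx k` in which right multiplication by `α_1` and `ᾱ_1` is given by the two
graphs, with structure constants `c` and involution `K`. -/
structure GraphModel (k : ℕ) (c : Vtx k → Vtx k → Vtx k → ℚ) (K : Equiv.Perm (Vtx k)) : Prop where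
  nat : ∀ x y z, ∃ n : ℕ, c x y z = n
  support : ∀ x y z, c x y z ≠ 0 → lt z = lt x ∧ rt z = rt y ∧ rt x = lt y
  assoc : ∀ x y z v, ∑ w, c x y w * c w z v = ∑ w, c y z w * c x w v
  invol : ∀ x, K (K x) = x
  lt_K : ∀ x, lt (K x) = rt x
  conj_right : ∀ x y z, c x y z = c z (K y) x
  conj : ∀ x y z, c x y z = c (K y) (K x) (K z)
  al_zero : ∀ x z, rt x = .N → c x (al 0) z = e x z
  al'_zero : ∀ x z, rt x = .M → c x (al' 0) z = e x z
  al_one : ∀ x z, rt x = .N → c x (al 1) z = adjM k z x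
  al'_one : ∀ x z, rt x = .M → c x (al' 1) z = adjM k z x
  K_al_zero : K (al 0) = al 0
  K_al'_zero : K (al' 0) = al' 0
  K_al : ∀ j < 4 * k + 4, Odd j → K (al j) = al' j
  K_b2 : K b2 = bb
  K_c2 : K c2 = cb

namespace GraphModel

variable {c : Vtx k → Vtx k → Vtx k → ℚ} {K : Equiv.Perm (Vtx k)} (h : GraphModel k c K)

/-- The matrix of right multiplication by a basis element. -/
def mat (c : Vtx k → Vtx k → Vtx k → ℚ) (y : Vtx k) : Matrix (Vtx k) (Vtx k) ℚ :=
  Matrix.of fun z x => c x y z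

theorem mat_apply (y z x : Vtx k) : mat c y z x = c x y z := rfl

/-- The matrix of right multiplication by a vector. -/
def matV (c : Vtx k → Vtx k → Vtx k → ℚ) : (Vtx k → ℚ) →ₗ[ℚ] Matrix (Vtx k) (Vtx k) ℚ :=
  Fintype.linearCombination ℚ (mat c)

theorem matV_single (y : Vtx k) : matV c (e y) = mat c y := by
  simp [matV, Fintype.linearCombination_apply_single]

theorem matV_eq_sum (v : Vtx k → ℚ) : matV c v = ∑ w, v w • mat c w :=
  Fintype.linearCombination_apply ℚ (mat c) v

section
include h

theorem rt_K (x : Vtx k) : rt (K x) = lt x := by rw [← h.lt_K, h.invol]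

/-- This is associativity, read as a statement about matrices of right multiplication. -/
theorem mat_mul_mat (y z : Vtx k) : mat c z * mat c y = matV c (mat c z *ᵥ e y) := by
  ext v x
  rw [Matrix.mul_apply, matV_eq_sum, Matrix.sum_apply, e, mulVec_single_one]
  simp only [Matrix.smul_apply, mat_apply, smul_eq_mul, Matrix.col_apply]
  rw [← h.assoc]
  exact Finset.sum_congr rfl fun w _ => mul_comm _ _

theorem adjM_eq : adjM k = mat c (al 1) + mat c (al' 1) := by
  ext z x
  rw [Matrix.add_apply, mat_apply, mat_apply]
  cases hx : rt x
  · rw [h.al_one x z hx]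
    have : c x (al' 1) z = 0 := by
      by_contra h0
      have := (h.support _ _ _ h0).2.2
      rw [hx, lt_al'] at this
      cases this
    rw [this, add_zero]
  · rw [h.al'_one x z hx]
    have : c x (al 1) z = 0 := by
      by_contra h0
      have := (h.support _ _ _ h0).2.2
      rw [hx, lt_al] at this
      cases this
    rw [this, zero_add]

theorem adjM_mul_matV (v : Vtx k → ℚ) : adjM k * matV c v = matV c (adjM k *ᵥ v) := by
  have hy : ∀ y, adjM k * mat c y = matV c (adjM k *ᵥ e y) := fun y => by
    rw [h.adjM_eq, Matrix.add_mul, h.mat_mul_mat, h.mat_mul_mat, add_mulVec, map_add]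
  have hv : v = ∑ y, v y • e y := by
    ext z
    rw [Finset.sum_apply, Finset.sum_eq_single z]
    · simp
    · intro y _ hy; rw [Pi.smul_apply, single_apply_ne hy.symm, smul_zero]
    · simp
  conv_rhs => rw [hv, mulVec_sum, map_sum]
  rw [matV_eq_sum, Finset.mul_sum]
  refine Finset.sum_congr rfl fun y _ => ?_
  rw [Matrix.mul_smul, hy, mulVec_smul, map_smul]

theorem mat_al_zero : mat c (al 0) = projN k := by
  refine ext_single fun x => ?_
  ext z
  rw [projN_single, e, mulVec_single_one]
  change c x (al 0) z = _
  split_ifs with hx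
  · exact h.al_zero x z hx
  · by_contra h0
    exact hx ((h.support _ _ _ h0).2.2)

theorem mat_al'_zero : mat c (al' 0) = 1 - projN k := by
  refine ext_single fun x => ?_
  ext z
  rw [sub_mulVec, one_mulVec, projN_single, e, mulVec_single_one]
  change c x (al' 0) z = _
  split_ifs with hx
  · rw [sub_self]
    by_contra h0
    have := (h.support _ _ _ h0).2.2
    rw [hx, lt_al'] at this
    cases this
  · rw [sub_zero]
    refine h.al'_zero x z ?_
    cases hx' : rt x
    · exact absurd hx' hx
    · rfl

theorem matV_one : matV c (oneVec k) = 1 := by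
  rw [oneVec, map_add, matV_single, matV_single, h.mat_al_zero, h.mat_al'_zero, add_sub_cancel]

theorem matV_cheb (m : ℕ) (v : Vtx k → ℚ) : matV c (cheb k m *ᵥ v) = cheb k m * matV c v := by
  induction m using cheb_induction with
  | h0 => rw [cheb_zero_mulVec, cheb, Matrix.one_mul]
  | h1 => exact (h.adjM_mul_matV v).symm
  | h m h1 h2 =>
    rw [cheb_succ_succ, map_sub, ← h.adjM_mul_matV, h1, h2, cheb, Matrix.sub_mul, Matrix.mul_assoc]

theorem transpose_mat (y : Vtx k) : (mat c y)ᵀ = mat c (K y) := by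
  ext z x
  rw [transpose_apply, mat_apply, mat_apply, h.conj_right]

/-- Right multiplication commutes with left multiplication by `α_1 + ᾱ_1`. -/
theorem commute_mat (y : Vtx k) : Commute (mat c y) ((adjM k).submatrix K K) := by
  have hl : ∀ x, Commute (mat c y) ((mat c x).submatrix K K) := by
    intro x
    rw [commute_iff_eq]
    have hx : (mat c x).submatrix K K = Matrix.of fun z w => c (K x) w z := by
      ext z w
      rw [submatrix_apply, mat_apply, Matrix.of_apply, h.conj, h.invol, h.invol]
    rw [hx]
    ext v w
    rw [Matrix.mul_apply, Matrix.mul_apply]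
    simp only [mat_apply, Matrix.of_apply]
    have := h.assoc (K x) w y v
    rw [show ∑ j, c j y v * c (K x) w j = ∑ j, c (K x) w j * c j y v from
      Finset.sum_congr rfl fun _ _ => mul_comm _ _, this]
    exact Finset.sum_congr rfl fun _ _ => mul_comm _ _
  rw [h.adjM_eq, submatrix_add]
  exact (hl _).add_right (hl _)

theorem left_mulVec (v : Vtx k → ℚ) :
    (adjM k).submatrix K K *ᵥ v = (adjM k *ᵥ (v ∘ K)) ∘ K :=
  Generates.submatrix_mulVec K h.invol _ _

theorem single_comp (x : Vtx k) : e x ∘ K = e (K x) := by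
  ext y
  by_cases hy : y = K x
  · subst hy; simp [h.invol]
  · have : K y ≠ x := fun h' => hy (by rw [← h', h.invol])
    rw [Function.comp_apply, single_apply_ne this, single_apply_ne hy]

theorem commute_adjM_left : Commute (adjM k) ((adjM k).submatrix K K) := by
  nth_rewrite 1 [h.adjM_eq]
  exact (h.commute_mat _).add_left (h.commute_mat _)

theorem K_al_one : K (al 1) = al' 1 := h.K_al 1 (by omega) odd_one

theorem K_al'_one : K (al' 1) = al 1 := by rw [← h.K_al_one, h.invol]

/-- α_1 + ᾱ_1 is self-conjugate, and left and right multiplication by it commute and agree on the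
identity. They therefore agree on every polynomial in it, and such polynomials are self-conjugate.
This is the main constraint on the unknown involution. -/
theorem cheb_one_comp (m : ℕ) : (cheb k m *ᵥ oneVec k) ∘ K = cheb k m *ᵥ oneVec k := by
  have key : (cheb k m *ᵥ oneVec k) ∘ K = cheb k m *ᵥ oneVec k ∧
      (adjM k).submatrix K K *ᵥ (cheb k m *ᵥ oneVec k) = adjM k *ᵥ (cheb k m *ᵥ oneVec k) := by
    have step : ∀ v, v ∘ K = v → (adjM k).submatrix K K *ᵥ v = adjM k *ᵥ v →
        (adjM k *ᵥ v) ∘ K = adjM k *ᵥ v ∧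
        (adjM k).submatrix K K *ᵥ (adjM k *ᵥ v) = adjM k *ᵥ (adjM k *ᵥ v) := by
      intro v h1 h2
      refine ⟨?_, ?_⟩
      · conv_rhs => rw [← h2]
        rw [h.left_mulVec, h1]
      · rw [mulVec_mulVec, ← h.commute_adjM_left.eq, ← mulVec_mulVec, h2]
    have h0 : oneVec k ∘ K = oneVec k ∧
        (adjM k).submatrix K K *ᵥ oneVec k = adjM k *ᵥ oneVec k := by
      have h1 : oneVec k ∘ K = oneVec k := by
        rw [oneVec, show (e (al 0) + e (al' 0) : Vtx k → ℚ) ∘ K = e (al 0) ∘ K + e (al' 0) ∘ K from rfl,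
          h.single_comp, h.single_comp, h.K_al_zero, h.K_al'_zero]
      refine ⟨h1, ?_⟩
      rw [h.left_mulVec, h1, adjM_oneVec,
        show (e (al 1) + e (al' 1) : Vtx k → ℚ) ∘ K = e (al 1) ∘ K + e (al' 1) ∘ K from rfl,
        h.single_comp, h.single_comp, h.K_al_one, h.K_al'_one, add_comm]
    induction m using cheb_induction with
    | h0 => rw [cheb_zero_mulVec]; exact h0
    | h1 => exact step _ h0.1 h0.2
    | h m h1 h2 =>
      obtain ⟨h3, h4⟩ := step _ h2.1 h2.2
      rw [cheb_succ_succ]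
      refine ⟨?_, ?_⟩
      · conv_rhs => rw [← h3, ← h1.1]
        rfl
      · rw [mulVec_sub, mulVec_sub, h4, h1.2]
  exact key.1

theorem cheb_one_apply (m : ℕ) (x : Vtx k) :
    (cheb k m *ᵥ oneVec k) (K x) = (cheb k m *ᵥ oneVec k) x :=
  congrFun (h.cheb_one_comp m) x

end

theorem cheb_oneVec {j : ℕ} (hj : j < 4 * k + 4) :
    cheb k j *ᵥ oneVec k = e (al j) + e (al' j) := by
  rw [oneVec, mulVec_add, cheb_al hj, cheb_al' hj]

theorem cheb_oneVec_next : cheb k (4 * k + 4) *ᵥ oneVec k = e b1 + e c1 + (e vf + e vg) := by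
  rw [oneVec, mulVec_add, cheb_al_zero_next, cheb_al'_zero_next]

theorem cheb_oneVec_next₂ : cheb k (4 * k + 6) *ᵥ oneVec k =
    e (al (4 * k + 2)) + e b1 + e c1 + e b3 + e c3 + (e (al' (4 * k + 2)) + (2 : ℚ) • e vg) := by
  rw [oneVec, mulVec_add, cheb_al_zero_next₂]
  congr 1
  rw [cheb_succ_succ, cheb_al'_zero_next', cheb_al'_zero_next, mulVec_add, mulVec_add,
    adjM_al'_last, adjM_bb, adjM_cb]
  module

section
include h

/-- U_j(A)·1 = α_j + α'_j is invariant, and the two summands are told apart by their left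
coefficients. -/
theorem K_al_even {j : ℕ} (hj : j < 4 * k + 4) (hj' : Even j) : K (al j) = al j := by
  have h1 := h.cheb_one_apply j (al j)
  have h2 : lt (K (al j)) = .N := by rw [h.lt_K, rt_al hj, if_pos hj']
  rw [cheb_oneVec hj] at h1
  by_contra hne
  have hne' : K (al j) ≠ al' j := fun h0 => by rw [h0, lt_al'] at h2; cases h2
  rw [Pi.add_apply, single_apply_ne hne, single_apply_ne hne'] at h1
  simp [al, al'] at h1

theorem K_al'_even {j : ℕ} (hj : j < 4 * k + 4) (hj' : Even j) : K (al' j) = al' j := by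
  have h1 := h.cheb_one_apply j (al' j)
  have h2 : lt (K (al' j)) = .M := by rw [h.lt_K, rt_al' hj, if_pos hj']
  rw [cheb_oneVec hj] at h1
  by_contra hne
  have hne' : K (al' j) ≠ al j := fun h0 => by rw [h0, lt_al] at h2; cases h2
  rw [Pi.add_apply, single_apply_ne hne, single_apply_ne hne'] at h1
  simp [al, al'] at h1

theorem K_b1_or {x : Vtx k} (hx : x = b1 ∨ x = c1) : K x = b1 ∨ K x = c1 := by
  have h1 := h.cheb_one_apply (4 * k + 4) x
  have h2 : lt (K x) = .N := by rw [h.lt_K]; rcases hx with rfl | rfl <;> simp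
  rw [cheb_oneVec_next] at h1
  by_contra hne
  rw [not_or] at hne
  have hf : K x ≠ vf := fun h0 => by rw [h0] at h2; cases h2
  have hg : K x ≠ vg := fun h0 => by rw [h0] at h2; cases h2
  simp only [Pi.add_apply] at h1
  rw [single_apply_ne hne.1, single_apply_ne hne.2, single_apply_ne hf, single_apply_ne hg] at h1
  rcases hx with rfl | rfl <;> simp at h1

/-- In U_{n+3}(A)·1 the vertex g is the only one with coefficient 2. -/
theorem K_vg : K vg = vg := by
  have h1 := h.cheb_one_apply (4 * k + 6) vg
  rw [cheb_oneVec_next₂] at h1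
  have h2 : lt (K vg) = .M := by rw [h.lt_K]; simp
  by_contra hne
  have hz : ∀ y : Vtx k, lt y = .N → e y (K vg) = 0 := fun y hy => single_apply_ne (by
    rintro rfl; rw [hy] at h2; cases h2)
  simp only [Pi.add_apply, Pi.smul_apply] at h1
  rw [hz _ (lt_al _), hz b1 rfl, hz c1 rfl, hz b3 rfl, hz c3 rfl, single_apply_ne hne] at h1
  by_cases h3 : K vg = al' (4 * k + 2)
  · rw [h3] at h1
    simp [al, al'] at h1
  · rw [single_apply_ne h3] at h1
    simp [al, al'] at h1

theorem K_vf : K vf = vf := by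
  have h1 := h.cheb_one_apply (4 * k + 4) vf
  have h2 : lt (K vf) = .M := by rw [h.lt_K]; simp
  rw [cheb_oneVec_next] at h1
  by_contra hne
  have hz : ∀ y : Vtx k, lt y = .N → e y (K vf) = 0 := fun y hy => single_apply_ne (by
    rintro rfl; rw [hy] at h2; cases h2)
  have hg : K vf ≠ vg := fun h0 => by
    have := h.invol vf
    rw [h0, h.K_vg] at this
    cases this
  simp only [Pi.add_apply] at h1
  rw [hz b1 rfl, hz c1 rfl, single_apply_ne hne, single_apply_ne hg] at h1
  simp at h1

theorem K_b3_or {x : Vtx k} (hx : x = b3 ∨ x = c3) : K x = b3 ∨ K x = c3 := by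
  have h1 := h.cheb_one_apply (4 * k + 6) x
  have h2 : lt (K x) = .N := by rw [h.lt_K]; rcases hx with rfl | rfl <;> simp
  have hKx : K (K x) = x := h.invol x
  rw [cheb_oneVec_next₂] at h1
  by_contra hne
  rw [not_or] at hne
  have hz : ∀ y : Vtx k, lt y = .M → e y (K x) = 0 := fun y hy => single_apply_ne (by
    rintro rfl; rw [hy] at h2; cases h2)
  have ha : K x ≠ al (4 * k + 2) := fun h0 => by
    rw [h0, h.K_al_even (by omega) even_before_last] at hKx
    rcases hx with rfl | rfl <;> simp [al] at hKx
  have hb : K x ≠ b1 := fun h0 => by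
    have := h.K_b1_or (.inl h0)
    rw [hKx] at this
    rcases hx with rfl | rfl <;> simp at this
  have hc : K x ≠ c1 := fun h0 => by
    have := h.K_b1_or (.inr h0)
    rw [hKx] at this
    rcases hx with rfl | rfl <;> simp at this
  simp only [Pi.add_apply, Pi.smul_apply] at h1
  rw [hz _ (lt_al' _), hz vg rfl, single_apply_ne hne.1, single_apply_ne hne.2, single_apply_ne ha,
    single_apply_ne hb, single_apply_ne hc] at h1
  rcases hx with rfl | rfl <;> simp [al, al'] at h1

/-- If β_1 and γ_1 were conjugate, reciprocity would give them equal coefficients of β̄_2 in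
β̄_2·β_1 and β̄_2·γ_1, with an even sum. That sum is a diagonal entry of U_{n+1}(A), which is odd by
`wave_betaBar` and `trib_mod_four`. -/
theorem K_b1 : K b1 = b1 := by
  rcases h.K_b1_or (.inl rfl) with h0 | h0
  · exact h0
  exfalso
  have h1 := h.matV_cheb (4 * k + 4) (oneVec k)
  rw [cheb_oneVec_next, h.matV_one, Matrix.mul_one, map_add, map_add, map_add, matV_single,
    matV_single, matV_single, matV_single] at h1
  have h2 := congrFun (congrFun h1 bb) bb
  simp only [Matrix.add_apply, mat_apply] at h2
  -- β̄_2 has right coefficient N, so f and g do not contribute to the product with β_1 + γ_1 + f +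
  -- g.
  have hz : ∀ y : Vtx k, lt y = .M → c bb y bb = 0 := fun y hy => by
    by_contra h3
    have := (h.support _ _ _ h3).2.2
    rw [hy] at this
    simp at this
  obtain ⟨n, hn⟩ := h.nat bb b1 bb
  have h3 := h.conj_right bb b1 bb
  rw [h0] at h3
  rw [hz vf rfl, hz vg rfl, ← h3, hn] at h2
  have h4 := (wave_betaBar (branchWave'_bb (k := k)) (cheb_zero_mulVec _) adjM_bb (2 * k + 2)
    (by omega)).1.2.2.2.1
  rw [show 0 + 2 * (2 * k + 2) = 4 * k + 4 by ring, mulVec_single_one] at h4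
  change cheb k (4 * k + 4) bb bb = _ at h4
  rw [h4, Even.neg_one_pow ⟨k + 1, by ring⟩] at h2
  have h5 : ∃ a c : ℕ, trib (2 * k + 2) + trib (2 * k + 2 + 2) = 4 * a + 4 * c + 1 := by
    rcases Nat.even_or_odd' k with ⟨m, hm | hm⟩
    · obtain ⟨-, -, c, -, -, hc⟩ := trib_mod_four m
      obtain ⟨a, -, -, ha, -, -⟩ := trib_mod_four (m + 1)
      refine ⟨a, c, ?_⟩
      rw [show 2 * k + 2 = 4 * m + 2 by omega, hc, show 4 * m + 2 + 2 = 4 * (m + 1) by ring, ha]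
      ring
    · obtain ⟨a, -, c, ha, -, hc⟩ := trib_mod_four (m + 1)
      refine ⟨a, c, ?_⟩
      rw [show 2 * k + 2 = 4 * (m + 1) by omega, ha, hc]
      ring
  obtain ⟨a, c', hac⟩ := h5
  rw [hac] at h2
  have h6 : n + n = 2 * (a + c') + 1 := by
    have : (n + n : ℚ) = 2 * (a + c') + 1 := by linarith
    exact_mod_cast this
  omega

theorem K_c1 : K c1 = c1 := by
  rcases h.K_b1_or (.inr rfl) with h0 | h0
  · have := h.invol c1
    rw [h0, h.K_b1] at this
    cases this
  · exact h0

/-- If β_3 were self-conjugate, the two orders of left and right multiplication by α_1 + ᾱ_1 would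
send β̄_2 to vectors with different coefficients of β_2, namely 2 and 1. -/
theorem K_b3 : K b3 = c3 := by
  rcases h.K_b3_or (.inl rfl) with h0 | h0
  · exfalso
    have h1 := congrArg (· *ᵥ e bb) h.commute_adjM_left.eq
    simp only [← mulVec_mulVec] at h1
    have hbb : K bb = b2 := by rw [← h.K_b2, h.invol]
    have hcb : K cb = c2 := by rw [← h.K_c2, h.invol]
    have hl' : K (al' (4 * k + 3)) = al (4 * k + 3) := by
      rw [← h.K_al _ (by omega) (Nat.not_even_iff_odd.1 not_even_last), h.invol]
    have hadd : ∀ u v : Vtx k → ℚ, (u + v) ∘ K = u ∘ K + v ∘ K := fun _ _ => rfl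
    rw [adjM_bb, h.left_mulVec, h.left_mulVec, h.single_comp, h.single_comp, hbb, h.K_vg, adjM_b2,
      adjM_vg, hadd, hadd, hadd, h.single_comp, h.single_comp, h.single_comp, h.single_comp,
      h.single_comp, hbb, hcb, hl', h.K_b1, h0, mulVec_add, adjM_b1, adjM_b3] at h1
    have h2 := congrFun h1 b2
    simp [al] at h2
  · exact h0

theorem eq_conj : K = Vtx.conj k := by
  ext x
  induction x using cases_vtx with
  | hal j hj =>
    by_cases hj' : Even j
    · rw [h.K_al_even hj hj', conj_al_even hj hj']
    · rw [h.K_al j hj (Nat.not_even_iff_odd.1 hj'), conj_al_odd hj hj']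
  | hal' j hj =>
    by_cases hj' : Even j
    · rw [h.K_al'_even hj hj', conj_al'_even hj hj']
    · rw [← h.K_al j hj (Nat.not_even_iff_odd.1 hj'), h.invol,
        h.K_al j hj (Nat.not_even_iff_odd.1 hj'), conj_al'_odd hj hj']
  | hb1 => rw [h.K_b1, conj_b1]
  | hb2 => rw [h.K_b2, conj_b2]
  | hb3 => rw [h.K_b3, conj_b3]
  | hc1 => rw [h.K_c1, conj_c1]
  | hc2 => rw [h.K_c2, conj_c2]
  | hc3 => rw [← h.K_b3, h.invol, h.K_b3, conj_c3]
  | hf => rw [h.K_vf, conj_vf]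
  | hg => rw [h.K_vg, conj_vg]
  | hbb => rw [← h.K_b2, h.invol, h.K_b2, conj_bb]
  | hcb => rw [← h.K_c2, h.invol, h.K_c2, conj_cb]

theorem isAnti : IsAnti (mat c b1 - mat c c1) where
  symm := by
    rw [transpose_sub, h.transpose_mat, h.transpose_mat, h.K_b1, h.K_c1]
  comm := by
    have h1 := fun y => h.commute_mat y
    rw [h.eq_conj] at h1
    exact (h1 _).sub_left (h1 _)
  mul_projN := by
    refine ext_single fun x => ?_
    rw [← mulVec_mulVec, projN_single]
    split_ifs with hx
    · rfl
    · have hz : ∀ y : Vtx k, lt y = .N → mat c y *ᵥ e x = 0 := fun y hy => by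
        ext z
        rw [e, mulVec_single_one]
        change c x y z = 0
        by_contra h3
        have := (h.support _ _ _ h3).2.2
        rw [hy] at this
        exact hx this
      rw [mulVec_zero, sub_mulVec, hz b1 rfl, hz c1 rfl, sub_zero]
  apply_al_zero := by
    have hz : ∀ y : Vtx k, lt y = .N → K y = y → mat c y *ᵥ e (al 0) = e y := fun y hy hK => by
      ext z
      rw [e, mulVec_single_one]
      change c (al 0) y z = _
      rw [h.conj, h.K_al_zero, h.al_zero _ _ (by rw [h.rt_K, hy]), ← h.single_comp,
        Function.comp_apply, h.invol]
    rw [sub_mulVec, hz _ rfl h.K_b1, hz _ rfl h.K_c1]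
  anticomm := by
    have h1 := h.matV_cheb 2 (e b1 - e c1)
    rw [cheb_two_sub, map_sub, map_sub, matV_single, matV_single, matV_single, matV_single] at h1
    -- Transposition reverses the order of the factors and, by exchanging β_3 and γ_3, changes the
    -- sign of the product; this is the anticommutation.
    have h2 := congrArg transpose h1
    have hc3 : K c3 = b3 := by rw [← h.K_b3, h.invol]
    rw [transpose_sub, h.transpose_mat, h.transpose_mat, h.K_b3, hc3, transpose_mul, cheb_symm,
      transpose_sub, h.transpose_mat, h.transpose_mat, h.K_b1, h.K_c1] at h2
    rw [← h1, ← h2, neg_sub]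

/-- The map `matV c` commutes with the three generators, hence with their algebra. Since it sends
the identity vector to the identity matrix, it sends X·1 to X for every X in the algebra. -/
theorem matV_eq_R (v : Vtx k → ℚ) : matV c v = (generates k).R v := by
  have hD : mat c b1 - mat c c1 = antiM k := h.isAnti.unique isAnti_antiM
  have hmat : ∀ (z : Vtx k) (v), mat c z * matV c v = matV c (mat c z *ᵥ v) := by
    intro z v
    have hv : v = ∑ y, v y • e y := by
      ext z
      rw [Finset.sum_apply, Finset.sum_eq_single z]
      · simp
      · intro y _ hy; rw [Pi.smul_apply, single_apply_ne hy.symm, smul_zero]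
      · simp
    conv_rhs => rw [hv, mulVec_sum, map_sum]
    rw [matV_eq_sum, Finset.mul_sum]
    refine Finset.sum_congr rfl fun y _ => ?_
    rw [Matrix.mul_smul, h.mat_mul_mat, mulVec_smul, map_smul]
  have hgen : ∀ X ∈ gens k, ∀ v, matV c (X *ᵥ v) = X * matV c v := by
    rintro X (rfl | rfl | rfl) v
    · exact (h.adjM_mul_matV v).symm
    · rw [← hD, sub_mulVec, map_sub, ← hmat, ← hmat, Matrix.sub_mul]
    · rw [← h.mat_al_zero, hmat]
  have hadj : ∀ X ∈ Algebra.adjoin ℚ (gens k), ∀ v, matV c (X *ᵥ v) = X * matV c v := by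
    intro X hX
    induction hX using Algebra.adjoin_induction with
    | mem X hX => exact hgen X hX
    | algebraMap r =>
      intro v
      rw [Algebra.algebraMap_eq_smul_one, smul_mulVec, one_mulVec, map_smul, Matrix.smul_mul,
        Matrix.one_mul]
    | add X Y _ _ h1 h2 => intro v; rw [add_mulVec, map_add, h1, h2, Matrix.add_mul]
    | mul X Y _ _ h1 h2 => intro v; rw [← mulVec_mulVec, h1, h2, Matrix.mul_assoc]
  conv_lhs => rw [← (generates k).R_one v]
  rw [hadj _ ((generates k).R_mem v), h.matV_one, Matrix.mul_one]

theorem eq_coef (x y z : Vtx k) : c x y z = coef x y z := by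
  have h1 := h.matV_eq_R (e y)
  rw [matV_single] at h1
  rw [coef, vmul, Generates.mul_def, ← h1, e, mulVec_single_one]
  rfl

end

end GraphModel

/-! ### A compatible fusion ring as a based ring on all vertices. -/

namespace FusionRing

open V

variable (F : FusionRing (V k))

open Classical in
/-- The structure constants of a fusion ring on `V`, extended by zero to all triples of vertices. -/
noncomputable def coefVtx (x y z : Vtx k) : ℕ :=
  if h : lt z = lt x ∧ rt z = rt y ∧ rt x = lt y then
    F.N (ofVtx x rfl h.2.2) (ofVtx y rfl rfl) (ofVtx z h.1 h.2.1) else 0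

theorem coefVtx_toVtx {P Q R : Side} (a : V k P Q) (b : V k Q R) (c : V k P R) :
    F.coefVtx a.toVtx b.toVtx c.toVtx = F.N a b c := by
  -- The vertices are generalized so that P, Q, R can be replaced by their gradings and no casts
  -- remain.
  have key : ∀ (x y z : Vtx k) (a : V k P Q) (b : V k Q R) (c : V k P R), a.toVtx = x →
      b.toVtx = y → c.toVtx = z → F.coefVtx x y z = F.N a b c := by
    intro x y z a b c hx hy hz
    obtain rfl : lt x = P := by rw [← hx, lt_toVtx]
    obtain rfl : lt y = Q := by rw [← hy, lt_toVtx]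
    obtain rfl : rt y = R := by rw [← hy, rt_toVtx]
    have h : lt z = lt x ∧ rt z = rt y ∧ rt x = lt y := by
      rw [← hz, lt_toVtx, rt_toVtx]
      exact ⟨rfl, rfl, (congrArg rt hx).symm.trans (rt_toVtx a)⟩
    rw [coefVtx, dif_pos h]
    congr 1
    · exact toVtx_injective ((toVtx_ofVtx _ _ _).trans hx.symm)
    · exact toVtx_injective ((toVtx_ofVtx _ _ _).trans hy.symm)
    · exact toVtx_injective ((toVtx_ofVtx _ _ _).trans hz.symm)
  exact key _ _ _ a b c rfl rfl rfl

theorem coefVtx_ne_zero {x y z : Vtx k} (h : F.coefVtx x y z ≠ 0) :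
    lt z = lt x ∧ rt z = rt y ∧ rt x = lt y := by
  by_contra h'
  exact h (dif_neg h')

theorem coefVtx_of_not {x y z : Vtx k} (h : ¬(lt z = lt x ∧ rt z = rt y ∧ rt x = lt y)) :
    F.coefVtx x y z = 0 := dif_neg h

/-- The involution of a fusion ring on `V` as a map of vertices. -/
noncomputable def conjVtx (x : Vtx k) : Vtx k := (F.conj (ofVtx x rfl rfl)).toVtx

theorem conjVtx_toVtx {P Q : Side} (a : V k P Q) : F.conjVtx a.toVtx = (F.conj a).toVtx := by
  have key : ∀ (x : Vtx k) (a : V k P Q), a.toVtx = x → F.conjVtx x = (F.conj a).toVtx := by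
    intro x a hx
    obtain rfl : lt x = P := by rw [← hx, lt_toVtx]
    obtain rfl : rt x = Q := by rw [← hx, rt_toVtx]
    rw [conjVtx]
    congr 2
    exact toVtx_injective ((toVtx_ofVtx _ _ _).trans hx.symm)
  exact key _ a rfl

theorem lt_conjVtx (x : Vtx k) : lt (F.conjVtx x) = rt x := lt_toVtx _

theorem rt_conjVtx (x : Vtx k) : rt (F.conjVtx x) = lt x := rt_toVtx _

theorem conjVtx_conjVtx (x : Vtx k) : F.conjVtx (F.conjVtx x) = x := by
  conv_lhs => rw [← toVtx_ofVtx x rfl rfl]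
  rw [conjVtx_toVtx, conjVtx_toVtx, F.conj_conj, toVtx_ofVtx]

theorem exists_toVtx_triple {x y z : Vtx k} (h : lt z = lt x ∧ rt z = rt y ∧ rt x = lt y) :
    ∃ (P Q R : Side) (a : V k P Q) (b : V k Q R) (c : V k P R),
      a.toVtx = x ∧ b.toVtx = y ∧ c.toVtx = z :=
  ⟨_, _, _, ofVtx x rfl h.2.2, ofVtx y rfl rfl, ofVtx z h.1 h.2.1, toVtx_ofVtx _ _ _,
    toVtx_ofVtx _ _ _, toVtx_ofVtx _ _ _⟩

theorem coefVtx_conj_right (x y z : Vtx k) :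
    F.coefVtx x y z = F.coefVtx z (F.conjVtx y) x := by
  by_cases h : lt z = lt x ∧ rt z = rt y ∧ rt x = lt y
  · obtain ⟨P, Q, R, a, b, c, rfl, rfl, rfl⟩ := exists_toVtx_triple h
    rw [conjVtx_toVtx, coefVtx_toVtx, coefVtx_toVtx, F.frobenius₁]
  · rw [coefVtx_of_not F h, coefVtx_of_not]
    rw [lt_conjVtx, rt_conjVtx]
    exact fun h' => h ⟨h'.1.symm, h'.2.2, h'.2.1⟩

theorem coefVtx_conj (x y z : Vtx k) :
    F.coefVtx x y z = F.coefVtx (F.conjVtx y) (F.conjVtx x) (F.conjVtx z) := by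
  by_cases h : lt z = lt x ∧ rt z = rt y ∧ rt x = lt y
  · obtain ⟨P, Q, R, a, b, c, rfl, rfl, rfl⟩ := exists_toVtx_triple h
    rw [conjVtx_toVtx, conjVtx_toVtx, conjVtx_toVtx, coefVtx_toVtx, coefVtx_toVtx, F.frobenius₃]
  · rw [coefVtx_of_not F h, coefVtx_of_not]
    simp only [lt_conjVtx, rt_conjVtx]
    exact fun h' => h ⟨h'.2.1, h'.1, h'.2.2.symm⟩

theorem gradedProd_single {P Q R : Side} (a : V k P Q) (b : V k Q R) (z : V k P R) :
    gradedProd F.N (Pi.single a 1) (Pi.single b 1) z = F.N a b z := by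
  rw [gradedProd, Finset.sum_eq_single a, Finset.sum_eq_single b]
  · simp
  · intro y _ hy; simp [hy]
  · simp
  · intro x _ hx; simp [hx]
  · simp

theorem sum_N_mul_N {P Q R S : Side} (a : V k P Q) (b : V k Q R) (c : V k R S) (d : V k P S) :
    ∑ w, F.N a b w * F.N w c d = ∑ w, F.N b c w * F.N a w d := by
  have h := congrFun (F.mul_assoc (Pi.single a 1) (Pi.single b 1) (Pi.single c 1)) d
  have h1 : gradedProd F.N (Pi.single a 1) (Pi.single b 1) = fun w => (F.N a b w : ℤ) :=
    funext fun w => F.gradedProd_single a b w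
  have h2 : gradedProd F.N (Pi.single b 1) (Pi.single c 1) = fun w => (F.N b c w : ℤ) :=
    funext fun w => F.gradedProd_single b c w
  have hl : gradedProd F.N (fun w => (F.N a b w : ℤ)) (Pi.single c 1) d =
      ∑ w, (F.N a b w : ℤ) * F.N w c d := by
    refine Finset.sum_congr rfl fun w _ => ?_
    rw [Finset.sum_eq_single c]
    · simp
    · intro y _ hy; simp [hy]
    · simp
  have hr : gradedProd F.N (Pi.single a 1) (fun w => (F.N b c w : ℤ)) d =
      ∑ w, (F.N b c w : ℤ) * F.N a w d := by
    rw [gradedProd, Finset.sum_eq_single a]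
    · simp
    · intro y _ hy; simp [hy]
    · simp
  rw [h1, h2, hl, hr] at h
  exact_mod_cast h

theorem coefVtx_assoc (x y z v : Vtx k) :
    ∑ w, F.coefVtx x y w * F.coefVtx w z v = ∑ w, F.coefVtx y z w * F.coefVtx x w v := by
  by_cases h : rt x = lt y ∧ rt y = lt z ∧ lt v = lt x ∧ rt v = rt z
  · obtain ⟨h1, h2, h3, h4⟩ := h
    obtain ⟨a, ha⟩ := exists_toVtx x rfl h1
    obtain ⟨b, hb⟩ := exists_toVtx y rfl h2
    obtain ⟨c, hc⟩ := exists_toVtx z rfl rfl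
    obtain ⟨d, hd⟩ := exists_toVtx v h3 h4
    have hs := F.sum_N_mul_N a b c d
    simp only [← coefVtx_toVtx, ha, hb, hc, hd] at hs
    rwa [sum_toVtx (fun w => F.coefVtx x y w * F.coefVtx w z v) (fun w hw => by
        have hw' := F.coefVtx_ne_zero (left_ne_zero_of_mul hw)
        exact ⟨hw'.1, hw'.2.1.trans h2⟩),
      sum_toVtx (fun w => F.coefVtx y z w * F.coefVtx x w v) (fun w hw => by
        have hw' := F.coefVtx_ne_zero (left_ne_zero_of_mul hw)
        exact ⟨hw'.1, hw'.2.1⟩)] at hs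
  · rw [Finset.sum_eq_zero, Finset.sum_eq_zero]
    · intro w _
      by_contra hw
      have h1 := F.coefVtx_ne_zero (left_ne_zero_of_mul hw)
      have h2 := F.coefVtx_ne_zero (right_ne_zero_of_mul hw)
      exact h ⟨h2.2.2.trans h1.1, h1.2.2, h2.1, h2.2.1.trans h1.2.1⟩
    · intro w _
      by_contra hw
      have h1 := F.coefVtx_ne_zero (left_ne_zero_of_mul hw)
      have h2 := F.coefVtx_ne_zero (right_ne_zero_of_mul hw)
      exact h ⟨h1.2.2, h1.2.1.symm.trans h2.2.2, h2.1.trans h1.1, h2.2.1⟩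

theorem coefVtx_one (P : Side) {x z : Vtx k} (hx : rt x = P) :
    (F.coefVtx x (F.one P).toVtx z : ℚ) = e x z := by
  by_cases h : lt z = lt x ∧ rt z = P
  · obtain ⟨a, ha⟩ := exists_toVtx x rfl hx
    obtain ⟨c, hc⟩ := exists_toVtx z h.1 h.2
    rw [← ha, ← hc, coefVtx_toVtx, F.mul_one, single_toVtx]
  · rw [coefVtx_of_not, single_apply_ne, Nat.cast_zero]
    · rintro rfl; exact h ⟨rfl, hx⟩
    · rw [rt_toVtx]; exact fun h' => h ⟨h'.1, h'.2.1⟩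

/-- Reciprocity turns 1·1 = 1 into the statement that the conjugate of 1, multiplied by 1, contains
1. -/
theorem conj_one (P : Side) : F.conj (F.one P) = F.one P := by
  have h1 := F.frobenius₂ (F.one P) (F.one P) (F.one P)
  rw [F.one_mul, if_pos rfl, F.mul_one] at h1
  by_contra h
  rw [if_neg h] at h1
  cases h1

variable {F}

theorem coefVtx_alpha1 {x z : Vtx k} (hF : GraphCompatible k F) (hx : rt x = .N) :
    (F.coefVtx x (al 1) z : ℚ) = adjM k z x := by
  classical
  by_cases h : lt z = lt x ∧ rt z = .M
  · cases hl : lt x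
    · obtain ⟨a, rfl⟩ := exists_toVtx x hl hx
      obtain ⟨c, rfl⟩ := exists_toVtx z (h.1.trans hl) h.2
      rw [← toVtx_alpha1, coefVtx_toVtx, hF.edge_NN, adjM_toVtx]; rfl
    · obtain ⟨a, rfl⟩ := exists_toVtx x hl hx
      obtain ⟨c, rfl⟩ := exists_toVtx z (h.1.trans hl) h.2
      rw [← toVtx_alpha1, coefVtx_toVtx, hF.edge_MN, adjM_toVtx]; rfl
  · rw [← toVtx_alpha1, coefVtx_of_not, adjM_toVtx, if_neg]
    · intro ha
      refine h ⟨ha.lt_eq.symm, ?_⟩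
      have := ha.rt_ne
      rw [hx] at this
      cases hz : rt z
      · exact absurd hz.symm this
      · rfl
    · rw [rt_toVtx]; exact fun h' => h ⟨h'.1, h'.2.1⟩

theorem coefVtx_alpha1Bar {x z : Vtx k} (hF : GraphCompatible k F) (hx : rt x = .M) :
    (F.coefVtx x (al' 1) z : ℚ) = adjM k z x := by
  classical
  by_cases h : lt z = lt x ∧ rt z = .N
  · cases hl : lt x
    · obtain ⟨a, rfl⟩ := exists_toVtx x hl hx
      obtain ⟨c, rfl⟩ := exists_toVtx z (h.1.trans hl) h.2
      rw [← toVtx_alpha1Bar, coefVtx_toVtx, hF.edge_NM, adjM_toVtx]; rfl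
    · obtain ⟨a, rfl⟩ := exists_toVtx x hl hx
      obtain ⟨c, rfl⟩ := exists_toVtx z (h.1.trans hl) h.2
      rw [← toVtx_alpha1Bar, coefVtx_toVtx, hF.edge_MM, adjM_toVtx]; rfl
  · rw [← toVtx_alpha1Bar, coefVtx_of_not, adjM_toVtx, if_neg]
    · intro ha
      refine h ⟨ha.lt_eq.symm, ?_⟩
      have := ha.rt_ne
      rw [hx] at this
      cases hz : rt z
      · rfl
      · exact absurd hz.symm this
    · rw [rt_toVtx]; exact fun h' => h ⟨h'.1, h'.2.1⟩

theorem graphModel (hF : GraphCompatible k F) : GraphModel k (fun x y z => (F.coefVtx x y z : ℚ))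
    ⟨F.conjVtx, F.conjVtx, F.conjVtx_conjVtx, F.conjVtx_conjVtx⟩ where
  nat x y z := ⟨_, rfl⟩
  support x y z h := F.coefVtx_ne_zero (Nat.cast_ne_zero.1 h)
  assoc x y z v := by exact_mod_cast F.coefVtx_assoc x y z v
  invol := F.conjVtx_conjVtx
  lt_K := F.lt_conjVtx
  conj_right x y z := congrArg _ (F.coefVtx_conj_right x y z)
  conj x y z := congrArg _ (F.coefVtx_conj x y z)
  al_zero x z hx := by rw [← toVtx_alpha0, ← hF.one_N]; exact F.coefVtx_one _ hx
  al'_zero x z hx := by rw [← toVtx_alpha0', ← hF.one_M]; exact F.coefVtx_one _ hx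
  al_one x z hx := coefVtx_alpha1 hF hx
  al'_one x z hx := coefVtx_alpha1Bar hF hx
  K_al_zero := by
    change F.conjVtx (al 0) = al 0
    rw [← toVtx_alpha0, ← hF.one_N, conjVtx_toVtx, F.conj_one]
  K_al'_zero := by
    change F.conjVtx (al' 0) = al' 0
    rw [← toVtx_alpha0', ← hF.one_M, conjVtx_toVtx, F.conj_one]
  K_al j hj hj' := by
    change F.conjVtx (al j) = al' j
    have h := toVtx_alphaOdd (⟨j, hj⟩ : Fin (4 * k + 4)) hj'
    rw [show ((⟨j, hj⟩ : Fin (4 * k + 4)) : ℕ) = j from rfl] at h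
    rw [← h, conjVtx_toVtx, hF.conj_alpha, toVtx_alphaOddBar]
  K_b2 := by
    change F.conjVtx b2 = bb
    rw [← toVtx_beta2, conjVtx_toVtx, hF.conj_beta2, toVtx_beta2Bar]
  K_c2 := by
    change F.conjVtx c2 = cb
    rw [← toVtx_gamma2, conjVtx_toVtx, hF.conj_gamma2, toVtx_gamma2Bar]

theorem eq_graphFusionRing (hF : GraphCompatible k F) : F = graphFusionRing k := by
  have hm := graphModel hF
  refine FusionRing.ext ?_ ?_ ?_
  · funext P Q R a b c
    have h := hm.eq_coef a.toVtx b.toVtx c.toVtx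
    simp only [coefVtx_toVtx] at h
    exact (natCoef_eq_iff.2 h.symm).symm
  · funext P Q a
    refine toVtx_injective ?_
    have h := congrArg (fun s : Equiv.Perm (Vtx k) => s a.toVtx) hm.eq_conj
    change F.conjVtx _ = _ at h
    rw [conjVtx_toVtx] at h
    rw [h]
    exact (toVtx_conj a).symm
  · funext P
    cases P
    · exact hF.one_N
    · exact hF.one_M

end FusionRing

theorem theorem1p1 (k : ℕ) : ∃! F : FusionRing (V k), GraphCompatible k F := by
  exact ⟨graphFusionRing k, graphCompatible_graphFusionRing k,
    fun _ hF => FusionRing.eq_graphFusionRing hF⟩
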